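/- **Notation.** Write $\|\cdot\|$ for the norm of $L^2(\mathbb R^2;\mathbb C)$, $e_1=(1,0)$, and let $\Lambda^s$, $|D|^p$ be the Fourier multipliers with symbols $(1+|\xi|^2)^{s/2}$, $|\xi|^p$; $\|f\|_{H^s}=\|\Lambda^sf\|$. For $k,\epsilon>0$ let $\Lambda^s_\epsilon$ have symbol $(1+|(\xi-ke_1)/\epsilon|^2)^{s/2}$ and let $\mathcal B_k$ have as symbol the characteristic function of $\{\xi:|\xi-ke_1|\le k/2\}$. Let $q\ge3$ be an odd integer, $s>1-\frac2{q-1}$ real, $p>0$, $k>0$, $\nu\in(1,2)$, $\mathbf T>0$, and put $\omega=k^{p/2}$, $C_k=\omega^{2-4/p}$, $g(\lambda)=1-\sqrt{1-\lambda}$ for $\lambda<1$. Let $0\ne A_0\in H^N(\mathbb R^2)$ with $N>s+21$, let $T_1>0$, $\mathscr T_1\ge0$ satisfy $T_1+\mathscr T_1\le 2\omega^{4/p-1}\mathbf T$, and define $$\lambda(f)=\frac{\|\Lambda^s_\epsilon f\|^2}{\nu^2\omega^4\|A_0\|_{H^s}^2},\qquad \mathcal N(z,t)=\omega^2\mathcal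 B_k\bigl(\epsilon^{q+4}z+2i(\epsilon^7t+\epsilon^5(T_1+\mathscr T_1))\,z|z|^{q-1}\bigr).$$ The progenitor equation is $$z_{tt}+|D|^pz+C_k\epsilon^2\mathcal B_k(z|z/\epsilon|^{q-1})+\mathcal N(z,t)\,g(\lambda(z_{tt}))=0,\tag{E}$$ and $\mathfrak w\in L^2$ is called compatible with $\mathfrak z\in L^2$ if $$\mathfrak w=-|D|^p\mathfrak z-C_k\epsilon^2\mathcal B_k(\mathfrak z|\mathfrak z/\epsilon|^{q-1})-\mathcal N(\mathfrak z,0)\,g(\lambda(\mathfrak w)).$$ **Proposition.** There are a universal constant $\mathscr C>1$, a constant $K>0$ depending only on $s,q$, and a positive function $t_0=t_0(\epsilon,k,s,p,q,\delta)$ such that the following holds. (a) There is an $\epsilon_0>0$ depending only on $s,p,q,k,\nu,\mathbf T,N,\|A_0\|_{H^s},\|A_0\|_{H^N}$ such that for all $0<\epsilon<\epsilon_0$, with $z(0)=\mathcal B_k\bigl(\epsilon A_0(\epsilon x,\epsilon y)e^{ikx}\bigr)$, there is a $\mathfrak w_0\in L^2$ compatible with $z(0)$ and satisfying $\lambda(\mathfrak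 w_0)\le\frac12+\frac1{2\nu^2}<1$. (b) There is an $\epsilon_0>0$ depending only on $s,p,q,k,\nu,\mathbf T,\|A_0\|_{H^s}$ such that the following holds for all $0<\epsilon<\epsilon_0$, provided that $K\omega^{4/p-1}\mathbf T\|A_0\|_{L^\infty}^{q-1}\le1$. Let $u_0,v_0,w_0\in L^2$ satisfy $u_0=\mathcal B_ku_0$, $v_0=\mathcal B_kv_0$, $w_0=\mathcal B_kw_0$, $$\max(\|u_0\|,\omega^{-1}\|v_0\|,\omega^{-2}\|w_0\|)\le2\|A_0\|_{H^s},\qquad\|\Lambda^{-s}_\epsilon u_0\|_{L^\infty}\le2\epsilon\|A_0\|_{L^\infty},$$ let $\Lambda^{-s}_\epsilon w_0$ be compatible with $\Lambda^{-s}_\epsilon u_0$, and suppose that $\lambda_0:=\lambda(\Lambda^{-s}_\epsilon w_0)<1$ satisfies $g'(\lambda_0)\le16\,\epsilon^{-(q+4)}/\mathscr C$. Then there are a time $\mathbf t>t_0(\epsilon,k,s,p,q,1-\lambda_0)$ and a function $z$ on $\mathbb R^2\times[0,\mathbf t]$, differentiable in time as a map into $L^2$, whose derivative $z_t$ is absolutely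 continuous, $z_t(t)=z_t(0)+\int_0^tz_{tt}$, with an everywhere defined $z_{tt}$, such that $(z,z_t,z_{tt})(0)=(\Lambda^{-s}_\epsilon u_0,\Lambda^{-s}_\epsilon v_0,\Lambda^{-s}_\epsilon w_0)$ and 1. $\Lambda^s_\epsilon z_{tt}(x,y,t)$ is a bounded measurable function on $\mathbb R^2\times[0,\mathbf t]$, $\Lambda^s_\epsilon z_{tt}\in L^\infty([0,\mathbf t],L^2)$, and (E) holds for every $(x,y)\in\mathbb R^2$ and almost every $t\in[0,\mathbf t]$, and in particular at $t=\mathbf t$; 2. $z(t)=\mathcal B_kz(t)$, and likewise for $z_t(t)$ and $z_{tt}(t)$, for every $t\in[0,\mathbf t]$; 3. $\Lambda^s_\epsilon z,\Lambda^s_\epsilon z_t\in C([0,\mathbf t],L^2)$ and $\max(\|\Lambda^s_\epsilon z(t)\|,\omega^{-1}\|\Lambda^s_\epsilon z_t(t)\|)\le3\|A_0\|_{H^s}$ for every $t\in[0,\mathbf t]$; 4. $|\lambda(z_{tt}(t))-\lambda_0|\le\frac12(1-\lambda_0)$ for every $t\in[0,\mathbf t]$. -/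

import Mathlib

open MeasureTheory FourierTransform

namespace Progenitor

noncomputable section

/-- The Euclidean plane, the space of the variables `(x, y)` and of the frequencies `ξ`. -/
abbrev Plane : Type := EuclideanSpace ℝ (Fin 2)

/-- The complex Hilbert space `L²(ℝ²)`. -/
abbrev L2 : Type := Lp (α := Plane) ℂ 2 volume

open Classical in
/-- The class in `L²` of a square integrable function (and `0` if it is not square integrable). -/
def toL2 (f : Plane → ℂ) : L2 :=
  if h : MemLp f 2 volume then h.toLp f else 0

/-! ### Fourier multipliers

Mathlib's Fourier transform uses the character `exp (-2πi x·η)`, so that the frequency `ξ` of the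
character `exp (-i x·ξ)` is `ξ = 2πη`: the multiplier with symbol `m(ξ)` acts as multiplication by
`m(2πη)`. -/

/-- The function `η ↦ m(2πη) 𝓕f(η)`. -/
def symbolMul (m : Plane → ℝ) (f : L2) : Plane → ℂ :=
  fun η => (m ((2 * Real.pi) • η) : ℂ) * (𝓕 f : L2) η

/-- `f` lies in the `L²`-domain of the Fourier multiplier with symbol `m`. -/
def InDomain (m : Plane → ℝ) (f : L2) : Prop :=
  MemLp (symbolMul m f) 2 volume

/-- The Fourier multiplier with symbol `m`, on its `L²`-domain (and `0` off that domain). -/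
def multiplier (m : Plane → ℝ) (f : L2) : L2 :=
  (𝓕⁻ (toL2 (symbolMul m f)) : L2)

/-- The unit vector `e₁ = (1, 0)`. -/
def e1 : Plane := EuclideanSpace.single 0 1

/-- The symbol `(|ξ|² + 1)^(s/2)` of `Λˢ`. -/
def besselSymbol (s : ℝ) : Plane → ℝ := fun ξ => (‖ξ‖ ^ 2 + 1) ^ (s / 2)

/-- The symbol `|ξ|ᵖ` of `|D|ᵖ`. -/
def rieszSymbol (p : ℝ) : Plane → ℝ := fun ξ => ‖ξ‖ ^ p

/-- The symbol of `𝓑ₖ`: the characteristic function of `{ξ : |ξ - k e₁| ≤ k/2}`. -/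
def bandSymbol (k : ℝ) : Plane → ℝ :=
  Set.indicator (Metric.closedBall (k • e1) (k / 2)) 1

/-- The rescaled symbol `m_ε(ξ) = m((ξ - k e₁)/ε)`. -/
def rescaledSymbol (k ε : ℝ) (m : Plane → ℝ) : Plane → ℝ :=
  fun ξ => m (ε⁻¹ • (ξ - k • e1))

/-- `Λˢ_ε`. -/
def Lam (s k ε : ℝ) (f : L2) : L2 := multiplier (rescaledSymbol k ε (besselSymbol s)) f

/-- `|D|ᵖ`. -/
def absD (p : ℝ) (f : L2) : L2 := multiplier (rieszSymbol p) f

/-- The mode filter `𝓑ₖ`. -/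
def band (k : ℝ) (f : L2) : L2 := multiplier (bandSymbol k) f

/-- `f ∈ Hˢ(ℝ²)` (for `s ≥ 0`). -/
def MemH (s : ℝ) (f : L2) : Prop := InDomain (besselSymbol s) f

/-- `‖f‖_{Hˢ} = ‖Λˢ f‖`. -/
def sobNorm (s : ℝ) (f : L2) : ℝ := ‖multiplier (besselSymbol s) f‖

/-- `‖f‖_{L^∞}` as a real number, for an essentially bounded `f`. -/
def supNorm (f : L2) : ℝ := (eLpNorm f ⊤ volume).toReal

/-- The value at `x` of the continuous representative of `f`, by Fourier inversion. It is used for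
functions `f = 𝓑ₖ f`, whose Fourier transform is integrable since it has compact support. -/
def pointValue (f : L2) (x : Plane) : ℂ := 𝓕⁻ ((𝓕 f : L2) : Plane → ℂ) x

/-! ### The progenitor equation -/

/-- The frequency `ω > 0`, given by `ω² = kᵖ`. -/
def freq (p k : ℝ) : ℝ := k ^ (p / 2)

/-- The coefficient `C_k = ω^(2 - 4/p)` of the power nonlinearity. -/
def powCoeff (p k : ℝ) : ℝ := freq p k ^ (2 - 4 / p)

/-- The nonlinearity `z |z/r|^(q-1)`. -/
def powTerm (q : ℕ) (r : ℝ) (z : L2) : L2 :=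
  toL2 fun x => z x * (((‖z x‖ / r) ^ (q - 1) : ℝ) : ℂ)

/-- The term `C_k ε² 𝓑ₖ(z |z/ε|^(q-1))`. -/
def semilinear (q : ℕ) (p k ε : ℝ) (z : L2) : L2 :=
  ((powCoeff p k * ε ^ 2 : ℝ) : ℂ) • band k (powTerm q ε z)

/-- The coefficient
`𝒩 = ω² 𝓑ₖ(ε^(q+4) z + 2i (ε⁷ t + ε⁵ T) z |z|^(q-1))` of the penalization term. -/
def penal (q : ℕ) (p k ε T t : ℝ) (z : L2) : L2 :=
  ((freq p k ^ 2 : ℝ) : ℂ) •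
    band k (((ε ^ (q + 4) : ℝ) : ℂ) • z +
      (2 * Complex.I * ((ε ^ 7 * t + ε ^ 5 * T : ℝ) : ℂ)) • powTerm q 1 z)

/-- `g(λ) = 1 - √(1 - λ)`, used for `0 ≤ λ < 1`. -/
def pen (l : ℝ) : ℝ := 1 - Real.sqrt (1 - l)

/-- The control functional `λ(f) = ‖Λˢ_ε f‖² / (ν² ω⁴ ‖A₀‖²_{Hˢ})`. -/
def controlNorm (s p k ε ν : ℝ) (A₀ : L2) (f : L2) : ℝ :=
  ‖Lam s k ε f‖ ^ 2 / (ν ^ 2 * freq p k ^ 4 * sobNorm s A₀ ^ 2)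

/-- The datum `z(0) = 𝓑ₖ z̃(0)`, where `z̃(0) = ε A₀(εx, εy) e^{ikx}`. -/
def packetDatum (k ε : ℝ) (A₀ : L2) : L2 :=
  band k (toL2 fun x => (ε : ℂ) * A₀ (ε • x) * Complex.exp (Complex.I * ((k * x 0 : ℝ) : ℂ)))

/-- The compatibility condition
`𝔴 = -|D|ᵖ 𝔷 - C_k ε² 𝓑ₖ(𝔷 |𝔷/ε|^(q-1)) - g(λ(𝔴)) 𝒩(0)` between `𝔷 = z(0)` and `𝔴 = z_tt(0)`. -/
def Compatible (q : ℕ) (s p k ε ν T : ℝ) (A₀ 𝔷 𝔴 : L2) : Prop :=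
  𝔴 = -absD p 𝔷 - semilinear q p k ε 𝔷
    - ((pen (controlNorm s p k ε ν A₀ 𝔴) : ℝ) : ℂ) • penal q p k ε T 0 𝔷

/-- At time `t` the progenitor equation
`z_tt + |D|ᵖ z + C_k ε² 𝓑ₖ(z |z/ε|^(q-1)) + g(λ(z_tt)) 𝒩 = 0`
holds at every point of the plane, for the values `z = z(t)` and `ztt = z_tt(t)`. -/
def EquationAt (q : ℕ) (s p k ε ν T : ℝ) (A₀ : L2) (t : ℝ) (z ztt : L2) : Prop :=
  ∀ x : Plane,
    pointValue ztt x + pointValue (absD p z) x + pointValue (semilinear q p k ε z) x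
      + ((pen (controlNorm s p k ε ν A₀ ztt) : ℝ) : ℂ) * pointValue (penal q p k ε T t z) x = 0

/-- `z`, with first and second time derivatives `zt` and `ztt`, is a solution on `[0, t₁]` of the
progenitor equation, for every point of the plane and almost every time, and also at the time
`t = t₁`. -/
structure IsSolution (q : ℕ) (s p k ε ν T : ℝ) (A₀ : L2) (t₁ : ℝ) (z zt ztt : ℝ → L2) : Prop where
  /-- `z` is differentiable in time with values in `L²`, with derivative `zt`. -/
  hasDeriv : ∀ t ∈ Set.Icc 0 t₁, HasDerivWithinAt z (zt t) (Set.Icc 0 t₁) t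
  /-- `ztt` is integrable and `zt` is absolutely continuous in time with derivative `ztt`. -/
  integrable : IntervalIntegrable ztt volume 0 t₁
  eq_integral : ∀ t ∈ Set.Icc 0 t₁, zt t = zt 0 + ∫ τ in (0 : ℝ)..t, ztt τ
  /-- `Λˢ_ε z_tt(x, y, t)` is a bounded measurable function on `ℝ² × [0, t₁]`. -/
  measurable_ztt : Measurable fun y : Set.Icc 0 t₁ × Plane =>
    pointValue (Lam s k ε (ztt y.1)) y.2
  bounded_ztt : ∃ B : ℝ, ∀ t ∈ Set.Icc 0 t₁, ∀ x, ‖pointValue (Lam s k ε (ztt t)) x‖ ≤ B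
  /-- `Λˢ_ε z_tt ∈ L^∞([0, t₁], L²)`. -/
  memLp_ztt : MemLp (fun t => Lam s k ε (ztt t)) ⊤ (volume.restrict (Set.Icc 0 t₁))
  /-- The equation holds almost everywhere in time, and at the final time. -/
  equation : ∀ᵐ t ∂volume.restrict (Set.Icc 0 t₁), EquationAt q s p k ε ν T A₀ t (z t) (ztt t)
  equation_end : EquationAt q s p k ε ν T A₀ t₁ (z t₁) (ztt t₁)

end

end Progenitor

open Progenitor

/-!
The Fourier transform of a function `f = 𝓑ₖ f` has compact support. On such functions `|D|ᵖ` and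
`Λˢ_ε` are therefore bounded, the `L²` norm controls the supremum, and the nonlinearities are
Lipschitz on bounded sets. The constant of the tame estimate
`‖Λˢ_ε 𝓑ₖ(z |z|^(q-1))‖ ≤ K ‖z‖_{L^∞}^(q-1) ‖Λˢ_ε z‖` depends only on `s` and `q`: truncating `z`
smoothly to the frequencies within `2r` of `k e₁` increases its supremum by at most a constant
factor, and the power of the truncation has its frequencies within `2qr`, so that the `L²` mass of
`z |z|^(q-1)` beyond `2qr` is controlled by the mass of `z` beyond `r`. Integrating over `r` with
the weight of `Λˢ_ε` gives the estimate.

The equation is implicit in `z_tt`. In terms of `γ = g(λ(z_tt))`, that is `λ = 2γ - γ²`, it says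
that `z_tt = f - γ 𝒩` with `f` and `𝒩` depending on `z` and `t`, where `γ` solves the quadratic
equation `‖Λˢ_ε f - γ Λˢ_ε 𝒩‖² = M (2γ - γ²)`, `M = ν² ω⁴ ‖A₀‖²_{Hˢ}`. Its smaller root is a
Lipschitz function of `(z, t)` as long as the discriminant is bounded below, and at time `0` such a
bound comes from `g'(λ₀) ≤ 16 ε^(-(q+4))/𝒞`. The Picard-Lindelöf theorem then applies to the
resulting explicit equation, with an existence time that is uniform in the data.

For the wave packet data of part (a), `‖Λˢ_ε |D|ᵖ z(0)‖` is close to `ω² ‖A₀‖_{Hˢ}` and the other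
terms of the compatibility condition are small, so that compatibility becomes a fixed point equation
for the scalar `λ` on the interval `[0, 1/2 + 1/(2ν²)]`, solved by continuity.
-/

namespace Progenitor

noncomputable section

/-! ### Fourier transforms of integrable and of square integrable functions -/

section Fourier

open SchwartzMap
open scoped ComplexConjugate Convolution Pointwise RealInnerProductSpace

variable {V : Type*} [NormedAddCommGroup V] [InnerProductSpace ℝ V] [FiniteDimensional ℝ V]
  [MeasurableSpace V] [BorelSpace V]

theorem ae_eq_of_forall_integral_schwartz_mul_eq {f g : V → ℂ} (hf : LocallyIntegrable f)
    (hg : LocallyIntegrable g) (h : ∀ φ : 𝓢(V, ℂ), ∫ x, φ x * f x = ∫ x, φ x * g x) :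
    f =ᵐ[volume] g := by
  refine ae_eq_of_integral_contDiff_smul_eq hf hg fun u hu hc => ?_
  have hcs : HasCompactSupport fun x => (u x : ℂ) := hc.comp_left (g := Complex.ofReal) (by simp)
  have husmooth : ContDiff ℝ ((⊤ : ℕ∞) : WithTop ℕ∞) fun x => (u x : ℂ) :=
    Complex.ofRealCLM.contDiff.comp hu
  simpa using h (hcs.toSchwartzMap husmooth)

theorem locallyIntegrable_coe (f : Lp (α := V) ℂ 2 volume) : LocallyIntegrable f :=
  (Lp.memLp f).locallyIntegrable (by norm_num)

theorem integral_schwartz_mul_fourierInv (φ : 𝓢(V, ℂ)) (g : Lp (α := V) ℂ 2 volume) :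
    ∫ x, φ x * (𝓕⁻ g : Lp (α := V) ℂ 2 volume) x = ∫ x, (𝓕⁻ φ : 𝓢(V, ℂ)) x * g x := by
  have h := congrArg (fun T => T φ) (Lp.fourierInv_toTemperedDistribution_eq g)
  simp only [TemperedDistribution.fourierInv_apply, Lp.toTemperedDistribution_apply,
    smul_eq_mul] at h
  exact h.symm

theorem continuous_neg_innerₗ_uncurry {V : Type*} [NormedAddCommGroup V] [InnerProductSpace ℝ V] :
    Continuous fun p : V × V => (-innerₗ V) p.1 p.2 :=
  (continuous_inner (𝕜 := ℝ) (E := V)).neg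

theorem integral_fourierInv_mul {f g : V → ℂ} (hf : Integrable f) (hg : Integrable g) :
    ∫ x, 𝓕⁻ f x * g x = ∫ x, f x * 𝓕⁻ g x := by
  have hflip : (-innerₗ V).flip = -innerₗ V := by
    ext x y
    simp [real_inner_comm]
  have h := VectorFourier.integral_fourierIntegral_smul_eq_flip (μ := volume) (ν := volume)
    (L := -innerₗ V) Real.continuous_fourierChar continuous_neg_innerₗ_uncurry hf hg
  rwa [hflip] at h

theorem continuous_fourierInv {g : V → ℂ} (hg : Integrable g) : Continuous (𝓕⁻ g) :=
  VectorFourier.fourierIntegral_continuous Real.continuous_fourierChar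
    continuous_neg_innerₗ_uncurry hg

theorem norm_fourierInv_le (g : V → ℂ) (x : V) : ‖𝓕⁻ g x‖ ≤ ∫ η, ‖g η‖ :=
  VectorFourier.norm_fourierIntegral_le_integral_norm _ _ _ _ _

theorem coe_fourierInv_ae_eq (g : Lp (α := V) ℂ 2 volume) (hg : Integrable g) :
    ((𝓕⁻ g : Lp (α := V) ℂ 2 volume) : V → ℂ) =ᵐ[volume] 𝓕⁻ (g : V → ℂ) := by
  refine ae_eq_of_forall_integral_schwartz_mul_eq (locallyIntegrable_coe _)
    (continuous_fourierInv hg).locallyIntegrable fun φ => ?_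
  rw [integral_schwartz_mul_fourierInv, ← integral_fourierInv_mul φ.integrable hg,
    SchwartzMap.fourierInv_coe]

theorem fourier_ae_eq_of_ae_eq_fourierInv {f : Lp (α := V) ℂ 2 volume} {a : V → ℂ}
    (ha : Integrable a) (h : (f : V → ℂ) =ᵐ[volume] 𝓕⁻ a) :
    ((𝓕 f : Lp (α := V) ℂ 2 volume) : V → ℂ) =ᵐ[volume] a := by
  refine ae_eq_of_forall_integral_schwartz_mul_eq (locallyIntegrable_coe _)
    ha.locallyIntegrable fun φ => ?_
  have hswap := integral_schwartz_mul_fourierInv (𝓕 φ) (𝓕 f : Lp (α := V) ℂ 2 volume)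
  rw [FourierTransform.fourierInv_fourier_eq, FourierTransform.fourierInv_fourier_eq] at hswap
  calc ∫ x, φ x * (𝓕 f : Lp (α := V) ℂ 2 volume) x
      = ∫ x, (𝓕 φ : 𝓢(V, ℂ)) x * 𝓕⁻ a x := by
        rw [← hswap]
        refine integral_congr_ae ?_
        filter_upwards [h] with x hx
        rw [hx]
    _ = ∫ x, φ x * a x := by
        rw [← integral_fourierInv_mul (𝓕 φ : 𝓢(V, ℂ)).integrable ha, ← SchwartzMap.fourierInv_coe,
          FourierTransform.fourierInv_fourier_eq]

theorem norm_le_of_ae_norm_le {X E : Type*} [TopologicalSpace X] [MeasurableSpace X]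
    {μ : Measure X} [μ.IsOpenPosMeasure] [SeminormedAddCommGroup E] {g : X → E}
    (hg : Continuous g) {M : ℝ} (h : ∀ᵐ x ∂μ, ‖g x‖ ≤ M) (x : X) : ‖g x‖ ≤ M := by
  have hdense : Dense {x | ‖g x‖ ≤ M} := Measure.dense_of_ae h
  have hclosed : IsClosed {x | ‖g x‖ ≤ M} := isClosed_le hg.norm continuous_const
  simpa [hclosed.closure_eq] using hdense x

/-- `F` is the inverse Fourier transform of an integrable function which vanishes outside `S`. The
frequencies are those of the character `exp (2πi x·η)`. -/
def HasSpectrumIn (F : V → ℂ) (S : Set V) : Prop :=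
  ∃ a : V → ℂ, Integrable a ∧ Function.support a ⊆ S ∧ F = 𝓕⁻ a

namespace HasSpectrumIn

variable {F G : V → ℂ} {S T : Set V}

theorem mul (hF : HasSpectrumIn F S) (hG : HasSpectrumIn G T) :
    HasSpectrumIn (fun x => F x * G x) (S + T) := by
  obtain ⟨a, ha, haS, rfl⟩ := hF
  obtain ⟨b, hb, hbT, rfl⟩ := hG
  refine ⟨a ⋆[ContinuousLinearMap.mul ℂ ℂ] b, ha.integrable_convolution _ hb,
    (support_convolution_subset _).trans (Set.add_subset_add haS hbT), ?_⟩
  funext x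
  simp only [Real.fourierInv_eq_fourier_neg, Real.fourier_mul_convolution_eq ha hb]

theorem star (hF : HasSpectrumIn F S) : HasSpectrumIn (fun x => conj (F x)) (-S) := by
  obtain ⟨a, ha, haS, rfl⟩ := hF
  refine ⟨fun η => conj (a (-η)),
    (Complex.conjLIE.toContinuousLinearEquiv : ℂ →L[ℝ] ℂ).integrable_comp ha.comp_neg,
    fun η hη => haS (by simpa using hη), ?_⟩
  funext x
  rw [Real.fourierInv_eq', Real.fourierInv_eq', ← integral_conj, ← integral_neg_eq_self]
  refine integral_congr_ae (.of_forall fun η => ?_)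
  simp only [inner_neg_left, smul_eq_mul, map_mul, ← Complex.exp_conj, Complex.conj_ofReal,
    Complex.conj_I]
  congr 2
  push_cast
  ring

theorem mul_norm_pow {c : V} {ρ : ℝ} (hρ : 0 ≤ ρ) (hF : HasSpectrumIn F (Metric.closedBall c ρ))
    (m : ℕ) : HasSpectrumIn (fun x => F x * ((‖F x‖ ^ (2 * m) : ℝ) : ℂ))
      (Metric.closedBall c ((2 * m + 1) * ρ)) := by
  induction m with
  | zero => simpa using hF
  | succ m ih =>
    convert (ih.mul hF).mul hF.star using 1
    · funext x
      have hsq : ((‖F x‖ ^ 2 : ℝ) : ℂ) = F x * conj (F x) := by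
        rw [Complex.mul_conj, Complex.normSq_eq_norm_sq]
      rw [mul_add_one, pow_add, Complex.ofReal_mul, hsq]
      ring
    · rw [neg_closedBall, closedBall_add_closedBall (by positivity) hρ,
        closedBall_add_closedBall (by positivity) hρ, add_neg_cancel_right]
      congr 1
      push_cast
      ring

end HasSpectrumIn

theorem integrable_circle_smul {g : V → ℂ} (hg : Integrable g) {e : V → Circle}
    (he : Continuous e) : Integrable fun v => e v • g v :=
  hg.mono (he.aestronglyMeasurable.smul hg.aestronglyMeasurable) (.of_forall fun v => by simp)

theorem fourierInv_fourier_dilation_mul {ψ a : V → ℂ} (hψ : Integrable ψ) (ha : Integrable a)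
    (r : ℝ) (c x : V) :
    𝓕⁻ (fun η => 𝓕 ψ (r • (η - c)) * a η) x
      = ∫ v, (𝐞 (r * ⟪v, c⟫) • ψ v) * 𝓕⁻ a (x - r • v) := by
  have hψc : Integrable fun v => 𝐞 (r * ⟪v, c⟫) • ψ v :=
    integrable_circle_smul hψ (Real.continuous_fourierChar.comp (by fun_prop))
  have hax : Integrable fun η => 𝐞 ⟪η, x⟫ • a η :=
    integrable_circle_smul ha (Real.continuous_fourierChar.comp (by fun_prop))
  have hcont : Continuous fun p : V × V => (r • innerₗ V) p.1 p.2 :=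
    (continuous_inner (𝕜 := ℝ) (E := V)).const_smul r
  have hswap := VectorFourier.integral_fourierIntegral_smul_eq_flip (μ := volume) (ν := volume)
    Real.continuous_fourierChar hcont hψc hax
  simp only [VectorFourier.fourierIntegral, LinearMap.flip_apply, LinearMap.smul_apply,
    innerₗ_apply_apply, smul_smul, ← AddChar.map_add_eq_mul] at hswap
  convert hswap using 1
  · rw [Real.fourierInv_eq]
    refine integral_congr_ae (.of_forall fun η => ?_)
    simp only [Real.fourier_eq, smul_eq_mul, mul_smul_comm, inner_smul_right, inner_sub_right]
    congr! 6
    ring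
  · refine integral_congr_ae (.of_forall fun v => ?_)
    simp only [Real.fourierInv_eq, smul_eq_mul]
    congr! 5 with η
    simp only [inner_sub_right, inner_smul_right, real_inner_comm v η]
    ring

theorem norm_fourierInv_fourier_dilation_mul_le {ψ a : V → ℂ} (hψ : Integrable ψ)
    (ha : Integrable a) {M : ℝ} (hM : ∀ x, ‖𝓕⁻ a x‖ ≤ M) (r : ℝ) (c x : V) :
    ‖𝓕⁻ (fun η => 𝓕 ψ (r • (η - c)) * a η) x‖ ≤ (∫ v, ‖ψ v‖) * M := by
  rw [fourierInv_fourier_dilation_mul hψ ha, ← integral_mul_const]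
  refine norm_integral_le_of_norm_le (hψ.norm.mul_const M) (.of_forall fun v => ?_)
  rw [norm_mul, Circle.norm_smul]
  exact mul_le_mul_of_nonneg_left (hM _) (norm_nonneg _)

theorem exists_fourier_eq_contDiffBump (φ : ContDiffBump (0 : V)) :
    ∃ ψ : 𝓢(V, ℂ), 𝓕 (ψ : V → ℂ) = fun η => (φ η : ℂ) := by
  have hcs : HasCompactSupport fun η => (φ η : ℂ) :=
    φ.hasCompactSupport.comp_left (g := Complex.ofReal) (by simp)
  refine ⟨𝓕⁻ (hcs.toSchwartzMap (Complex.ofRealCLM.contDiff.comp φ.contDiff)), ?_⟩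
  rw [← SchwartzMap.fourier_coe, FourierTransform.fourier_fourierInv_eq]
  rfl

theorem exists_norm_fourierInv_bump_mul_le (φ : ContDiffBump (0 : V)) :
    ∃ C : ℝ, 1 ≤ C ∧ ∀ (r : ℝ) (c : V) (a : V → ℂ), Integrable a →
      ∀ M : ℝ, (∀ x, ‖𝓕⁻ a x‖ ≤ M) →
      ∀ x, ‖𝓕⁻ (fun η => (φ (r • (η - c)) : ℂ) * a η) x‖ ≤ C * M := by
  obtain ⟨ψ, hψ⟩ := exists_fourier_eq_contDiffBump φ
  refine ⟨max 1 (∫ v, ‖ψ v‖), le_max_left _ _, fun r c a ha M hM x => ?_⟩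
  have h := norm_fourierInv_fourier_dilation_mul_le ψ.integrable ha hM r c x
  rw [hψ] at h
  exact h.trans (mul_le_mul_of_nonneg_right (le_max_right _ _) ((norm_nonneg _).trans (hM 0)))

end Fourier

/-! ### Fourier multipliers and band-limited functions -/

section Multipliers

variable {m m' : Plane → ℝ} {f g : L2} {C : ℝ}

theorem toL2_ae_eq {F : Plane → ℂ} (h : MemLp F 2 volume) : (toL2 F : Plane → ℂ) =ᵐ[volume] F := by
  rw [toL2, dif_pos h]
  exact h.coeFn_toLp

theorem enorm_sq_eq_lintegral (f : L2) : ‖f‖ₑ ^ 2 = ∫⁻ x, ‖f x‖ₑ ^ 2 := by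
  simpa [Lp.enorm_def] using
    eLpNorm_nnreal_pow_eq_lintegral (μ := volume) (f := (f : Plane → ℂ)) (p := 2) two_ne_zero

theorem enorm_sq_eq_lintegral_fourier (f : L2) : ‖f‖ₑ ^ 2 = ∫⁻ η, ‖(𝓕 f : L2) η‖ₑ ^ 2 := by
  rw [← enorm_sq_eq_lintegral, ← ofReal_norm, ← ofReal_norm, Lp.norm_fourier_eq]

theorem eq_of_fourier_ae_eq (h : ((𝓕 f : L2) : Plane → ℂ) =ᵐ[volume] (𝓕 g : L2)) : f = g :=
  (Lp.fourierTransformₗᵢ Plane ℂ).injective (Lp.ext h)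

theorem fourier_add_ae_eq (f g : L2) :
    ((𝓕 (f + g) : L2) : Plane → ℂ) =ᵐ[volume] fun η => (𝓕 f : L2) η + (𝓕 g : L2) η := by
  rw [FourierTransform.fourier_add]
  exact Lp.coeFn_add _ _

theorem fourier_sub_ae_eq (f g : L2) :
    ((𝓕 (f - g) : L2) : Plane → ℂ) =ᵐ[volume] fun η => (𝓕 f : L2) η - (𝓕 g : L2) η := by
  rw [show (𝓕 (f - g) : L2) = 𝓕 f - 𝓕 g from map_sub (Lp.fourierTransformₗᵢ Plane ℂ) f g]
  exact Lp.coeFn_sub _ _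

theorem fourier_smul_ae_eq (c : ℂ) (f : L2) :
    ((𝓕 (c • f) : L2) : Plane → ℂ) =ᵐ[volume] fun η => c * (𝓕 f : L2) η := by
  rw [FourierTransform.fourier_smul]
  exact Lp.coeFn_smul _ _

theorem fourier_multiplier_ae_eq (h : InDomain m f) :
    ((𝓕 (multiplier m f) : L2) : Plane → ℂ) =ᵐ[volume] symbolMul m f := by
  rw [multiplier, FourierTransform.fourier_fourierInv_eq]
  exact toL2_ae_eq h

theorem norm_multiplier (m : Plane → ℝ) (f : L2) : ‖multiplier m f‖ = ‖toL2 (symbolMul m f)‖ := by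
  rw [← Lp.norm_fourier_eq, multiplier, FourierTransform.fourier_fourierInv_eq]

theorem aestronglyMeasurable_symbolMul (hm : Measurable m) (f : L2) :
    AEStronglyMeasurable (symbolMul m f) volume :=
  (Complex.measurable_ofReal.comp
    (hm.comp (measurable_const_smul _))).aestronglyMeasurable.mul (Lp.aestronglyMeasurable _)

theorem norm_symbolMul (m : Plane → ℝ) (f : L2) (η : Plane) :
    ‖symbolMul m f η‖ = |m ((2 * Real.pi) • η)| * ‖(𝓕 f : L2) η‖ := by
  rw [symbolMul, norm_mul, Complex.norm_real, Real.norm_eq_abs]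

theorem InDomain.of_norm_le (hm : Measurable m) (h : InDomain m' g)
    (hle : ∀ᵐ η, ‖symbolMul m f η‖ ≤ C * ‖symbolMul m' g η‖) : InDomain m f :=
  MemLp.of_le_mul h (aestronglyMeasurable_symbolMul hm f) hle

theorem norm_multiplier_le (hm : Measurable m) (h : InDomain m' g)
    (hle : ∀ᵐ η, ‖symbolMul m f η‖ ≤ C * ‖symbolMul m' g η‖) :
    ‖multiplier m f‖ ≤ C * ‖multiplier m' g‖ := by
  rw [norm_multiplier, norm_multiplier]
  refine Lp.norm_le_mul_norm_of_ae_le_mul ?_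
  filter_upwards [toL2_ae_eq h, toL2_ae_eq (h.of_norm_le hm hle), hle] with η hg hf hη
  rwa [hg, hf]

theorem inDomain_of_bounded (hm : Measurable m) (hC : ∀ ξ, |m ξ| ≤ C) (f : L2) : InDomain m f := by
  refine MemLp.of_le_mul (Lp.memLp (𝓕 f : L2)) (aestronglyMeasurable_symbolMul hm f) (c := C)
    (.of_forall fun η => ?_)
  rw [norm_symbolMul]
  exact mul_le_mul_of_nonneg_right (hC _) (norm_nonneg _)

theorem norm_multiplier_le_of_bounded (hm : Measurable m) (hC : ∀ ξ, |m ξ| ≤ C) (f : L2) :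
    ‖multiplier m f‖ ≤ C * ‖f‖ := by
  rw [norm_multiplier, ← Lp.norm_fourier_eq f]
  refine Lp.norm_le_mul_norm_of_ae_le_mul ?_
  filter_upwards [toL2_ae_eq (inDomain_of_bounded hm hC f)] with η h
  rw [h, norm_symbolMul]
  exact mul_le_mul_of_nonneg_right (hC _) (norm_nonneg _)

theorem multiplier_eq_iff (h : InDomain m f) :
    multiplier m f = g ↔ ((𝓕 g : L2) : Plane → ℂ) =ᵐ[volume] symbolMul m f := by
  constructor
  · rintro rfl
    exact fourier_multiplier_ae_eq h
  · intro hg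
    exact eq_of_fourier_ae_eq ((fourier_multiplier_ae_eq h).trans hg.symm)

theorem multiplier_add (hf : InDomain m f) (hg : InDomain m g) (hfg : InDomain m (f + g)) :
    multiplier m (f + g) = multiplier m f + multiplier m g := by
  rw [multiplier_eq_iff hfg]
  filter_upwards [fourier_add_ae_eq (multiplier m f) (multiplier m g), fourier_add_ae_eq f g,
    fourier_multiplier_ae_eq hf, fourier_multiplier_ae_eq hg] with η hsum hadd hmf hmg
  rw [hsum, hmf, hmg, symbolMul, symbolMul, symbolMul, hadd, mul_add]

theorem multiplier_smul (c : ℂ) (hf : InDomain m f) (hcf : InDomain m (c • f)) :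
    multiplier m (c • f) = c • multiplier m f := by
  rw [multiplier_eq_iff hcf]
  filter_upwards [fourier_smul_ae_eq c (multiplier m f), fourier_smul_ae_eq c f,
    fourier_multiplier_ae_eq hf] with η hsmul hc hmf
  rw [hsmul, hmf, symbolMul, symbolMul, hc, mul_left_comm]

/-- The Fourier multiplier with a bounded measurable symbol, as a bounded operator of `L²`. -/
def boundedMultiplier (m : Plane → ℝ) (hm : Measurable m) (C : ℝ) (hC : ∀ ξ, |m ξ| ≤ C) :
    L2 →L[ℂ] L2 :=
  LinearMap.mkContinuous
    { toFun := multiplier m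
      map_add' := fun _ _ => multiplier_add (inDomain_of_bounded hm hC _)
        (inDomain_of_bounded hm hC _) (inDomain_of_bounded hm hC _)
      map_smul' := fun c _ => multiplier_smul c (inDomain_of_bounded hm hC _)
        (inDomain_of_bounded hm hC _) }
    C (norm_multiplier_le_of_bounded hm hC)

end Multipliers

section Band

variable {k : ℝ} {f g : L2}

theorem measurable_bandSymbol (k : ℝ) : Measurable (bandSymbol k) :=
  measurable_one.indicator Metric.isClosed_closedBall.measurableSet

theorem bandSymbol_of_mem {ξ : Plane} (h : ξ ∈ Metric.closedBall (k • e1) (k / 2)) :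
    bandSymbol k ξ = 1 :=
  Set.indicator_of_mem h _

theorem bandSymbol_of_notMem {ξ : Plane} (h : ξ ∉ Metric.closedBall (k • e1) (k / 2)) :
    bandSymbol k ξ = 0 :=
  Set.indicator_of_notMem h _

theorem abs_bandSymbol_le (k : ℝ) (ξ : Plane) : |bandSymbol k ξ| ≤ 1 := by
  by_cases h : ξ ∈ Metric.closedBall (k • e1) (k / 2)
  · simp [bandSymbol_of_mem h]
  · simp [bandSymbol_of_notMem h]

theorem bandSymbol_mul_self (k : ℝ) (ξ : Plane) :
    bandSymbol k ξ * bandSymbol k ξ = bandSymbol k ξ := by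
  by_cases h : ξ ∈ Metric.closedBall (k • e1) (k / 2)
  · simp [bandSymbol_of_mem h]
  · simp [bandSymbol_of_notMem h]

theorem measurable_mul_bandSymbol (k : ℝ) (m : C(Plane, ℝ)) :
    Measurable fun ξ => m ξ * bandSymbol k ξ :=
  m.continuous.measurable.mul (measurable_bandSymbol k)

theorem exists_abs_mul_bandSymbol_le (k : ℝ) (m : C(Plane, ℝ)) :
    ∃ C : ℝ, ∀ ξ, |m ξ * bandSymbol k ξ| ≤ C := by
  obtain ⟨C, hC⟩ := (isCompact_closedBall (k • e1) (k / 2)).exists_bound_of_continuousOn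
    (f := m) m.continuous.continuousOn
  refine ⟨max C 0, fun ξ => ?_⟩
  by_cases h : ξ ∈ Metric.closedBall (k • e1) (k / 2)
  · rw [bandSymbol_of_mem h, mul_one]
    exact (hC ξ h).trans (le_max_left _ _)
  · simp [bandSymbol_of_notMem h]

/-- The composition of `𝓑ₖ` with the Fourier multiplier with a continuous symbol `m`. It is a
bounded operator, since `m` is bounded on the band. -/
def bandOp (k : ℝ) (m : C(Plane, ℝ)) : L2 →L[ℂ] L2 :=
  boundedMultiplier (fun ξ => m ξ * bandSymbol k ξ) (measurable_mul_bandSymbol k m) _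
    (exists_abs_mul_bandSymbol_le k m).choose_spec

theorem inDomain_mul_bandSymbol (k : ℝ) (m : C(Plane, ℝ)) (f : L2) :
    InDomain (fun ξ => m ξ * bandSymbol k ξ) f :=
  inDomain_of_bounded (measurable_mul_bandSymbol k m)
    (exists_abs_mul_bandSymbol_le k m).choose_spec f

theorem fourier_bandOp_ae_eq (k : ℝ) (m : C(Plane, ℝ)) (f : L2) :
    ((𝓕 (bandOp k m f) : L2) : Plane → ℂ) =ᵐ[volume]
      symbolMul (fun ξ => m ξ * bandSymbol k ξ) f :=
  fourier_multiplier_ae_eq (inDomain_mul_bandSymbol k m f)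

theorem fourier_band_ae_eq (k : ℝ) (f : L2) :
    ((𝓕 (band k f) : L2) : Plane → ℂ) =ᵐ[volume] symbolMul (bandSymbol k) f :=
  fourier_multiplier_ae_eq (inDomain_of_bounded (measurable_bandSymbol k) (abs_bandSymbol_le k) f)

theorem eq_bandOp_of_fourier_ae_eq {m : C(Plane, ℝ)}
    (h : ((𝓕 g : L2) : Plane → ℂ) =ᵐ[volume] symbolMul (fun ξ => m ξ * bandSymbol k ξ) f) :
    g = bandOp k m f :=
  eq_of_fourier_ae_eq (h.trans (fourier_bandOp_ae_eq k m f).symm)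

theorem band_eq_bandOp_one (k : ℝ) (f : L2) : band k f = bandOp k 1 f :=
  eq_bandOp_of_fourier_ae_eq ((fourier_band_ae_eq k f).trans
    (.of_forall fun η => by simp [symbolMul]))

theorem bandOp_bandOp (k : ℝ) (m m' : C(Plane, ℝ)) (f : L2) :
    bandOp k m (bandOp k m' f) = bandOp k (m * m') f := by
  refine eq_bandOp_of_fourier_ae_eq ?_
  filter_upwards [fourier_bandOp_ae_eq k m (bandOp k m' f), fourier_bandOp_ae_eq k m' f]
    with η houter hinner
  have hidem := congrArg Complex.ofReal (bandSymbol_mul_self k ((2 * Real.pi) • η))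
  rw [houter, symbolMul, hinner, symbolMul, symbolMul, ContinuousMap.mul_apply]
  push_cast at hidem ⊢
  linear_combination ((m ((2 * Real.pi) • η) : ℂ) * (m' ((2 * Real.pi) • η) : ℂ) *
    (𝓕 f : L2) η) * hidem

/-- `f` is invariant under the mode filter `𝓑ₖ`: its spectrum lies in the band of `𝓑ₖ`. -/
def IsBandLimited (k : ℝ) (f : L2) : Prop := f = band k f

theorem isBandLimited_bandOp (k : ℝ) (m : C(Plane, ℝ)) (f : L2) :
    IsBandLimited k (bandOp k m f) := by
  rw [IsBandLimited, band_eq_bandOp_one, bandOp_bandOp, one_mul]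

theorem isBandLimited_band (k : ℝ) (f : L2) : IsBandLimited k (band k f) :=
  band_eq_bandOp_one k f ▸ isBandLimited_bandOp k 1 f

theorem bandOp_band (k : ℝ) (m : C(Plane, ℝ)) (f : L2) : bandOp k m (band k f) = bandOp k m f := by
  rw [band_eq_bandOp_one, bandOp_bandOp, mul_one]

namespace IsBandLimited

theorem bandOp_one_eq (hf : IsBandLimited k f) : bandOp k 1 f = f :=
  (band_eq_bandOp_one k f).symm.trans (Eq.symm hf)

theorem add (hf : IsBandLimited k f) (hg : IsBandLimited k g) : IsBandLimited k (f + g) := by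
  rw [IsBandLimited, band_eq_bandOp_one, map_add, hf.bandOp_one_eq, hg.bandOp_one_eq]

theorem smul (c : ℂ) (hf : IsBandLimited k f) : IsBandLimited k (c • f) := by
  rw [IsBandLimited, band_eq_bandOp_one, map_smul, hf.bandOp_one_eq]

theorem neg (hf : IsBandLimited k f) : IsBandLimited k (-f) := by
  rw [IsBandLimited, band_eq_bandOp_one, map_neg, hf.bandOp_one_eq]

theorem sub (hf : IsBandLimited k f) (hg : IsBandLimited k g) : IsBandLimited k (f - g) := by
  rw [IsBandLimited, band_eq_bandOp_one, map_sub, hf.bandOp_one_eq, hg.bandOp_one_eq]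

theorem fourier_eq_zero (hf : IsBandLimited k f) :
    ∀ᵐ η, (2 * Real.pi) • η ∉ Metric.closedBall (k • e1) (k / 2) → (𝓕 f : L2) η = 0 := by
  filter_upwards [fourier_band_ae_eq k f] with η h hη
  rw [hf, h, symbolMul, bandSymbol_of_notMem hη, Complex.ofReal_zero, zero_mul]

theorem symbolMul_ae_eq (hf : IsBandLimited k f) (m : Plane → ℝ) :
    symbolMul m f =ᵐ[volume] symbolMul (fun ξ => m ξ * bandSymbol k ξ) f := by
  filter_upwards [hf.fourier_eq_zero] with η h
  by_cases hη : (2 * Real.pi) • η ∈ Metric.closedBall (k • e1) (k / 2)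
  · simp [symbolMul, bandSymbol_of_mem hη]
  · simp [symbolMul, h hη]

theorem inDomain (hf : IsBandLimited k f) (m : C(Plane, ℝ)) : InDomain m f :=
  (memLp_congr_ae (hf.symbolMul_ae_eq m)).2 (inDomain_mul_bandSymbol k m f)

theorem multiplier_eq_bandOp (hf : IsBandLimited k f) (m : C(Plane, ℝ)) :
    multiplier m f = bandOp k m f :=
  eq_bandOp_of_fourier_ae_eq
    ((fourier_multiplier_ae_eq (hf.inDomain m)).trans (hf.symbolMul_ae_eq m))

end IsBandLimited

end Band

section FiniteMeasureSupport

variable {α : Type*} [MeasurableSpace α] {μ : Measure α} {E : Type*} [NormedAddCommGroup E]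
  [NormedSpace ℝ E]

theorem integrable_smul_of_memLp_two {φ : α → ℝ} (hφ : MemLp φ 2 μ) (g : Lp E 2 μ) :
    Integrable (fun a => φ a • g a) μ :=
  memLp_one_iff_integrable.1 ((Lp.memLp g).smul hφ)

theorem integral_norm_smul_le {φ : α → ℝ} (hφ : MemLp φ 2 μ) (g : Lp E 2 μ) :
    ∫ a, ‖φ a • g a‖ ∂μ ≤ (eLpNorm φ 2 μ).toReal * ‖g‖ := by
  rw [integral_norm_eq_lintegral_enorm (integrable_smul_of_memLp_two hφ g).1,
    ← eLpNorm_one_eq_lintegral_enorm, Lp.norm_def, ← ENNReal.toReal_mul]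
  exact ENNReal.toReal_mono (ENNReal.mul_lt_top hφ.2 (Lp.memLp g).2).ne
    (eLpNorm_smul_le_mul_eLpNorm (Lp.memLp g).1 hφ.1)

theorem indicator_one_smul_ae_eq {S : Set α} {g : α → E} (hg : ∀ᵐ a ∂μ, a ∉ S → g a = 0) :
    (fun a => S.indicator (1 : α → ℝ) a • g a) =ᵐ[μ] g := by
  filter_upwards [hg] with a h
  by_cases ha : a ∈ S
  · simp [ha]
  · simp [ha, h ha]

theorem memLp_indicator_one {S : Set α} (hS : MeasurableSet S) (hμS : μ S ≠ ⊤) :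
    MemLp (S.indicator (1 : α → ℝ)) 2 μ :=
  memLp_indicator_const 2 hS 1 (Or.inr hμS)

theorem integrable_of_ae_eq_zero_off {S : Set α} (hS : MeasurableSet S) (hμS : μ S ≠ ⊤)
    (g : Lp E 2 μ) (hg : ∀ᵐ a ∂μ, a ∉ S → g a = 0) : Integrable g μ :=
  (integrable_smul_of_memLp_two (memLp_indicator_one hS hμS) g).congr (indicator_one_smul_ae_eq hg)

theorem integral_norm_le_of_ae_eq_zero_off {S : Set α} (hS : MeasurableSet S) (hμS : μ S ≠ ⊤)
    (g : Lp E 2 μ) (hg : ∀ᵐ a ∂μ, a ∉ S → g a = 0) :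
    ∫ a, ‖g a‖ ∂μ ≤ (eLpNorm (S.indicator (1 : α → ℝ)) 2 μ).toReal * ‖g‖ :=
  (integral_congr_ae ((indicator_one_smul_ae_eq hg).fun_comp norm)).ge.trans
    (integral_norm_smul_le (memLp_indicator_one hS hμS) g)

end FiniteMeasureSupport

section PointValue

variable {k : ℝ} {f g : L2}

/-- The set of those `η` for which the frequency `2πη` lies in the band of `𝓑ₖ`. -/
def bandFrequencies (k : ℝ) : Set Plane :=
  (fun η => (2 * Real.pi) • η) ⁻¹' Metric.closedBall (k • e1) (k / 2)

theorem measurableSet_bandFrequencies (k : ℝ) : MeasurableSet (bandFrequencies k) :=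
  measurable_const_smul (2 * Real.pi) Metric.isClosed_closedBall.measurableSet

theorem volume_bandFrequencies_ne_top (k : ℝ) : volume (bandFrequencies k) ≠ ⊤ := by
  rw [bandFrequencies, Measure.addHaar_preimage_smul volume (by positivity)]
  exact ENNReal.mul_ne_top ENNReal.ofReal_ne_top measure_closedBall_lt_top.ne

theorem IsBandLimited.integrable_fourier (hf : IsBandLimited k f) : Integrable (𝓕 f : L2) :=
  integrable_of_ae_eq_zero_off (measurableSet_bandFrequencies k) (volume_bandFrequencies_ne_top k)
    _ hf.fourier_eq_zero

theorem pointValue_ae_eq (hf : Integrable (𝓕 f : L2)) :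
    (f : Plane → ℂ) =ᵐ[volume] pointValue f := by
  have h := coe_fourierInv_ae_eq (𝓕 f : L2) hf
  rwa [FourierTransform.fourierInv_fourier_eq] at h

theorem continuous_pointValue (hf : Integrable (𝓕 f : L2)) : Continuous (pointValue f) :=
  continuous_fourierInv hf

theorem exists_norm_pointValue_le (k : ℝ) :
    ∃ C : ℝ, 0 ≤ C ∧ ∀ f : L2, IsBandLimited k f → ∀ x, ‖pointValue f x‖ ≤ C * ‖f‖ := by
  refine ⟨(eLpNorm ((bandFrequencies k).indicator (1 : Plane → ℝ)) 2 volume).toReal,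
    ENNReal.toReal_nonneg, fun f hf x => (norm_fourierInv_le _ x).trans ?_⟩
  rw [← Lp.norm_fourier_eq f]
  exact integral_norm_le_of_ae_eq_zero_off (measurableSet_bandFrequencies k)
    (volume_bandFrequencies_ne_top k) _ hf.fourier_eq_zero

theorem exists_ae_norm_le_mul_norm (k : ℝ) :
    ∃ C : ℝ, 0 ≤ C ∧ ∀ f : L2, IsBandLimited k f → ∀ᵐ x, ‖f x‖ ≤ C * ‖f‖ := by
  obtain ⟨C, hC0, hC⟩ := exists_norm_pointValue_le k
  exact ⟨C, hC0, fun f hf => (pointValue_ae_eq hf.integrable_fourier).mono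
    fun x hx => hx ▸ hC f hf x⟩

theorem pointValue_add (hf : Integrable (𝓕 f : L2)) (hg : Integrable (𝓕 g : L2)) (x : Plane) :
    pointValue (f + g) x = pointValue f x + pointValue g x :=
  (Real.fourierInv_congr_ae (fourier_add_ae_eq f g) x).trans
    (congrFun (VectorFourier.fourierIntegral_add Real.continuous_fourierChar
      continuous_neg_innerₗ_uncurry hf hg) x)

theorem pointValue_smul (c : ℂ) (f : L2) (x : Plane) :
    pointValue (c • f) x = c * pointValue f x :=
  (Real.fourierInv_congr_ae (fourier_smul_ae_eq c f) x).trans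
    (congrFun (VectorFourier.fourierIntegral_const_smul 𝐞 volume (-innerₗ Plane) _ c) x)

theorem supNorm_nonneg (f : L2) : 0 ≤ supNorm f := ENNReal.toReal_nonneg

theorem supNorm_le {M : ℝ} (hM : 0 ≤ M) (h : ∀ᵐ x, ‖f x‖ ≤ M) : supNorm f ≤ M :=
  ENNReal.toReal_le_of_le_ofReal hM (eLpNormEssSup_le_of_ae_bound h)

theorem norm_pointValue_le_supNorm (hf : Integrable (𝓕 f : L2)) (x : Plane) :
    ‖pointValue f x‖ ≤ supNorm f := by
  have hfin : eLpNormEssSup f volume ≠ ⊤ := by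
    rw [eLpNormEssSup_congr_ae (pointValue_ae_eq hf)]
    exact (eLpNormEssSup_lt_top_of_ae_bound (.of_forall (norm_fourierInv_le _))).ne
  refine norm_le_of_ae_norm_le (μ := volume) (continuous_pointValue hf) ?_ x
  filter_upwards [ae_le_eLpNormEssSup (f := (f : Plane → ℂ)), pointValue_ae_eq hf] with y hle hy
  rw [← hy, ← toReal_enorm]
  exact ENNReal.toReal_mono hfin hle

end PointValue

/-! ### The tame estimate for the power nonlinearity -/

section Power

variable {r R : ℝ} {f g : L2}

/-- The pointwise nonlinearity `z |z/r|ⁿ`. -/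
def powFun (n : ℕ) (r : ℝ) (z : ℂ) : ℂ := z * (((‖z‖ / r) ^ n : ℝ) : ℂ)

theorem continuous_powFun (n : ℕ) (r : ℝ) : Continuous (powFun n r) := by
  unfold powFun
  fun_prop

theorem norm_powFun_le (n : ℕ) (hr : 0 < r) {a : ℂ} (ha : ‖a‖ ≤ R) :
    ‖powFun n r a‖ ≤ (R / r) ^ n * ‖a‖ := by
  rw [powFun, norm_mul, Complex.norm_real, Real.norm_of_nonneg (by positivity), mul_comm]
  gcongr

theorem norm_mul_abs_norm_div_pow_sub_le (n : ℕ) (hr : 0 < r) {a b : ℂ} (ha : ‖a‖ ≤ R)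
    (hb : ‖b‖ ≤ R) :
    ‖b‖ * |(‖a‖ / r) ^ n - (‖b‖ / r) ^ n| ≤ n * (R / r) ^ n * ‖a - b‖ := by
  cases n with
  | zero => simp
  | succ n =>
    have hR : 0 ≤ R := (norm_nonneg _).trans ha
    have hdiff : |‖a‖ / r - ‖b‖ / r| ≤ ‖a - b‖ / r := by
      rw [← sub_div, abs_div, abs_of_pos hr]
      gcongr
      exact abs_norm_sub_norm_le a b
    have hmax : max |‖a‖ / r| |‖b‖ / r| ≤ R / r := by
      rw [abs_of_nonneg (by positivity), abs_of_nonneg (by positivity)]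
      exact max_le (by gcongr) (by gcongr)
    calc ‖b‖ * |(‖a‖ / r) ^ (n + 1) - (‖b‖ / r) ^ (n + 1)|
        ≤ R * (‖a - b‖ / r * (n + 1 : ℕ) * (R / r) ^ n) := by
          refine mul_le_mul hb ((abs_pow_sub_pow_le _ _ _).trans ?_) (abs_nonneg _) hR
          rw [Nat.add_sub_cancel]
          gcongr
      _ = (n + 1 : ℕ) * (R / r) ^ (n + 1) * ‖a - b‖ := by rw [pow_succ]; ring

theorem norm_powFun_sub_le (n : ℕ) (hr : 0 < r) {a b : ℂ} (ha : ‖a‖ ≤ R) (hb : ‖b‖ ≤ R) :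
    ‖powFun n r a - powFun n r b‖ ≤ (n + 1) * (R / r) ^ n * ‖a - b‖ := by
  have hsplit : powFun n r a - powFun n r b = (a - b) * (((‖a‖ / r) ^ n : ℝ) : ℂ)
      + b * (((‖a‖ / r) ^ n - (‖b‖ / r) ^ n : ℝ) : ℂ) := by
    simp only [powFun]
    push_cast
    ring
  calc ‖powFun n r a - powFun n r b‖
      ≤ ‖a - b‖ * (‖a‖ / r) ^ n + ‖b‖ * |(‖a‖ / r) ^ n - (‖b‖ / r) ^ n| := by
        rw [hsplit]
        refine (norm_add_le _ _).trans (le_of_eq ?_)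
        rw [norm_mul, norm_mul, Complex.norm_real, Complex.norm_real,
          Real.norm_of_nonneg (by positivity), Real.norm_eq_abs]
    _ ≤ ‖a - b‖ * (R / r) ^ n + n * (R / r) ^ n * ‖a - b‖ :=
        add_le_add (by gcongr) (norm_mul_abs_norm_div_pow_sub_le n hr ha hb)
    _ = (n + 1) * (R / r) ^ n * ‖a - b‖ := by ring

theorem memLp_powFun (n : ℕ) (hr : 0 < r) (hf : ∀ᵐ x, ‖f x‖ ≤ R) :
    MemLp (fun x => powFun n r (f x)) 2 volume :=
  MemLp.of_le_mul (Lp.memLp f)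
    ((continuous_powFun n r).comp_aestronglyMeasurable (Lp.aestronglyMeasurable f))
    (hf.mono fun _ => norm_powFun_le n hr)

theorem powTerm_ae_eq (q : ℕ) (hr : 0 < r) (hf : ∀ᵐ x, ‖f x‖ ≤ R) :
    (powTerm q r f : Plane → ℂ) =ᵐ[volume] fun x => powFun (q - 1) r (f x) :=
  toL2_ae_eq (memLp_powFun (q - 1) hr hf)

theorem norm_powTerm_le (q : ℕ) (hr : 0 < r) (hf : ∀ᵐ x, ‖f x‖ ≤ R) :
    ‖powTerm q r f‖ ≤ (R / r) ^ (q - 1) * ‖f‖ := by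
  refine Lp.norm_le_mul_norm_of_ae_le_mul ?_
  filter_upwards [powTerm_ae_eq q hr hf, hf] with x hx hfx
  rw [hx]
  exact norm_powFun_le _ hr hfx

theorem norm_powTerm_sub_le (q : ℕ) (hr : 0 < r) (hf : ∀ᵐ x, ‖f x‖ ≤ R) (hg : ∀ᵐ x, ‖g x‖ ≤ R) :
    ‖powTerm q r f - powTerm q r g‖ ≤ ((q - 1 : ℕ) + 1) * (R / r) ^ (q - 1) * ‖f - g‖ := by
  refine Lp.norm_le_mul_norm_of_ae_le_mul ?_
  filter_upwards [powTerm_ae_eq q hr hf, powTerm_ae_eq q hr hg, hf, hg,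
    Lp.coeFn_sub (powTerm q r f) (powTerm q r g), Lp.coeFn_sub f g]
    with x hPf hPg hfx hgx hsubP hsub
  rw [hsubP, hsub, Pi.sub_apply, Pi.sub_apply, hPf, hPg]
  exact norm_powFun_sub_le _ hr hfx hgx

theorem powTerm_eq_smul (q : ℕ) (hr : 0 < r) (hf : ∀ᵐ x, ‖f x‖ ≤ R) :
    powTerm q r f = (((r⁻¹) ^ (q - 1) : ℝ) : ℂ) • powTerm q 1 f := by
  refine Lp.ext ?_
  filter_upwards [powTerm_ae_eq q hr hf, powTerm_ae_eq q one_pos hf,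
    Lp.coeFn_smul (((r⁻¹) ^ (q - 1) : ℝ) : ℂ) (powTerm q 1 f)] with x hPr hP hsmul
  rw [hPr, hsmul, Pi.smul_apply, hP, powFun, powFun, smul_eq_mul, div_one, div_pow, inv_pow]
  push_cast
  ring

end Power

section Layers

theorem lt_one_add_sq_rpow_iff {s t x : ℝ} (hs : 0 < s) (ht : 1 ≤ t) (hx : 0 ≤ x) :
    t < (1 + x ^ 2) ^ s ↔ √(t ^ s⁻¹ - 1) < x := by
  have hroot : 0 ≤ t ^ s⁻¹ - 1 := sub_nonneg.2 (Real.one_le_rpow ht (by positivity))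
  rw [Real.sqrt_lt hroot hx, ← Real.rpow_inv_lt_iff_of_pos (by positivity) (by positivity) hs,
    sub_lt_iff_lt_add']

theorem one_add_sq_rpow_mul_le {b s x : ℝ} (hb : 1 ≤ b) (hs : 0 ≤ s) :
    (1 + (b * x) ^ 2) ^ s ≤ b ^ (2 * s) * (1 + x ^ 2) ^ s := by
  have hb0 : 0 ≤ b := by linarith
  rw [Real.rpow_mul hb0, Real.rpow_two, ← Real.mul_rpow (by positivity) (by positivity)]
  refine Real.rpow_le_rpow (by positivity) ?_ hs
  nlinarith

variable {α : Type*} [MeasurableSpace α] {μ ν : Measure α}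

theorem lintegral_ofReal_le_of_layers {v w : α → ℝ} (hv : Measurable v) (hw : Measurable w)
    (hv0 : 0 ≤ v) (hw0 : 0 ≤ w) {D : ENNReal} (hD : D ≠ ⊤)
    (h : ∀ t > 0, ν {a | t < v a} ≤ D * μ {a | t < w a}) :
    ∫⁻ a, ENNReal.ofReal (v a) ∂ν ≤ D * ∫⁻ a, ENNReal.ofReal (w a) ∂μ := by
  rw [lintegral_eq_lintegral_meas_lt ν (.of_forall hv0) hv.aemeasurable,
    lintegral_eq_lintegral_meas_lt μ (.of_forall hw0) hw.aemeasurable,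
    ← lintegral_const_mul' _ _ hD]
  exact setLIntegral_mono' measurableSet_Ioi h

theorem lintegral_one_add_sq_rpow_le {d : α → ℝ} (hd : Measurable d) (hd0 : 0 ≤ d) {b s : ℝ}
    (hb : 1 < b) (hs : 0 < s) {D : ENNReal} (hD : D ≠ ⊤) (huniv : ν Set.univ ≤ D * μ Set.univ)
    (htail : ∀ r > 0, ν {a | b * r < d a} ≤ D * μ {a | r < d a}) :
    ∫⁻ a, ENNReal.ofReal ((1 + d a ^ 2) ^ s) ∂ν
      ≤ D * (ENNReal.ofReal (b ^ (2 * s)) * ∫⁻ a, ENNReal.ofReal ((1 + d a ^ 2) ^ s) ∂μ) := by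
  have hmeas : Measurable fun a => (1 + d a ^ 2) ^ s := by fun_prop
  have hb0 : 0 < b := by linarith
  have hone : ∀ a, 1 ≤ (1 + d a ^ 2) ^ s := fun a =>
    Real.one_le_rpow (by linarith [sq_nonneg (d a)]) hs.le
  rw [← lintegral_const_mul _ hmeas.ennreal_ofReal]
  simp_rw [← ENNReal.ofReal_mul (Real.rpow_nonneg hb0.le (2 * s))]
  refine lintegral_ofReal_le_of_layers hmeas (hmeas.const_mul _) (fun a => by positivity)
    (fun a => by positivity) hD fun t _ => ?_
  rcases le_or_gt t 1 with ht1 | ht1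
  · have hlayer : {a | t < b ^ (2 * s) * (1 + d a ^ 2) ^ s} = Set.univ :=
      Set.eq_univ_of_forall fun a => ht1.trans_lt
        (one_lt_mul_of_lt_of_le (Real.one_lt_rpow hb (by positivity)) (hone a))
    rw [hlayer]
    exact (measure_mono (Set.subset_univ _)).trans huniv
  · have hy : 0 < √(t ^ s⁻¹ - 1) :=
      Real.sqrt_pos.2 (sub_pos.2 (Real.one_lt_rpow ht1 (by positivity)))
    refine (measure_mono fun a ha => ?_).trans ((htail _ (div_pos hy hb0)).trans ?_)
    · rw [Set.mem_ofPred_eq, mul_div_cancel₀ _ hb0.ne']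
      exact (lt_one_add_sq_rpow_iff hs ht1.le (hd0 a)).1 ha
    · refine mul_le_mul_right (measure_mono fun a ha => ?_) D
      rw [Set.mem_ofPred_eq, div_lt_iff₀' hb0] at ha
      exact ((lt_one_add_sq_rpow_iff hs ht1.le (mul_nonneg hb0.le (hd0 a))).2 ha).trans_le
        (one_add_sq_rpow_mul_le hb.le hs.le)

end Layers

section PowerSpectrum

variable {f g A B : L2} {c : Plane} {ρ M : ℝ}

/-- The measure `|𝓕f(η)|² dη`: the distribution of the `L²` mass of `f` over the frequencies. -/
def powerSpectrum (f : L2) : Measure Plane := volume.withDensity fun η => ‖(𝓕 f : L2) η‖ₑ ^ 2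

theorem powerSpectrum_univ (f : L2) : powerSpectrum f Set.univ = ‖f‖ₑ ^ 2 := by
  rw [powerSpectrum, withDensity_apply _ .univ, Measure.restrict_univ,
    enorm_sq_eq_lintegral_fourier]

theorem powerSpectrum_le_of_norm_le
    (h : ∀ᵐ η, ‖(𝓕 f : L2) η‖ ≤ ‖(𝓕 g : L2) η‖) : powerSpectrum f ≤ powerSpectrum g := by
  refine withDensity_mono (h.mono fun η hη => ?_)
  change _ ^ 2 ≤ _ ^ 2
  gcongr
  exact enorm_le_iff_norm_le.2 hη

theorem powerSpectrum_le_enorm_sub_sq {S : Set Plane} (hS : MeasurableSet S)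
    (hg : ∀ᵐ η, η ∈ S → (𝓕 g : L2) η = 0) : powerSpectrum f S ≤ ‖f - g‖ₑ ^ 2 := by
  rw [powerSpectrum, withDensity_apply _ hS, enorm_sq_eq_lintegral_fourier]
  refine (setLIntegral_congr_fun_ae hS ?_).trans_le (setLIntegral_le_lintegral S _)
  filter_upwards [hg, fourier_sub_ae_eq f g] with η hzero hsub hη
  rw [hsub, hzero hη, sub_zero]

theorem enorm_sub_sq_le_powerSpectrum {S : Set Plane} (hS : MeasurableSet S)
    (h : ∀ᵐ η, ‖(𝓕 (f - g) : L2) η‖ ≤ ‖(𝓕 f : L2) η‖)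
    (hfg : ∀ᵐ η, η ∉ S → (𝓕 (f - g) : L2) η = 0) : ‖f - g‖ₑ ^ 2 ≤ powerSpectrum f S := by
  rw [powerSpectrum, withDensity_apply _ hS, enorm_sq_eq_lintegral_fourier,
    ← lintegral_indicator hS]
  refine lintegral_mono_ae ?_
  filter_upwards [h, hfg] with η hle hzero
  by_cases hη : η ∈ S
  · rw [Set.indicator_of_mem hη]
    gcongr
    exact enorm_le_iff_norm_le.2 hle
  · simp [hzero hη]

theorem measurableSet_lt_dist (c : Plane) (ρ : ℝ) : MeasurableSet {η | ρ < dist η c} :=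
  measurableSet_lt measurable_const (by fun_prop)

theorem exists_truncation : ∃ C : ℝ, 1 ≤ C ∧ ∀ (c : Plane) (ρ : ℝ), 0 < ρ → ∀ (A : L2) (M : ℝ),
    Integrable (𝓕 A : L2) → (∀ x, ‖pointValue A x‖ ≤ M) → ∃ B : L2,
      Integrable (𝓕 B : L2) ∧ (∀ x, ‖pointValue B x‖ ≤ C * M) ∧
      HasSpectrumIn (pointValue B) (Metric.closedBall c ρ) ∧
      ‖A - B‖ₑ ^ 2 ≤ powerSpectrum A {η | ρ / 2 < dist η c} := by
  let φ : ContDiffBump (0 : Plane) := ⟨1 / 2, 1, by norm_num, by norm_num⟩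
  obtain ⟨C, hC1, hC⟩ := exists_norm_fourierInv_bump_mul_le φ
  refine ⟨C, hC1, fun c ρ hρ A M hA hM => ?_⟩
  have hdist : ∀ η, ‖ρ⁻¹ • (η - c)‖ = dist η c / ρ := fun η => by
    rw [norm_smul, norm_inv, Real.norm_of_nonneg hρ.le, dist_eq_norm, inv_mul_eq_div]
  set a : Plane → ℂ := fun η => (φ (ρ⁻¹ • (η - c)) : ℂ) * (𝓕 A : L2) η with ha
  have haA : ∀ η, ‖a η‖ ≤ ‖(𝓕 A : L2) η‖ := fun η => by
    rw [ha, norm_mul, Complex.norm_real, Real.norm_of_nonneg φ.nonneg]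
    exact mul_le_of_le_one_left (norm_nonneg _) φ.le_one
  have hameas : AEStronglyMeasurable a volume :=
    (Complex.continuous_ofReal.comp
      (φ.continuous.comp (by fun_prop))).aestronglyMeasurable.mul (Lp.aestronglyMeasurable _)
  have haint : Integrable a := hA.mono hameas (.of_forall haA)
  have hB : ((𝓕 (𝓕⁻ (toL2 a) : L2) : L2) : Plane → ℂ) =ᵐ[volume] a := by
    rw [FourierTransform.fourier_fourierInv_eq]
    exact toL2_ae_eq ((Lp.memLp (𝓕 A : L2)).mono hameas (.of_forall haA))
  have hpoint : pointValue (𝓕⁻ (toL2 a) : L2) = 𝓕⁻ a :=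
    funext (Real.fourierInv_congr_ae hB)
  refine ⟨(𝓕⁻ (toL2 a) : L2), haint.congr hB.symm, ?_, ⟨a, haint, fun η hη => ?_, hpoint⟩, ?_⟩
  · exact hpoint ▸ hC ρ⁻¹ c _ hA M hM
  · have hφ : ρ⁻¹ • (η - c) ∈ Function.support φ := fun h0 => hη (by simp [ha, h0])
    rw [φ.support_eq, mem_ball_zero_iff, hdist, div_lt_one hρ] at hφ
    exact hφ.le
  · have hdiff : ∀ᵐ η, (𝓕 (A - 𝓕⁻ (toL2 a)) : L2) η
        = ((1 - φ (ρ⁻¹ • (η - c)) : ℝ) : ℂ) * (𝓕 A : L2) η := by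
      filter_upwards [fourier_sub_ae_eq A (𝓕⁻ (toL2 a)), hB] with η hsub hBη
      rw [hsub, hBη, ha]
      push_cast
      ring
    refine enorm_sub_sq_le_powerSpectrum (measurableSet_lt_dist c _) ?_ ?_
    · filter_upwards [hdiff] with η h
      rw [h, norm_mul, Complex.norm_real, Real.norm_of_nonneg (sub_nonneg.2 φ.le_one)]
      exact mul_le_of_le_one_left (norm_nonneg _) (by linarith [φ.nonneg (x := ρ⁻¹ • (η - c))])
    · filter_upwards [hdiff] with η h hη
      have hφ : φ (ρ⁻¹ • (η - c)) = 1 := φ.one_of_mem_closedBall <| by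
        rw [mem_closedBall_zero_iff, hdist, div_le_div_iff₀ hρ two_pos]
        linarith [not_lt.1 hη]
      rw [h, hφ, sub_self, Complex.ofReal_zero, zero_mul]

theorem fourier_powTerm_eq_zero (m : ℕ) (hρ : 0 ≤ ρ) (hB : Integrable (𝓕 B : L2))
    (hM : ∀ᵐ x, ‖B x‖ ≤ M) (hspec : HasSpectrumIn (pointValue B) (Metric.closedBall c ρ)) :
    ∀ᵐ η, η ∈ {η | (2 * m + 1) * ρ < dist η c} → (𝓕 (powTerm (2 * m + 1) 1 B) : L2) η = 0 := by
  obtain ⟨a, haint, hsupp, ha⟩ := hspec.mul_norm_pow hρ m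
  have hfourier : ((𝓕 (powTerm (2 * m + 1) 1 B) : L2) : Plane → ℂ) =ᵐ[volume] a := by
    refine fourier_ae_eq_of_ae_eq_fourierInv haint ?_
    filter_upwards [powTerm_ae_eq (2 * m + 1) one_pos hM, pointValue_ae_eq hB] with x hP hx
    rw [hP, hx, ← ha, powFun, div_one, Nat.add_sub_cancel]
  filter_upwards [hfourier] with η h hη
  rw [h]
  by_contra ha0
  exact not_le.2 hη (hsupp ha0)

/-- The truncation `B` of `A` at the radius `2r` has a nonlinear term with spectrum in a ball, so
that the high frequencies of the nonlinear term of `A` are controlled by `A - B`. -/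
theorem exists_powerSpectrum_powTerm_tail_le (m : ℕ) : ∃ D : ℝ, 1 ≤ D ∧
    ∀ (c : Plane) (A : L2) (M : ℝ), Integrable (𝓕 A : L2) → (∀ x, ‖pointValue A x‖ ≤ M) →
    ∀ r > 0, powerSpectrum (powTerm (2 * m + 1) 1 A) {η | (2 * (2 * m + 1)) * r < dist η c}
      ≤ ENNReal.ofReal (D * M ^ (2 * m)) ^ 2 * powerSpectrum A {η | r < dist η c} := by
  obtain ⟨C, hC1, hC⟩ := exists_truncation
  have hCm : (1 : ℝ) ≤ C ^ (2 * m) := one_le_pow₀ hC1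
  refine ⟨(2 * m + 1) * C ^ (2 * m), by nlinarith, fun c A M hA hM r hr => ?_⟩
  have hM0 : 0 ≤ M := (norm_nonneg _).trans (hM 0)
  obtain ⟨B, hB, hBM, hspec, hAB⟩ := hC c (2 * r) (by positivity) A M hA hM
  have hA' : ∀ᵐ x, ‖A x‖ ≤ C * M := by
    filter_upwards [pointValue_ae_eq hA] with x hx
    exact hx ▸ (hM x).trans (le_mul_of_one_le_left hM0 hC1)
  have hB' : ∀ᵐ x, ‖B x‖ ≤ C * M := by
    filter_upwards [pointValue_ae_eq hB] with x hx
    exact hx ▸ hBM x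
  have hlip : ‖powTerm (2 * m + 1) 1 A - powTerm (2 * m + 1) 1 B‖ₑ
      ≤ ENNReal.ofReal ((2 * m + 1) * C ^ (2 * m) * M ^ (2 * m)) * ‖A - B‖ₑ := by
    rw [← ofReal_norm, ← ofReal_norm, ← ENNReal.ofReal_mul (by positivity)]
    refine ENNReal.ofReal_le_ofReal ((norm_powTerm_sub_le _ one_pos hA' hB').trans_eq ?_)
    rw [Nat.add_sub_cancel, div_one, mul_pow]
    push_cast
    ring
  rw [mul_div_cancel_left₀ r two_ne_zero] at hAB
  have hzero := fourier_powTerm_eq_zero m (by positivity) hB hB' hspec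
  calc powerSpectrum (powTerm (2 * m + 1) 1 A) {η | (2 * (2 * m + 1)) * r < dist η c}
      = powerSpectrum (powTerm (2 * m + 1) 1 A) {η | (2 * m + 1) * (2 * r) < dist η c} := by
        rw [mul_comm (2 : ℝ), mul_assoc]
    _ ≤ ‖powTerm (2 * m + 1) 1 A - powTerm (2 * m + 1) 1 B‖ₑ ^ 2 :=
        powerSpectrum_le_enorm_sub_sq (measurableSet_lt_dist c _) hzero
    _ ≤ ENNReal.ofReal ((2 * m + 1) * C ^ (2 * m) * M ^ (2 * m)) ^ 2 * ‖A - B‖ₑ ^ 2 := by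
        rw [← mul_pow]
        gcongr
    _ ≤ _ := by gcongr

theorem exists_lintegral_powerSpectrum_powTerm_le (m : ℕ) {s : ℝ} (hs : 0 < s) :
    ∃ K : ℝ, 1 ≤ K ∧ ∀ (c : Plane) (ε : ℝ), 0 < ε → ∀ (A : L2) (M : ℝ), Integrable (𝓕 A : L2) →
      (∀ x, ‖pointValue A x‖ ≤ M) →
      ∫⁻ η, ENNReal.ofReal ((1 + (dist η c / ε) ^ 2) ^ s) ∂powerSpectrum (powTerm (2 * m + 1) 1 A)
        ≤ ENNReal.ofReal (K * M ^ (2 * m)) ^ 2 *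
          ∫⁻ η, ENNReal.ofReal ((1 + (dist η c / ε) ^ 2) ^ s) ∂powerSpectrum A := by
  obtain ⟨D, hD1, hD⟩ := exists_powerSpectrum_powTerm_tail_le m
  set b : ℝ := 2 * (2 * m + 1)
  have hb : 1 < b := by simp only [b]; linarith [(Nat.cast_nonneg m : (0 : ℝ) ≤ m)]
  refine ⟨D * b ^ s, one_le_mul_of_one_le_of_one_le hD1 (Real.one_le_rpow hb.le hs.le),
    fun c ε hε A M hA hM => ?_⟩
  have hM0 : 0 ≤ M := (norm_nonneg _).trans (hM 0)
  have huniv : powerSpectrum (powTerm (2 * m + 1) 1 A) Set.univ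
      ≤ ENNReal.ofReal (D * M ^ (2 * m)) ^ 2 * powerSpectrum A Set.univ := by
    have hAM : ∀ᵐ x, ‖A x‖ ≤ M := (pointValue_ae_eq hA).mono fun x hx => hx ▸ hM x
    rw [powerSpectrum_univ, powerSpectrum_univ, ← mul_pow, ← ofReal_norm, ← ofReal_norm,
      ← ENNReal.ofReal_mul (by positivity)]
    gcongr
    refine (norm_powTerm_le (2 * m + 1) one_pos hAM).trans ?_
    rw [Nat.add_sub_cancel, div_one]
    gcongr
    exact le_mul_of_one_le_left (by positivity) hD1
  refine (lintegral_one_add_sq_rpow_le (by fun_prop) (fun η => by positivity) hb hs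
    (by finiteness) huniv fun r hr => ?_).trans_eq ?_
  · simp_rw [lt_div_iff₀ hε, mul_assoc]
    exact hD c A M hA hM (r * ε) (by positivity)
  · have hb0 : 0 ≤ b := by linarith
    have hfactor : ENNReal.ofReal (b ^ (2 * s)) = ENNReal.ofReal (b ^ s) ^ 2 := by
      rw [← ENNReal.ofReal_pow (by positivity), ← Real.rpow_mul_natCast hb0, mul_comm s]
      norm_num
    rw [hfactor, ← mul_assoc, ← mul_pow, ← ENNReal.ofReal_mul (by positivity), mul_right_comm]

end PowerSpectrum

section Symbols

variable {s k ε : ℝ} {f : L2}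

/-- The symbol of `Λˢ_ε` as a continuous function. -/
def besselC (s k ε : ℝ) : C(Plane, ℝ) where
  toFun := rescaledSymbol k ε (besselSymbol s)
  continuous_toFun := by
    unfold rescaledSymbol besselSymbol
    exact Continuous.rpow_const (by fun_prop) fun ξ => Or.inl (by positivity)

/-- The symbol of `|D|ᵖ` as a continuous function, for `p > 0`. -/
def rieszC (p : ℝ) (hp : 0 < p) : C(Plane, ℝ) where
  toFun := rieszSymbol p
  continuous_toFun := continuous_norm.rpow_const fun _ => Or.inr hp.le

theorem IsBandLimited.Lam_eq (hf : IsBandLimited k f) : Lam s k ε f = bandOp k (besselC s k ε) f :=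
  hf.multiplier_eq_bandOp (besselC s k ε)

theorem IsBandLimited.absD_eq {p : ℝ} (hp : 0 < p) (hf : IsBandLimited k f) :
    absD p f = bandOp k (rieszC p hp) f :=
  hf.multiplier_eq_bandOp (rieszC p hp)

theorem IsBandLimited.isBandLimited_Lam (hf : IsBandLimited k f) :
    IsBandLimited k (Lam s k ε f) :=
  hf.Lam_eq ▸ isBandLimited_bandOp k _ f

theorem besselC_mul_neg (s k ε : ℝ) : besselC s k ε * besselC (-s) k ε = 1 := by
  ext ξ
  change (_ : ℝ) ^ (s / 2) * (_ : ℝ) ^ (-s / 2) = 1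
  rw [← Real.rpow_add (by positivity), ← add_div, add_neg_cancel, zero_div, Real.rpow_zero]

theorem IsBandLimited.Lam_Lam_neg (hf : IsBandLimited k f) :
    Lam s k ε (Lam (-s) k ε f) = f := by
  rw [hf.isBandLimited_Lam.Lam_eq, hf.Lam_eq, bandOp_bandOp, besselC_mul_neg, hf.bandOp_one_eq]

theorem besselC_sq_apply (s k : ℝ) (hε : 0 < ε) (η : Plane) :
    besselC s k ε ((2 * Real.pi) • η) ^ 2
      = (1 + (dist η ((2 * Real.pi)⁻¹ • k • e1) / (ε / (2 * Real.pi))) ^ 2) ^ s := by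
  have hscale : (2 * Real.pi) • η - k • e1
      = (2 * Real.pi) • (η - (2 * Real.pi)⁻¹ • k • e1) := by
    rw [smul_sub, smul_inv_smul₀ (by positivity)]
  change ((‖ε⁻¹ • ((2 * Real.pi) • η - k • e1)‖ ^ 2 + 1) ^ (s / 2)) ^ 2 = _
  rw [← Real.rpow_mul_natCast (by positivity), hscale, norm_smul, norm_smul, norm_inv,
    Real.norm_of_nonneg hε.le, Real.norm_of_nonneg Real.two_pi_pos.le, dist_eq_norm, add_comm,
    div_div_eq_mul_div, mul_comm (2 * Real.pi), inv_mul_eq_div]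
  norm_num

theorem IsBandLimited.enorm_Lam_sq (hε : 0 < ε) (hf : IsBandLimited k f) :
    ‖Lam s k ε f‖ₑ ^ 2 = ∫⁻ η, ENNReal.ofReal
      ((1 + (dist η ((2 * Real.pi)⁻¹ • k • e1) / (ε / (2 * Real.pi))) ^ 2) ^ s)
        ∂powerSpectrum f := by
  rw [powerSpectrum, lintegral_withDensity_eq_lintegral_mul₀
    ((Lp.aestronglyMeasurable (𝓕 f : L2)).enorm.pow_const 2) (by fun_prop),
    enorm_sq_eq_lintegral_fourier]
  refine lintegral_congr_ae ?_
  filter_upwards [fourier_multiplier_ae_eq (hf.inDomain (besselC s k ε))] with η h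
  rw [Pi.mul_apply, ← besselC_sq_apply s k hε, show (𝓕 (Lam s k ε f) : L2) η = _ from h,
    ← ofReal_norm, norm_symbolMul, ENNReal.ofReal_mul (by positivity), ofReal_norm, mul_pow,
    ← ENNReal.ofReal_pow (by positivity), sq_abs, mul_comm]

/-- The tame estimate with constant `K` for the `q`-th power nonlinearity in the norm of `Λˢ_ε`. -/
def TameBound (q : ℕ) (s k ε K : ℝ) : Prop := ∀ f : L2, IsBandLimited k f →
  ‖Lam s k ε (band k (powTerm q 1 f))‖ ≤ K * supNorm f ^ (q - 1) * ‖Lam s k ε f‖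

theorem exists_tameBound {q : ℕ} (hq : Odd q) (hs : 0 < s) :
    ∃ K : ℝ, 1 ≤ K ∧ ∀ k ε : ℝ, 0 < ε → TameBound q s k ε K := by
  obtain ⟨m, rfl⟩ := hq
  obtain ⟨K, hK1, hK⟩ := exists_lintegral_powerSpectrum_powTerm_le m hs
  refine ⟨K, hK1, fun k ε hε f hf => ?_⟩
  have hle : powerSpectrum (band k (powTerm (2 * m + 1) 1 f))
      ≤ powerSpectrum (powTerm (2 * m + 1) 1 f) := by
    refine powerSpectrum_le_of_norm_le ?_
    filter_upwards [fourier_band_ae_eq k (powTerm (2 * m + 1) 1 f)] with η h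
    rw [h, norm_symbolMul]
    exact mul_le_of_le_one_left (norm_nonneg _) (abs_bandSymbol_le _ _)
  have hsup := supNorm_nonneg f
  have hsq : ‖Lam s k ε (band k (powTerm (2 * m + 1) 1 f))‖ₑ ^ 2
      ≤ (ENNReal.ofReal (K * supNorm f ^ (2 * m)) * ‖Lam s k ε f‖ₑ) ^ 2 := by
    rw [mul_pow, hf.enorm_Lam_sq hε, (isBandLimited_band k _).enorm_Lam_sq hε]
    exact (lintegral_mono' hle le_rfl).trans (hK _ _ (by positivity) f _ hf.integrable_fourier
      (norm_pointValue_le_supNorm hf.integrable_fourier))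
  rw [Nat.add_sub_cancel]
  rwa [← ofReal_norm, ← ofReal_norm, ← ENNReal.ofReal_mul (by positivity),
    ENNReal.pow_le_pow_left_iff two_ne_zero, ENNReal.ofReal_le_ofReal_iff (by positivity)] at hsq

end Symbols

/-! ### Bounded Lipschitz functions -/

section BoundedLipschitz

variable {E Y Z W : Type*} [PseudoMetricSpace E] [NormedAddCommGroup Y] [NormedAddCommGroup Z]
  [NormedAddCommGroup W] {S S' : Set E}

/-- `f` is bounded and Lipschitz on `S`. The nonlinearities of the equation are of this kind on
bounded sets, which makes the existence time of solutions uniform in the data. -/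
structure BoundedLipschitzOn (f : E → Y) (S : Set E) : Prop where
  bounded : ∃ C : ℝ, 0 ≤ C ∧ ∀ x ∈ S, ‖f x‖ ≤ C
  lipschitz : ∃ K : NNReal, LipschitzOnWith K f S

namespace BoundedLipschitzOn

theorem of_le {f : E → Y} {C K : ℝ} (hbound : ∀ x ∈ S, ‖f x‖ ≤ C)
    (hlip : ∀ x ∈ S, ∀ y ∈ S, dist (f x) (f y) ≤ K * dist x y) : BoundedLipschitzOn f S :=
  ⟨⟨max 0 C, le_max_left _ _, fun x hx => (hbound x hx).trans (le_max_right _ _)⟩,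
    _, LipschitzOnWith.of_dist_le' hlip⟩

theorem mono {f : E → Y} (hf : BoundedLipschitzOn f S) (h : S' ⊆ S) : BoundedLipschitzOn f S' :=
  ⟨hf.bounded.imp fun _ hC => ⟨hC.1, fun x hx => hC.2 x (h hx)⟩,
    hf.lipschitz.imp fun _ hK => hK.mono h⟩

theorem continuousOn {f : E → Y} (hf : BoundedLipschitzOn f S) : ContinuousOn f S :=
  hf.lipschitz.choose_spec.continuousOn

theorem exists_dist_le {f : E → Y} (hf : BoundedLipschitzOn f S) {b : ℝ} (hb : 0 < b) :
    ∃ r > 0, ∀ x ∈ S, ∀ y ∈ S, dist x y ≤ r → dist (f x) (f y) ≤ b := by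
  obtain ⟨K, hK⟩ := hf.lipschitz
  refine ⟨b / (K + 1), by positivity, fun x hx y hy hxy => (hK.dist_le_mul x hx y hy).trans ?_⟩
  rw [le_div_iff₀ (by positivity)] at hxy
  nlinarith [dist_nonneg (x := x) (y := y)]

theorem const (c : Y) : BoundedLipschitzOn (fun _ : E => c) S :=
  of_le (fun _ _ => le_rfl) (K := 0) (by simp)

theorem add {f g : E → Y} (hf : BoundedLipschitzOn f S) (hg : BoundedLipschitzOn g S) :
    BoundedLipschitzOn (fun x => f x + g x) S := by
  obtain ⟨⟨C, hC, hfC⟩, K, hK⟩ := hf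
  obtain ⟨⟨D, hD, hgD⟩, L, hL⟩ := hg
  exact ⟨⟨C + D, add_nonneg hC hD,
    fun x hx => norm_add_le_of_le (hfC x hx) (hgD x hx)⟩, _, hK.add hL⟩

theorem lipschitz_comp {f : E → Y} (hf : BoundedLipschitzOn f S) {φ : Y → Z} {T : Set Y}
    {K : NNReal} {y₀ : Y} (hy₀ : y₀ ∈ T) (hφ : LipschitzOnWith K φ T) (hT : Set.MapsTo f S T) :
    BoundedLipschitzOn (fun x => φ (f x)) S := by
  obtain ⟨⟨C, hC, hfC⟩, L, hL⟩ := hf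
  refine ⟨⟨K * (C + ‖y₀‖) + ‖φ y₀‖, by positivity, fun x hx => ?_⟩, _, hφ.comp hL hT⟩
  have hφx := hφ.dist_le_mul _ (hT hx) _ hy₀
  rw [dist_eq_norm, dist_eq_norm] at hφx
  calc ‖φ (f x)‖ ≤ ‖φ (f x) - φ y₀‖ + ‖φ y₀‖ := norm_le_norm_sub_add _ _
    _ ≤ K * ‖f x - y₀‖ + ‖φ y₀‖ := by gcongr
    _ ≤ K * (C + ‖y₀‖) + ‖φ y₀‖ := by
        gcongr
        exact norm_sub_le_of_le (hfC x hx) le_rfl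

variable [NormedSpace ℝ Y] [NormedSpace ℝ Z] [NormedSpace ℝ W]

theorem bilin {f : E → Y} {g : E → Z} (hf : BoundedLipschitzOn f S) (hg : BoundedLipschitzOn g S)
    (B : Y →L[ℝ] Z →L[ℝ] W) : BoundedLipschitzOn (fun x => B (f x) (g x)) S := by
  obtain ⟨⟨C, hC, hfC⟩, K, hK⟩ := hf
  obtain ⟨⟨D, -, hgD⟩, L, hL⟩ := hg
  refine of_le (C := ‖B‖ * C * D) (K := ‖B‖ * K * D + ‖B‖ * C * L) (fun x hx => ?_)
    fun x hx y hy => ?_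
  · exact (B.le_opNorm₂ _ _).trans (by gcongr; exacts [hfC x hx, hgD x hx])
  have hsplit : B (f x) (g x) - B (f y) (g y) = B (f x - f y) (g x) + B (f y) (g x - g y) := by
    simp only [map_sub, sub_apply]
    abel
  have hfxy := hK.dist_le_mul x hx y hy
  have hgxy := hL.dist_le_mul x hx y hy
  rw [dist_eq_norm] at hfxy hgxy
  rw [dist_eq_norm, hsplit]
  calc ‖B (f x - f y) (g x) + B (f y) (g x - g y)‖
      ≤ ‖B‖ * ‖f x - f y‖ * ‖g x‖ + ‖B‖ * ‖f y‖ * ‖g x - g y‖ :=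
        norm_add_le_of_le (B.le_opNorm₂ _ _) (B.le_opNorm₂ _ _)
    _ ≤ ‖B‖ * (K * dist x y) * D + ‖B‖ * C * (L * dist x y) := by
        gcongr
        exacts [hgD x hx, hfC y hy]
    _ = (‖B‖ * K * D + ‖B‖ * C * L) * dist x y := by ring

theorem clm {f : E → Y} (hf : BoundedLipschitzOn f S) (A : Y →L[ℝ] Z) :
    BoundedLipschitzOn (fun x => A (f x)) S :=
  hf.lipschitz_comp (Set.mem_univ 0) A.lipschitz.lipschitzOnWith (Set.mapsTo_univ _ _)

theorem smul {f : E → ℝ} {g : E → Z} (hf : BoundedLipschitzOn f S)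
    (hg : BoundedLipschitzOn g S) : BoundedLipschitzOn (fun x => f x • g x) S :=
  hf.bilin hg (ContinuousLinearMap.lsmul ℝ ℝ)

theorem mul {f g : E → ℝ} (hf : BoundedLipschitzOn f S) (hg : BoundedLipschitzOn g S) :
    BoundedLipschitzOn (fun x => f x * g x) S :=
  hf.smul hg

theorem inner {H : Type*} [NormedAddCommGroup H] [InnerProductSpace ℝ H] {f g : E → H}
    (hf : BoundedLipschitzOn f S) (hg : BoundedLipschitzOn g S) :
    BoundedLipschitzOn (fun x => inner ℝ (f x) (g x)) S :=
  hf.bilin hg (innerSL ℝ)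

theorem neg {f : E → Y} (hf : BoundedLipschitzOn f S) : BoundedLipschitzOn (fun x => -f x) S :=
  hf.clm (-ContinuousLinearMap.id ℝ Y)

theorem sub {f g : E → Y} (hf : BoundedLipschitzOn f S) (hg : BoundedLipschitzOn g S) :
    BoundedLipschitzOn (fun x => f x - g x) S := by
  simpa only [sub_eq_add_neg] using hf.add hg.neg

end BoundedLipschitzOn

theorem lipschitzOnWith_sqrt_Ici {d : ℝ} (hd : 0 < d) :
    LipschitzOnWith (√d)⁻¹.toNNReal Real.sqrt (Set.Ici d) :=
  LipschitzOnWith.of_dist_le' fun x hx y hy => by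
    have hdx : √d ≤ √x := Real.sqrt_le_sqrt hx
    have hd' : 0 < √d := Real.sqrt_pos.2 hd
    have hsub : x - y = (√x - √y) * (√x + √y) := by
      linear_combination -Real.mul_self_sqrt (hd.le.trans hx) + Real.mul_self_sqrt (hd.le.trans hy)
    rw [Real.dist_eq, Real.dist_eq, inv_mul_eq_div, le_div_iff₀ hd', hsub, abs_mul,
      abs_of_nonneg (by positivity : 0 ≤ √x + √y)]
    gcongr
    linarith [Real.sqrt_nonneg y]

theorem lipschitzOnWith_inv_Ici {d : ℝ} (hd : 0 < d) :
    LipschitzOnWith (d⁻¹ * d⁻¹).toNNReal (fun x : ℝ => x⁻¹) (Set.Ici d) :=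
  LipschitzOnWith.of_dist_le' fun x hx y hy => by
    have hx0 : 0 < x := hd.trans_le hx
    have hy0 : 0 < y := hd.trans_le hy
    have hsub : x⁻¹ - y⁻¹ = x⁻¹ * y⁻¹ * (y - x) := by field_simp
    rw [Real.dist_eq, Real.dist_eq, hsub, abs_mul, abs_of_pos (by positivity : 0 < x⁻¹ * y⁻¹),
      abs_sub_comm]
    gcongr
    exacts [hx, hy]

theorem BoundedLipschitzOn.sqrt {f : E → ℝ} (hf : BoundedLipschitzOn f S) {d : ℝ} (hd : 0 < d)
    (h : ∀ x ∈ S, d ≤ f x) : BoundedLipschitzOn (fun x => √(f x)) S :=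
  hf.lipschitz_comp Set.self_mem_Ici (lipschitzOnWith_sqrt_Ici hd) h

theorem BoundedLipschitzOn.inv {f : E → ℝ} (hf : BoundedLipschitzOn f S) {d : ℝ} (hd : 0 < d)
    (h : ∀ x ∈ S, d ≤ f x) : BoundedLipschitzOn (fun x => (f x)⁻¹) S :=
  hf.lipschitz_comp Set.self_mem_Ici (lipschitzOnWith_inv_Ici hd) h

end BoundedLipschitz

/-! ### Second order differential equations -/

section SecondOrder

open Metric Set

variable {X : Type*} [NormedAddCommGroup X]

theorem exists_hasDerivWithinAt_mem_closedBall [NormedSpace ℝ X] [CompleteSpace X]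
    {f : ℝ → X → X} {a b : ℝ} {t₀ : Icc a b} {x₀ : X} {r L K : NNReal}
    (hf : IsPicardLindelof f t₀ x₀ r 0 L K) :
    ∃ α : ℝ → X, α t₀ = x₀ ∧ ∀ t ∈ Icc a b, α t ∈ closedBall x₀ r ∧
      HasDerivWithinAt α (f t (α t)) (Icc a b) t := by
  have hx₀ : x₀ ∈ closedBall x₀ ((0 : NNReal) : ℝ) := mem_closedBall_self le_rfl
  obtain ⟨α, hα⟩ := ODE.FunSpace.exists_isFixedPt_next hf hx₀
  have hball : ∀ t, α.compProj t ∈ closedBall x₀ r := fun t =>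
    α.compProj_mem_closedBall hf.mul_max_le
  have hpicard : ∀ t ∈ Icc a b, α.compProj t = ODE.picard f t₀ x₀ α.compProj t := fun t ht => by
    conv_lhs => rw [← hα.eq]
    rw [ODE.FunSpace.compProj_of_mem ht, ODE.FunSpace.next_apply]
  refine ⟨α.compProj, by rw [hpicard t₀ t₀.2, ODE.picard_apply₀], fun t ht => ⟨hball t, ?_⟩⟩
  exact (ODE.hasDerivWithinAt_picard_Icc t₀.2 hf.continuousOn_uncurry
    α.continuous_compProj.continuousOn (fun t _ => hball t) x₀ ht).congr_of_mem hpicard ht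

theorem isPicardLindelof_second_order {Φ : ℝ → X → X} {z₀ v₀ : X} {τ : ℝ} {r L K : NNReal}
    (hτ : 0 ≤ τ) (hv₀ : ‖v₀‖ ≤ L) (hτL : (L + r) * τ ≤ r)
    (hlip : ∀ t ∈ Icc 0 τ, LipschitzOnWith K (Φ t) (closedBall z₀ r))
    (hcont : ∀ x ∈ closedBall z₀ r, ContinuousOn (fun t => Φ t x) (Icc 0 τ))
    (hbound : ∀ t ∈ Icc 0 τ, ∀ x ∈ closedBall z₀ r, ‖Φ t x‖ ≤ L) :
    IsPicardLindelof (fun t (y : X × X) => (y.2, Φ t y.1)) (⟨0, left_mem_Icc.2 hτ⟩ : Icc 0 τ)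
      (z₀, v₀) r 0 (L + r) (max 1 K) := by
  have hball : ∀ y ∈ closedBall (z₀, v₀) (r : ℝ),
      y.1 ∈ closedBall z₀ r ∧ y.2 ∈ closedBall v₀ r := fun y hy => by
    rwa [← closedBall_prod_same] at hy
  refine ⟨fun t ht => ?_, fun y hy => ?_, fun t ht y hy => ?_, ?_⟩
  · have hfst : MapsTo Prod.fst (closedBall (z₀, v₀) (r : ℝ)) (closedBall z₀ r) :=
      fun y hy => (hball y hy).1
    have hsnd : LipschitzOnWith 1 (Prod.snd : X × X → X) (closedBall (z₀, v₀) r) :=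
      LipschitzWith.prod_snd.lipschitzOnWith
    have h := hsnd.prodMk ((hlip t ht).comp LipschitzWith.prod_fst.lipschitzOnWith hfst)
    rwa [mul_one] at h
  · exact continuousOn_const.prodMk (hcont y.1 (hball y hy).1)
  · have hv : ‖y.2‖ ≤ L + r :=
      (norm_le_norm_add_norm_sub' _ v₀).trans (add_le_add hv₀ (mem_closedBall_iff_norm.1
        (hball y hy).2))
    exact max_le hv ((hbound t ht y.1 (hball y hy).1).trans (by simp))
  · simpa [hτ] using hτL

theorem exists_second_order [NormedSpace ℝ X] [CompleteSpace X] {Φ : ℝ → X → X} {z₀ v₀ : X}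
    {τ : ℝ} {r L K : NNReal} (hτ : 0 ≤ τ) (hv₀ : ‖v₀‖ ≤ L) (hτL : (L + r) * τ ≤ r)
    (hlip : ∀ t ∈ Icc 0 τ, LipschitzOnWith K (Φ t) (closedBall z₀ r))
    (hcont : ∀ x ∈ closedBall z₀ r, ContinuousOn (fun t => Φ t x) (Icc 0 τ))
    (hbound : ∀ t ∈ Icc 0 τ, ∀ x ∈ closedBall z₀ r, ‖Φ t x‖ ≤ L) :
    ∃ z v : ℝ → X, z 0 = z₀ ∧ v 0 = v₀ ∧ ∀ t ∈ Icc 0 τ,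
      z t ∈ closedBall z₀ r ∧ v t ∈ closedBall v₀ r ∧
      HasDerivWithinAt z (v t) (Icc 0 τ) t ∧ HasDerivWithinAt v (Φ t (z t)) (Icc 0 τ) t := by
  obtain ⟨y, hy₀, hy⟩ := exists_hasDerivWithinAt_mem_closedBall
    (isPicardLindelof_second_order hτ hv₀ hτL hlip hcont hbound)
  refine ⟨fun t => (y t).1, fun t => (y t).2, congrArg Prod.fst hy₀, congrArg Prod.snd hy₀,
    fun t ht => ?_⟩
  obtain ⟨hball, hderiv⟩ := hy t ht
  rw [← closedBall_prod_same] at hball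
  exact ⟨hball.1, hball.2,
    (ContinuousLinearMap.fst ℝ X X).hasFDerivAt.comp_hasDerivWithinAt t hderiv,
    (ContinuousLinearMap.snd ℝ X X).hasFDerivAt.comp_hasDerivWithinAt t hderiv⟩

theorem exists_uniform_second_order [NormedSpace ℝ X] [CompleteSpace X] {Q : Type*}
    [PseudoMetricSpace Q] {V : X × Q → X} {S : Set (X × Q)} (hV : BoundedLipschitzOn V S)
    {r : ℝ} (hr : 0 < r) {R c : NNReal} :
    ∃ τ > 0, ∀ (z₀ v₀ : X) (θ : ℝ → Q), ‖v₀‖ ≤ R → LipschitzWith c θ →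
      (∀ t y, dist (y, θ t) (z₀, θ 0) ≤ r → (y, θ t) ∈ S) →
      ∃ z v : ℝ → X, z 0 = z₀ ∧ v 0 = v₀ ∧ ContinuousOn (fun t => V (z t, θ t)) (Icc 0 τ) ∧
        ∀ t ∈ Icc 0 τ, dist (z t, θ t) (z₀, θ 0) ≤ r ∧ dist (v t) v₀ ≤ r ∧
          HasDerivWithinAt z (v t) (Icc 0 τ) t ∧
          HasDerivWithinAt v (V (z t, θ t)) (Icc 0 τ) t := by
  lift r to NNReal using hr.le
  have ⟨⟨C, hC, hVC⟩, K, hVK⟩ := hV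
  lift C to NNReal using hC
  refine ⟨r / (C + R + r + c), by positivity, fun z₀ v₀ θ hv₀ hθ hS => ?_⟩
  set τ : ℝ := r / (C + R + r + c)
  have hτ : (C + R + r + c) * τ = r := mul_div_cancel₀ _ (by positivity)
  have hτ₀ : 0 < τ := by positivity
  have hτL : ((C + R : NNReal) + r) * τ ≤ r := by
    rw [← hτ]
    push_cast
    nlinarith [c.2]
  have hpath : ∀ t ∈ Icc 0 τ, ∀ y ∈ closedBall z₀ r, dist (y, θ t) (z₀, θ 0) ≤ r := by
    refine fun t ht y hy => max_le hy ((hθ.dist_le_mul t 0).trans ?_)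
    rw [Real.dist_0_eq_abs, abs_of_nonneg ht.1]
    refine (mul_le_mul_of_nonneg_left ht.2 c.2).trans ?_
    rw [← hτ]
    exact mul_le_mul_of_nonneg_right (le_add_of_nonneg_left (by positivity)) hτ₀.le
  obtain ⟨z, v, hz₀, hv₀, hzv⟩ := exists_second_order (Φ := fun t y => V (y, θ t)) (K := K * 1)
    (L := C + R) hτ₀.le (hv₀.trans (by simp)) hτL
    (fun t ht => hVK.comp (LipschitzWith.prodMk_right (θ t)).lipschitzOnWith
      fun y hy => hS t y (hpath t ht y hy))
    (fun y hy => hV.continuousOn.comp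
      (continuousOn_const.prodMk hθ.continuous.continuousOn) fun t ht => hS t y (hpath t ht y hy))
    fun t ht y hy => (hVC _ (hS t y (hpath t ht y hy))).trans (by simp)
  refine ⟨z, v, hz₀, hv₀, ?_, fun t ht => ?_⟩
  · have hz : ContinuousOn z (Icc 0 τ) := fun t ht => (hzv t ht).2.2.1.continuousWithinAt
    exact hV.continuousOn.comp (hz.prodMk hθ.continuous.continuousOn) fun t ht =>
      hS t _ (hpath t ht _ (hzv t ht).1)
  · obtain ⟨hzt, hvt, hderiv⟩ := hzv t ht
    exact ⟨hpath t ht _ hzt, hvt, hderiv⟩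

theorem map_eq_of_map_deriv_eq_zero [NormedSpace ℝ X] {Y : Type*} [NormedAddCommGroup Y]
    [NormedSpace ℝ Y] (A : X →L[ℝ] Y) {y y' : ℝ → X} {a b : ℝ}
    (hy : ∀ t ∈ Icc a b, HasDerivWithinAt y (y' t) (Icc a b) t)
    (hA : ∀ t ∈ Icc a b, A (y' t) = 0) : ∀ t ∈ Icc a b, A (y t) = A (y a) := by
  have hAy : ∀ t ∈ Icc a b, HasDerivWithinAt (fun t => A (y t)) 0 (Icc a b) t := fun t ht =>
    hA t ht ▸ A.hasFDerivAt.comp_hasDerivWithinAt t (hy t ht)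
  exact constant_of_has_deriv_right_zero (fun t ht => (hAy t ht).continuousWithinAt) fun t ht =>
    (hAy t ⟨ht.1, ht.2.le⟩).mono_of_mem_nhdsWithin (Icc_mem_nhdsGE_of_mem ht)

end SecondOrder

/-! ### The quadratic equation for the penalization -/

section Root

variable {H : Type*} [NormedAddCommGroup H] [InnerProductSpace ℝ H]

/-- `γ` is a simple root of the quadratic equation `‖f - γ n‖² = M (2γ - γ²)`: half the derivative
of `M (2γ - γ²) - ‖f - γ n‖²` at the root is at least `d`. -/
structure IsPenRoot (f n : H) (M d γ : ℝ) : Prop where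
  norm_sub_smul_sq : ‖f - γ • n‖ ^ 2 = M * (2 * γ - γ ^ 2)
  le_slope : d ≤ M * (1 - γ) + inner ℝ (f - γ • n) n

/-- A quarter of the discriminant of the quadratic equation `‖f - γ n‖² = M (2γ - γ²)`. -/
def penDisc (f n : H) (M : ℝ) : ℝ :=
  (M + inner ℝ f n) * (M + inner ℝ f n) - (inner ℝ n n + M) * inner ℝ f f

/-- The smaller root of the quadratic equation `‖f - γ n‖² = M (2γ - γ²)`; meaningful for `0 < M`
and `0 ≤ penDisc f n M`. -/
def penRoot (f n : H) (M : ℝ) : ℝ :=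
  ((M + inner ℝ f n) - √(penDisc f n M)) * (inner ℝ n n + M)⁻¹

theorem norm_sub_smul_sq_eq_inner (f n : H) (γ : ℝ) :
    ‖f - γ • n‖ ^ 2 = inner ℝ f f - 2 * γ * inner ℝ f n + γ ^ 2 * inner ℝ n n := by
  rw [norm_sub_sq_real, norm_smul, mul_pow, Real.norm_eq_abs, sq_abs, inner_smul_right,
    real_inner_self_eq_norm_sq, real_inner_self_eq_norm_sq]
  ring

theorem norm_sub_penRoot_smul_sq {f n : H} {M : ℝ} (hM : 0 < M) (hD : 0 ≤ penDisc f n M) :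
    ‖f - penRoot f n M • n‖ ^ 2 = M * (2 * penRoot f n M - penRoot f n M ^ 2) := by
  have hlead : 0 < inner ℝ n n + M := add_pos_of_nonneg_of_pos real_inner_self_nonneg hM
  have hsqrt : √(penDisc f n M) = M + inner ℝ f n - (inner ℝ n n + M) * penRoot f n M := by
    rw [penRoot]
    field_simp
    ring
  have hsq := Real.mul_self_sqrt hD
  rw [hsqrt, penDisc] at hsq
  have hquad := mul_left_cancel₀ hlead.ne' (show (inner ℝ n n + M) *
    ((inner ℝ n n + M) * penRoot f n M ^ 2 - 2 * (M + inner ℝ f n) * penRoot f n M + inner ℝ f f)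
      = (inner ℝ n n + M) * 0 by linear_combination hsq)
  rw [norm_sub_smul_sq_eq_inner]
  linear_combination hquad

theorem IsPenRoot.penDisc_eq {f n : H} {M d γ : ℝ} (h : IsPenRoot f n M d γ) :
    penDisc f n M = (M * (1 - γ) + inner ℝ (f - γ • n) n) ^ 2 := by
  have hroot := h.norm_sub_smul_sq
  rw [norm_sub_smul_sq_eq_inner] at hroot
  rw [penDisc, inner_sub_left, real_inner_smul_left]
  linear_combination (-(inner ℝ n n + M)) * hroot

theorem IsPenRoot.penRoot_eq {f n : H} {M d γ : ℝ} (h : IsPenRoot f n M d γ) (hM : 0 < M)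
    (hd : 0 ≤ d) : penRoot f n M = γ := by
  have hlead : 0 < inner ℝ n n + M := add_pos_of_nonneg_of_pos real_inner_self_nonneg hM
  rw [penRoot, h.penDisc_eq, Real.sqrt_sq (hd.trans h.le_slope), inner_sub_left,
    real_inner_smul_left, ← div_eq_mul_inv, div_eq_iff hlead.ne']
  ring

variable {E : Type*} [PseudoMetricSpace E] {S : Set E} {f n : E → H} {M : E → ℝ}

theorem BoundedLipschitzOn.penDisc (hf : BoundedLipschitzOn f S) (hn : BoundedLipschitzOn n S)
    (hM : BoundedLipschitzOn M S) :
    BoundedLipschitzOn (fun x => penDisc (f x) (n x) (M x)) S :=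
  ((hM.add (hf.inner hn)).mul (hM.add (hf.inner hn))).sub
    (((hn.inner hn).add hM).mul (hf.inner hf))

theorem BoundedLipschitzOn.penRoot (hf : BoundedLipschitzOn f S) (hn : BoundedLipschitzOn n S)
    (hM : BoundedLipschitzOn M S) {m d : ℝ} (hm : 0 < m) (hmM : ∀ x ∈ S, m ≤ M x) (hd : 0 < d)
    (hD : ∀ x ∈ S, d ≤ Progenitor.penDisc (f x) (n x) (M x)) :
    BoundedLipschitzOn (fun x => penRoot (f x) (n x) (M x)) S :=
  ((hM.add (hf.inner hn)).sub ((hf.penDisc hn hM).sqrt hd hD)).mul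
    (((hn.inner hn).add hM).inv hm fun x hx =>
      (hmM x hx).trans (le_add_of_nonneg_left real_inner_self_nonneg))

theorem exists_penRoot_stable (hf : BoundedLipschitzOn f S) (hn : BoundedLipschitzOn n S)
    (hM : BoundedLipschitzOn M S) {m d δ : ℝ} (hm : 0 < m) (hmM : ∀ x ∈ S, m ≤ M x) (hd : 0 < d)
    (hδ : 0 < δ) :
    ∃ r > 0, ∀ x₀ ∈ S, ∀ γ₀, IsPenRoot (f x₀) (n x₀) (M x₀) d γ₀ → √δ ≤ 1 - γ₀ →
      ∀ x ∈ S, dist x x₀ ≤ r → d ^ 2 / 2 ≤ penDisc (f x) (n x) (M x) ∧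
        penRoot (f x) (n x) (M x) ≤ 1 ∧
        |(2 * penRoot (f x) (n x) (M x) - penRoot (f x) (n x) (M x) ^ 2) - (2 * γ₀ - γ₀ ^ 2)|
          ≤ δ / 2 := by
  set D : E → ℝ := fun x => penDisc (f x) (n x) (M x)
  set γ : E → ℝ := fun x => penRoot (f x) (n x) (M x)
  set S' : Set E := {x ∈ S | d ^ 2 / 2 ≤ D x}
  have hS' : S' ⊆ S := Set.sep_subset _ _
  have hγ : BoundedLipschitzOn γ S' := (hf.mono hS').penRoot (hn.mono hS') (hM.mono hS') hm
    (fun x hx => hmM x (hS' hx)) (by positivity : 0 < d ^ 2 / 2) fun x hx => hx.2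
  have hlevel : BoundedLipschitzOn (fun x => 2 * γ x - γ x * γ x) S' :=
    ((BoundedLipschitzOn.const 2).mul hγ).sub (hγ.mul hγ)
  obtain ⟨r₁, hr₁, hD⟩ := (hf.penDisc hn hM).exists_dist_le (by positivity : 0 < d ^ 2 / 2)
  obtain ⟨r₂, hr₂, hγr⟩ := hγ.exists_dist_le (Real.sqrt_pos.2 hδ)
  obtain ⟨r₃, hr₃, hlevelr⟩ := hlevel.exists_dist_le (half_pos hδ)
  refine ⟨min r₁ (min r₂ r₃), by positivity, fun x₀ hx₀ γ₀ hγ₀ hδγ₀ x hx hxx₀ => ?_⟩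
  have hγx₀ : γ x₀ = γ₀ := hγ₀.penRoot_eq (hm.trans_le (hmM x₀ hx₀)) hd.le
  have hDx₀ : d ^ 2 ≤ D x₀ := by
    simp only [D, hγ₀.penDisc_eq]
    gcongr
    exact hγ₀.le_slope
  have hDx : d ^ 2 / 2 ≤ D x := by
    have := (abs_le.1 (hD x hx x₀ hx₀ (hxx₀.trans (min_le_left _ _)))).1
    linarith
  have hx' : x ∈ S' := ⟨hx, hDx⟩
  have hx₀' : x₀ ∈ S' := ⟨hx₀, by linarith [sq_nonneg d]⟩
  have hγx := hγr x hx' x₀ hx₀' (hxx₀.trans ((min_le_right _ _).trans (min_le_left _ _)))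
  have hlevelx := hlevelr x hx' x₀ hx₀' (hxx₀.trans ((min_le_right _ _).trans (min_le_right _ _)))
  rw [hγx₀, Real.dist_eq] at hγx
  rw [hγx₀, Real.dist_eq, ← sq, ← sq] at hlevelx
  exact ⟨hDx, by linarith [(abs_le.1 hγx).2], hlevelx⟩

end Root

/-! ### Second order equations with an implicit penalization -/

section ImplicitEvolution

open Metric Set

variable {X H Q : Type*} [NormedAddCommGroup X] [NormedSpace ℝ X] [NormedAddCommGroup H]
  [InnerProductSpace ℝ H]

/-- `(z, v, γ)` solves `z' = v`, `v' = F - γ N` on `[0, τ]`, where `γ` is determined implicitly by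
`‖Λ v'‖² = M (2γ - γ²)`. The coefficients `F`, `N`, `M` depend on `z` and on a path `θ` of
parameters. -/
structure IsImplicitSolution (Λ : X →L[ℝ] H) (F N : X × Q → X) (M : X × Q → ℝ) (θ : ℝ → Q) (τ : ℝ)
    (z v : ℝ → X) (γ : ℝ → ℝ) : Prop where
  hasDerivWithinAt_fst : ∀ t ∈ Icc 0 τ, HasDerivWithinAt z (v t) (Icc 0 τ) t
  hasDerivWithinAt_snd : ∀ t ∈ Icc 0 τ,
    HasDerivWithinAt v (F (z t, θ t) - γ t • N (z t, θ t)) (Icc 0 τ) t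
  continuousOn : ContinuousOn (fun t => F (z t, θ t) - γ t • N (z t, θ t)) (Icc 0 τ)
  norm_sq_eq : ∀ t ∈ Icc 0 τ,
    ‖Λ (F (z t, θ t) - γ t • N (z t, θ t))‖ ^ 2 = M (z t, θ t) * (2 * γ t - γ t ^ 2)

theorem exists_uniform_implicitSolution [CompleteSpace X] [PseudoMetricSpace Q] (Λ : X →L[ℝ] H)
    {F N : X × Q → X} {M : X × Q → ℝ} {S : Set (X × Q)} (hF : BoundedLipschitzOn F S)
    (hN : BoundedLipschitzOn N S) (hM : BoundedLipschitzOn M S) {ρ δ d m η : ℝ} {R c : NNReal}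
    (hm : 0 < m) (hmM : ∀ x ∈ S, m ≤ M x) (hρ : 0 < ρ) (hδ : 0 < δ) (hd : 0 < d) (hη : 0 < η) :
    ∃ τ > 0, ∀ z₀ v₀ (θ : ℝ → Q) γ₀, ‖v₀‖ ≤ R → LipschitzWith c θ →
      (∀ t y, dist (y, θ t) (z₀, θ 0) ≤ ρ → (y, θ t) ∈ S) → √δ ≤ 1 - γ₀ →
      IsPenRoot (Λ (F (z₀, θ 0))) (Λ (N (z₀, θ 0))) (M (z₀, θ 0)) d γ₀ →
      ∃ z v γ, z 0 = z₀ ∧ v 0 = v₀ ∧ γ 0 = γ₀ ∧ IsImplicitSolution Λ F N M θ τ z v γ ∧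
        ∀ t ∈ Icc 0 τ, ‖Λ (z t - z₀)‖ ≤ η ∧ ‖Λ (v t - v₀)‖ ≤ η ∧ γ t ≤ 1 ∧
          |(2 * γ t - γ t ^ 2) - (2 * γ₀ - γ₀ ^ 2)| ≤ δ / 2 := by
  have hΛF := hF.clm Λ
  have hΛN := hN.clm Λ
  let γ : X × Q → ℝ := fun x => penRoot (Λ (F x)) (Λ (N x)) (M x)
  let S' : Set (X × Q) := {x ∈ S | d ^ 2 / 2 ≤ penDisc (Λ (F x)) (Λ (N x)) (M x)}
  have hS' : S' ⊆ S := sep_subset _ _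
  have hγ : BoundedLipschitzOn γ S' := (hΛF.mono hS').penRoot (hΛN.mono hS') (hM.mono hS') hm
    (fun x hx => hmM x hx.1) (by positivity : 0 < d ^ 2 / 2) fun x hx => hx.2
  obtain ⟨r₀, hr₀, hstable⟩ := exists_penRoot_stable hΛF hΛN hM hm hmM hd hδ
  obtain ⟨r₁, hr₁, hΛr⟩ := uniformContinuous_iff_le.1 Λ.uniformContinuous η hη
  let r := min (min r₀ ρ) r₁
  have hr : 0 < r := by positivity
  have hΛball : ∀ y y₀ : X, dist y y₀ ≤ r → ‖Λ (y - y₀)‖ ≤ η := fun y y₀ hy => by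
    rw [map_sub, ← dist_eq_norm]
    exact hΛr (hy.trans (min_le_right _ _))
  obtain ⟨τ, hτ, hsol⟩ := exists_uniform_second_order (R := R) (c := c)
    ((hF.mono hS').sub (hγ.smul (hN.mono hS'))) hr
  refine ⟨τ, hτ, fun z₀ v₀ θ γ₀ hv₀ hθ hS hδγ₀ hγ₀ => ?_⟩
  have hx₀ : (z₀, θ 0) ∈ S := hS 0 z₀ (by simp [hρ.le])
  have hrρ : r ≤ ρ := (min_le_left _ _).trans (min_le_right _ _)
  have hrr₀ : r ≤ r₀ := (min_le_left _ _).trans (min_le_left _ _)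
  have hnear : ∀ t y, dist (y, θ t) (z₀, θ 0) ≤ r → _ := fun t y hy =>
    hstable _ hx₀ γ₀ hγ₀ hδγ₀ _ (hS t y (hy.trans hrρ)) (hy.trans hrr₀)
  obtain ⟨z, v, hz₀, hv₀, hcont, hzv⟩ := hsol z₀ v₀ θ hv₀ hθ fun t y hy =>
    ⟨hS t y (hy.trans hrρ), (hnear t y hy).1⟩
  refine ⟨z, v, fun t => γ (z t, θ t), hz₀, hv₀, ?_, ⟨fun t ht => (hzv t ht).2.2.1,
    fun t ht => (hzv t ht).2.2.2, hcont, fun t ht => ?_⟩, fun t ht => ?_⟩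
  · simp only [hz₀]
    exact hγ₀.penRoot_eq (hm.trans_le (hmM _ hx₀)) hd.le
  · have hball := (hzv t ht).1
    rw [map_sub, map_smul]
    exact norm_sub_penRoot_smul_sq (hm.trans_le (hmM _ (hS t _ (hball.trans hrρ))))
      ((by positivity : 0 ≤ d ^ 2 / 2).trans (hnear t _ hball).1)
  · obtain ⟨hball, hvball, -⟩ := hzv t ht
    exact ⟨hΛball _ _ ((le_max_left _ _).trans hball), hΛball _ _ hvball, (hnear t _ hball).2⟩

end ImplicitEvolution

/-! ### The progenitor equation as an evolution equation -/

section Pen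

variable {l γ : ℝ}

theorem pen_two_mul_sub_sq (h : γ ≤ 1) : pen (2 * γ - γ ^ 2) = γ := by
  rw [pen, show 1 - (2 * γ - γ ^ 2) = (1 - γ) ^ 2 by ring, Real.sqrt_sq (by linarith)]
  ring

theorem two_mul_pen_sub_sq (h : l ≤ 1) : 2 * pen l - pen l ^ 2 = l := by
  rw [pen]
  linear_combination -Real.sq_sqrt (sub_nonneg.2 h)

theorem one_sub_pen (l : ℝ) : 1 - pen l = √(1 - l) := sub_sub_cancel _ _

theorem deriv_pen (h : l < 1) : deriv pen l = 1 / (2 * √(1 - l)) := by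
  have hpen : HasDerivAt pen (-(-1 / (2 * √(1 - l)))) l :=
    (((hasDerivAt_id' l).const_sub 1).sqrt (sub_pos.2 h).ne').const_sub 1
  rw [hpen.deriv, neg_div, neg_neg]

theorem le_one_sub_pen {e C : ℝ} (hl : l < 1) (he : 0 < e) (hC : 0 < C)
    (h : deriv pen l ≤ 16 / (C * e)) : C / 32 * e ≤ 1 - pen l := by
  have hsqrt : 0 < √(1 - l) := Real.sqrt_pos.2 (sub_pos.2 hl)
  rw [deriv_pen hl, div_le_div_iff₀ (by positivity) (by positivity)] at h
  rw [one_sub_pen]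
  linarith

end Pen

section Terms

variable {q : ℕ} {s p k ε ν T t K : ℝ} {f g z w A₀ : L2}

theorem freq_pos (p : ℝ) (hk : 0 < k) : 0 < freq p k := Real.rpow_pos_of_pos hk _

/-- The part `-|D|ᵖ z - C_k ε² 𝓑ₖ(z |z/ε|^(q-1))` of `z_tt` which does not involve the
penalization. -/
def force (q : ℕ) (p k ε : ℝ) (z : L2) : L2 := -absD p z - semilinear q p k ε z

theorem isBandLimited_semilinear : IsBandLimited k (semilinear q p k ε z) :=
  (isBandLimited_band k _).smul _

theorem isBandLimited_penal : IsBandLimited k (penal q p k ε T t z) :=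
  (isBandLimited_band k _).smul _

theorem IsBandLimited.isBandLimited_absD (hp : 0 < p) (hz : IsBandLimited k z) :
    IsBandLimited k (absD p z) :=
  hz.absD_eq hp ▸ isBandLimited_bandOp k _ z

theorem IsBandLimited.isBandLimited_force (hp : 0 < p) (hz : IsBandLimited k z) :
    IsBandLimited k (force q p k ε z) :=
  (hz.isBandLimited_absD hp).neg.sub isBandLimited_semilinear

theorem IsBandLimited.real_smul (hf : IsBandLimited k f) (r : ℝ) : IsBandLimited k (r • f) := by
  rw [RCLike.real_smul_eq_coe_smul (K := ℂ)]
  exact hf.smul _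

theorem IsBandLimited.Lam_sub (hf : IsBandLimited k f) (hg : IsBandLimited k g) :
    Lam s k ε (f - g) = Lam s k ε f - Lam s k ε g := by
  rw [(hf.sub hg).Lam_eq, map_sub, ← hf.Lam_eq, ← hg.Lam_eq]

theorem IsBandLimited.Lam_real_smul (hf : IsBandLimited k f) (r : ℝ) :
    Lam s k ε (r • f) = r • Lam s k ε f := by
  rw [(hf.real_smul r).Lam_eq, RCLike.real_smul_eq_coe_smul (K := ℂ), map_smul, ← hf.Lam_eq,
    ← RCLike.real_smul_eq_coe_smul]

theorem IsBandLimited.norm_Lam_penal_le (hz : IsBandLimited k z) (hK : TameBound q s k ε K)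
    (hε : 0 < ε) (hT : 0 ≤ ε ^ 7 * t + ε ^ 5 * T) :
    ‖Lam s k ε (penal q p k ε T t z)‖ ≤ freq p k ^ 2 *
      (ε ^ (q + 4) + 2 * (ε ^ 7 * t + ε ^ 5 * T) * (K * supNorm z ^ (q - 1))) * ‖Lam s k ε z‖ := by
  have htame := hK z hz
  rw [(isBandLimited_band k _).Lam_eq, bandOp_band] at htame
  rw [isBandLimited_penal.Lam_eq, penal, map_smul, bandOp_band, map_add, map_smul, map_smul,
    ← hz.Lam_eq, norm_smul, Complex.norm_real, Real.norm_of_nonneg (by positivity),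
    mul_assoc (freq p k ^ 2)]
  gcongr
  refine (norm_add_le _ _).trans ?_
  rw [norm_smul, norm_smul, norm_mul, norm_mul, Complex.norm_I, Complex.norm_real,
    Complex.norm_real, Real.norm_of_nonneg hT, Real.norm_of_nonneg (by positivity),
    Complex.norm_ofNat, mul_one, add_mul, mul_assoc (2 * (ε ^ 7 * t + ε ^ 5 * T))]
  gcongr

theorem powCoeff_nonneg (p : ℝ) (hk : 0 < k) : 0 ≤ powCoeff p k :=
  Real.rpow_nonneg (freq_pos p hk).le _

theorem IsBandLimited.norm_Lam_semilinear_le (hz : IsBandLimited k z) (hK : TameBound q s k ε K)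
    (hk : 0 < k) (hε : 0 < ε) :
    ‖Lam s k ε (semilinear q p k ε z)‖ ≤
      powCoeff p k * ε ^ 2 * ((supNorm z / ε) ^ (q - 1) * (K * ‖Lam s k ε z‖)) := by
  have hpc := powCoeff_nonneg p hk
  obtain ⟨C, -, hC⟩ := exists_ae_norm_le_mul_norm k
  have htame := hK z hz
  rw [(isBandLimited_band k _).Lam_eq, bandOp_band] at htame
  rw [isBandLimited_semilinear.Lam_eq, semilinear, map_smul, bandOp_band,
    powTerm_eq_smul q hε (hC z hz), map_smul, norm_smul, norm_smul, Complex.norm_real,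
    Complex.norm_real, Real.norm_of_nonneg (by positivity), Real.norm_of_nonneg (by positivity)]
  refine mul_le_mul_of_nonneg_left ?_ (by positivity)
  calc ε⁻¹ ^ (q - 1) * ‖bandOp k (besselC s k ε) (powTerm q 1 z)‖
      ≤ ε⁻¹ ^ (q - 1) * (K * supNorm z ^ (q - 1) * ‖Lam s k ε z‖) := by gcongr
    _ = (supNorm z / ε) ^ (q - 1) * (K * ‖Lam s k ε z‖) := by rw [div_pow, inv_pow]; ring

end Terms

section LipschitzTerms

variable {E : Type*} [PseudoMetricSpace E] {S : Set E} {f : E → L2}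

namespace BoundedLipschitzOn

theorem complexClm (hf : BoundedLipschitzOn f S) (A : L2 →L[ℂ] L2) :
    BoundedLipschitzOn (fun x => A (f x)) S :=
  hf.clm (A.restrictScalars ℝ)

theorem band (hf : BoundedLipschitzOn f S) (k : ℝ) :
    BoundedLipschitzOn (fun x => Progenitor.band k (f x)) S := by
  simp_rw [band_eq_bandOp_one]
  exact hf.complexClm _

theorem complexSMul (hf : BoundedLipschitzOn f S) (c : ℂ) :
    BoundedLipschitzOn (fun x => c • f x) S :=
  hf.complexClm (c • ContinuousLinearMap.id ℂ L2)

theorem absD_band (hf : BoundedLipschitzOn f S) {p : ℝ} (hp : 0 < p) (k : ℝ) :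
    BoundedLipschitzOn (fun x => absD p (Progenitor.band k (f x))) S := by
  simp_rw [(isBandLimited_band k _).absD_eq hp]
  exact (hf.band k).complexClm _

theorem powTerm_band (hf : BoundedLipschitzOn f S) (q : ℕ) (k : ℝ) {r : ℝ} (hr : 0 < r) :
    BoundedLipschitzOn (fun x => powTerm q r (Progenitor.band k (f x))) S := by
  obtain ⟨⟨C, hC, hfC⟩, L, hL⟩ := hf.band k
  obtain ⟨D, hD, hbound⟩ := exists_ae_norm_le_mul_norm k
  have hsup : ∀ x ∈ S, ∀ᵐ y, ‖Progenitor.band k (f x) y‖ ≤ D * C := fun x hx =>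
    (hbound _ (isBandLimited_band k (f x))).mono fun y hy =>
      hy.trans (mul_le_mul_of_nonneg_left (hfC x hx) hD)
  refine of_le (C := (D * C / r) ^ (q - 1) * C)
    (K := ((q - 1 : ℕ) + 1) * (D * C / r) ^ (q - 1) * L) (fun x hx => ?_) fun x hx y hy => ?_
  · exact (norm_powTerm_le q hr (hsup x hx)).trans (by gcongr; exact hfC x hx)
  · have hLxy := hL.dist_le_mul x hx y hy
    rw [dist_eq_norm] at hLxy
    rw [dist_eq_norm, mul_assoc _ (L : ℝ)]
    exact (norm_powTerm_sub_le q hr (hsup x hx) (hsup y hy)).trans (by gcongr)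

theorem force_band (hf : BoundedLipschitzOn f S) (q : ℕ) {p ε : ℝ} (hp : 0 < p) (k : ℝ)
    (hε : 0 < ε) : BoundedLipschitzOn (fun x => force q p k ε (Progenitor.band k (f x))) S :=
  (hf.absD_band hp k).neg.sub (((hf.powTerm_band q k hε).band k).complexSMul _)

theorem penal_band (hf : BoundedLipschitzOn f S) {T t : E → ℝ} (hT : BoundedLipschitzOn T S)
    (ht : BoundedLipschitzOn t S) (q : ℕ) (p k ε : ℝ) :
    BoundedLipschitzOn (fun x => penal q p k ε (T x) (t x) (Progenitor.band k (f x))) S := by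
  have hcoef := ((const (ε ^ 7)).mul ht).add ((const (ε ^ 5)).mul hT)
  have hpow := hcoef.smul ((hf.powTerm_band q k one_pos).complexSMul (2 * Complex.I))
  convert ((((hf.band k).complexSMul ((ε ^ (q + 4) : ℝ) : ℂ)).add hpow).band k).complexSMul
    ((freq p k ^ 2 : ℝ) : ℂ) using 2
  rw [penal, RCLike.real_smul_eq_coe_smul (K := ℂ), smul_smul, mul_comm (2 * Complex.I)]
  rfl

end BoundedLipschitzOn

end LipschitzTerms

section Pointwise

variable {q : ℕ} {s p k ε ν T t τ γ : ℝ} {f g z w A₀ : L2}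

theorem IsBandLimited.equationAt (hp : 0 < p) (hz : IsBandLimited k z)
    (hw : w = force q p k ε z - γ • penal q p k ε T t z)
    (hγ : pen (controlNorm s p k ε ν A₀ w) = γ) : EquationAt q s p k ε ν T A₀ t z w := by
  intro x
  have hD := hz.isBandLimited_absD hp
  have hS : IsBandLimited k (semilinear q p k ε z) := isBandLimited_semilinear
  have hN : IsBandLimited k ((γ : ℂ) • penal q p k ε T t z) := isBandLimited_penal.smul _
  rw [RCLike.real_smul_eq_coe_smul (K := ℂ)] at hw
  have hwb : IsBandLimited k w := hw ▸ (hz.isBandLimited_force hp).sub hN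
  have hsum : w + absD p z + semilinear q p k ε z + (γ : ℂ) • penal q p k ε T t z
      = (0 : ℂ) • w := by
    rw [zero_smul, hw, force, RCLike.ofReal_eq_complex_ofReal]
    abel
  rw [hγ, ← pointValue_smul, ← pointValue_add hwb.integrable_fourier hD.integrable_fourier,
    ← pointValue_add (hwb.add hD).integrable_fourier hS.integrable_fourier,
    ← pointValue_add ((hwb.add hD).add hS).integrable_fourier hN.integrable_fourier, hsum,
    pointValue_smul, zero_mul]

theorem IsBandLimited.pointValue_sub (hf : IsBandLimited k f) (hg : IsBandLimited k g)
    (x : Plane) : pointValue (f - g) x = pointValue f x - pointValue g x := by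
  rw [eq_sub_iff_add_eq, ← pointValue_add (hf.sub hg).integrable_fourier hg.integrable_fourier,
    sub_add_cancel]

theorem continuous_pointValue_uncurry {α : Type*} [TopologicalSpace α] {G : α → L2}
    (hG : Continuous G) (hband : ∀ t, IsBandLimited k (G t)) :
    Continuous fun y : α × Plane => pointValue (G y.1) y.2 := by
  obtain ⟨C, -, hC⟩ := exists_norm_pointValue_le k
  rw [continuous_iff_continuousAt]
  rintro ⟨t₀, x₀⟩
  have hcont : Continuous fun y : α × Plane =>
      C * ‖G y.1 - G t₀‖ + ‖pointValue (G t₀) y.2 - pointValue (G t₀) x₀‖ := by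
    have := continuous_pointValue (hband t₀).integrable_fourier
    fun_prop
  have hlim := hcont.tendsto (t₀, x₀)
  simp only [sub_self, norm_zero, mul_zero, add_zero] at hlim
  refine tendsto_iff_norm_sub_tendsto_zero.2
    (squeeze_zero (fun _ => norm_nonneg _) (fun y => ?_) hlim)
  have hsub := hC _ ((hband y.1).sub (hband t₀)) y.2
  rw [(hband y.1).pointValue_sub (hband t₀)] at hsub
  calc ‖pointValue (G y.1) y.2 - pointValue (G t₀) x₀‖
      ≤ ‖pointValue (G y.1) y.2 - pointValue (G t₀) y.2‖
        + ‖pointValue (G t₀) y.2 - pointValue (G t₀) x₀‖ := norm_sub_le_norm_sub_add_norm_sub _ _ _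
    _ ≤ C * ‖G y.1 - G t₀‖ + ‖pointValue (G t₀) y.2 - pointValue (G t₀) x₀‖ := by gcongr

theorem isSolution_of_continuousOn {z zt ztt : ℝ → L2} (hτ : 0 ≤ τ)
    (hcont : ContinuousOn ztt (Set.Icc 0 τ)) (hband : ∀ t ∈ Set.Icc 0 τ, IsBandLimited k (ztt t))
    (hz : ∀ t ∈ Set.Icc 0 τ, HasDerivWithinAt z (zt t) (Set.Icc 0 τ) t)
    (hzt : ∀ t ∈ Set.Icc 0 τ, HasDerivWithinAt zt (ztt t) (Set.Icc 0 τ) t)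
    (heq : ∀ t ∈ Set.Icc 0 τ, EquationAt q s p k ε ν T A₀ t (z t) (ztt t)) :
    IsSolution q s p k ε ν T A₀ τ z zt ztt := by
  have hLam : ContinuousOn (fun t => Lam s k ε (ztt t)) (Set.Icc 0 τ) :=
    ((bandOp k (besselC s k ε)).continuous.comp_continuousOn hcont).congr
      fun t ht => (hband t ht).Lam_eq
  have hbandLam : ∀ t ∈ Set.Icc 0 τ, IsBandLimited k (Lam s k ε (ztt t)) :=
    fun t ht => (hband t ht).isBandLimited_Lam
  obtain ⟨B, hB⟩ := isCompact_Icc.exists_bound_of_continuousOn hLam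
  obtain ⟨C, hC0, hC⟩ := exists_norm_pointValue_le k
  exact
    { hasDeriv := hz
      integrable := ContinuousOn.intervalIntegrable (by rwa [Set.uIcc_of_le hτ])
      eq_integral := fun t ht => by
        have hsub : Set.Icc 0 t ⊆ Set.Icc 0 τ := Set.Icc_subset_Icc_right ht.2
        rw [intervalIntegral.integral_eq_sub_of_hasDerivAt_of_le ht.1
          (fun u hu => (hzt u (hsub hu)).continuousWithinAt.mono hsub)
          (fun u hu => (hzt u (hsub (Set.Ioo_subset_Icc_self hu))).hasDerivAt
            (Icc_mem_nhds hu.1 (hu.2.trans_le ht.2)))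
          (ContinuousOn.intervalIntegrable (by rw [Set.uIcc_of_le ht.1]; exact hcont.mono hsub)),
          add_sub_cancel]
      measurable_ztt := (continuous_pointValue_uncurry (continuousOn_iff_continuous_domRestrict.1
        hLam) fun t => hbandLam t t.2).measurable
      bounded_ztt := ⟨C * B, fun t ht x =>
        (hC _ (hbandLam t ht) x).trans (by gcongr; exact hB t ht)⟩
      memLp_ztt := memLp_top_of_bound (hLam.aestronglyMeasurable measurableSet_Icc) B
        (ae_restrict_of_forall_mem measurableSet_Icc hB)
      equation := ae_restrict_of_forall_mem measurableSet_Icc heq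
      equation_end := heq τ (Set.right_mem_Icc.2 hτ) }

end Pointwise

/-! ### Local existence for the progenitor equation -/

section Motion

variable {q : ℕ} {s p k ε ν T M τ t : ℝ} {A₀ : L2} {z v : ℝ → L2} {γ : ℝ → ℝ}

/-- The value of `z_tt` given by the progenitor equation when `g(λ(z_tt)) = γ`. -/
def acceleration (q : ℕ) (p k ε T t γ : ℝ) (z : L2) : L2 :=
  force q p k ε z - γ • penal q p k ε T t z

theorem IsBandLimited.isBandLimited_acceleration (hp : 0 < p) {γ : ℝ} {z : L2}
    (hz : IsBandLimited k z) : IsBandLimited k (acceleration q p k ε T t γ z) :=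
  (hz.isBandLimited_force hp).sub (isBandLimited_penal.real_smul γ)

theorem IsBandLimited.Lam_acceleration (hp : 0 < p) {γ : ℝ} {z : L2} (hz : IsBandLimited k z) :
    Lam s k ε (acceleration q p k ε T t γ z) =
      Lam s k ε (force q p k ε z) - γ • Lam s k ε (penal q p k ε T t z) := by
  rw [acceleration, (hz.isBandLimited_force hp).Lam_sub (isBandLimited_penal.real_smul γ),
    isBandLimited_penal.Lam_real_smul]

/-- A band-limited motion `z` on `[0, τ]` with velocity `v` and penalization factor `γ`, which is
determined by `‖Λˢ_ε z_tt‖² = M (2γ - γ²)`. For `M = ν² ω⁴ ‖A₀‖²_{Hˢ}` this says that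
`γ = g(λ(z_tt))`, see `IsPenalizedMotion.isSolution`. -/
structure IsPenalizedMotion (q : ℕ) (s p k ε T M τ : ℝ) (z v : ℝ → L2) (γ : ℝ → ℝ) : Prop where
  isBandLimited_fst : ∀ t ∈ Set.Icc 0 τ, IsBandLimited k (z t)
  isBandLimited_snd : ∀ t ∈ Set.Icc 0 τ, IsBandLimited k (v t)
  hasDerivWithinAt_fst : ∀ t ∈ Set.Icc 0 τ, HasDerivWithinAt z (v t) (Set.Icc 0 τ) t
  hasDerivWithinAt_snd : ∀ t ∈ Set.Icc 0 τ,
    HasDerivWithinAt v (acceleration q p k ε T t (γ t) (z t)) (Set.Icc 0 τ) t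
  continuousOn : ContinuousOn (fun t => acceleration q p k ε T t (γ t) (z t)) (Set.Icc 0 τ)
  norm_sq_eq : ∀ t ∈ Set.Icc 0 τ,
    ‖Lam s k ε (acceleration q p k ε T t (γ t) (z t))‖ ^ 2 = M * (2 * γ t - γ t ^ 2)
  le_one : ∀ t ∈ Set.Icc 0 τ, γ t ≤ 1

theorem IsBandLimited.of_hasDerivWithinAt {y y' : ℝ → L2} (h₀ : IsBandLimited k (y 0))
    (hy : ∀ t ∈ Set.Icc 0 τ, HasDerivWithinAt y (y' t) (Set.Icc 0 τ) t)
    (hband : ∀ t ∈ Set.Icc 0 τ, IsBandLimited k (y' t)) :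
    ∀ t ∈ Set.Icc 0 τ, IsBandLimited k (y t) := fun t ht => by
  let A : L2 →L[ℝ] L2 := (ContinuousLinearMap.id ℂ L2 - bandOp k 1).restrictScalars ℝ
  have hA : ∀ f, A f = 0 ↔ IsBandLimited k f := fun f => by
    rw [IsBandLimited, band_eq_bandOp_one]
    exact sub_eq_zero
  rw [← hA, map_eq_of_map_deriv_eq_zero A hy (fun t ht => (hA _).2 (hband t ht)) t ht, hA]
  exact h₀

theorem IsImplicitSolution.isPenalizedMotion (hp : 0 < p) (hz₀ : IsBandLimited k (z 0))
    (hv₀ : IsBandLimited k (v 0)) (hγ : ∀ t ∈ Set.Icc 0 τ, γ t ≤ 1)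
    (h : IsImplicitSolution ((bandOp k (besselC s k ε)).restrictScalars ℝ)
      (fun x : L2 × ℝ × ℝ × ℝ => force q p k ε (band k x.1))
      (fun x => penal q p k ε x.2.1 x.2.2.1 (band k x.1)) (fun x => x.2.2.2)
      (fun t => (T, t, M)) τ z v γ) : IsPenalizedMotion q s p k ε T M τ z v γ := by
  have hw : ∀ t z, IsBandLimited k (acceleration q p k ε T t (γ t) (band k z)) :=
    fun t z => (isBandLimited_band k z).isBandLimited_acceleration hp
  have hv := hv₀.of_hasDerivWithinAt h.hasDerivWithinAt_snd fun t _ => hw t (z t)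
  have hz := hz₀.of_hasDerivWithinAt h.hasDerivWithinAt_fst hv
  have hband : ∀ t ∈ Set.Icc 0 τ, acceleration q p k ε T t (γ t) (band k (z t))
      = acceleration q p k ε T t (γ t) (z t) := fun t ht => by rw [← hz t ht]
  refine ⟨hz, hv, h.hasDerivWithinAt_fst, fun t ht => ?_, ?_, fun t ht => ?_, hγ⟩
  · rw [← hband t ht]
    exact h.hasDerivWithinAt_snd t ht
  · exact h.continuousOn.congr fun t ht => (hband t ht).symm
  · rw [← hband t ht, (hw t _).Lam_eq]
    exact h.norm_sq_eq t ht

theorem exists_isPenalizedMotion (q : ℕ) (s k : ℝ) (hp : 0 < p) (hε : 0 < ε) {δ d m η : ℝ}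
    (R : NNReal) (hδ : 0 < δ) (hd : 0 < d) (hm : 0 < m) (hη : 0 < η) :
    ∃ τ > 0, ∀ (T M : ℝ) z₀ v₀ γ₀, IsBandLimited k z₀ → IsBandLimited k v₀ → ‖z₀‖ ≤ R →
      ‖v₀‖ ≤ R → |T| ≤ R → m ≤ M → |M| ≤ R → √δ ≤ 1 - γ₀ →
      IsPenRoot (Lam s k ε (force q p k ε z₀)) (Lam s k ε (penal q p k ε T 0 z₀)) M d γ₀ →
      ∃ z v γ, z 0 = z₀ ∧ v 0 = v₀ ∧ γ 0 = γ₀ ∧ IsPenalizedMotion q s p k ε T M τ z v γ ∧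
        ∀ t ∈ Set.Icc 0 τ, ‖Lam s k ε (z t - z₀)‖ ≤ η ∧ ‖Lam s k ε (v t - v₀)‖ ≤ η ∧
          |(2 * γ t - γ t ^ 2) - (2 * γ₀ - γ₀ ^ 2)| ≤ δ / 2 := by
  let S : Set (L2 × ℝ × ℝ × ℝ) := {x | ‖x‖ ≤ R + 1 ∧ m ≤ x.2.2.2}
  have hid : BoundedLipschitzOn (fun x => x) S :=
    .of_le (K := 1) (fun x hx => hx.1) fun x _ y _ => (one_mul _).ge
  have hθ := hid.clm (ContinuousLinearMap.snd ℝ L2 (ℝ × ℝ × ℝ))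
  have htM := hθ.clm (ContinuousLinearMap.snd ℝ ℝ (ℝ × ℝ))
  have hz := hid.clm (ContinuousLinearMap.fst ℝ L2 (ℝ × ℝ × ℝ))
  obtain ⟨τ, hτ, hsol⟩ := exists_uniform_implicitSolution (R := R) (c := 1) (η := η)
    ((bandOp k (besselC s k ε)).restrictScalars ℝ) (hz.force_band q hp k hε)
    (hz.penal_band (hθ.clm (.fst ℝ ℝ (ℝ × ℝ))) (htM.clm (.fst ℝ ℝ ℝ)) q p k ε)
    (htM.clm (.snd ℝ ℝ ℝ)) hm (fun x hx => hx.2) one_pos hδ hd hη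
  refine ⟨τ, hτ, fun T M z₀ v₀ γ₀ hz₀ hv₀ hz₀R hv₀R hTR hmM hMR hγ₀ hroot => ?_⟩
  have hpath : LipschitzWith 1 fun t : ℝ => (T, t, M) :=
    ((LipschitzWith.const T).prodMk (LipschitzWith.id.prodMk (LipschitzWith.const M))).weaken
      (by simp)
  have hx₀ : ‖(z₀, T, (0 : ℝ), M)‖ ≤ R := by simp [hz₀R, hTR, hMR]
  have hmem : ∀ t y, dist (y, T, t, M) (z₀, T, 0, M) ≤ 1 → (y, T, t, M) ∈ S := fun t y hy => by
    rw [dist_eq_norm] at hy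
    exact ⟨by linarith [norm_le_norm_sub_add (y, T, t, M) (z₀, T, 0, M)], hmM⟩
  rw [(hz₀.isBandLimited_force hp).Lam_eq, isBandLimited_penal.Lam_eq, hz₀] at hroot
  obtain ⟨z, v, γ, hz0, hv0, hγ0, himp, hclose⟩ :=
    hsol z₀ v₀ (fun t => (T, t, M)) γ₀ hv₀R hpath hmem hγ₀ hroot
  have hmotion := himp.isPenalizedMotion hp (hz0 ▸ hz₀) (hv0 ▸ hv₀) fun t ht => (hclose t ht).2.2.1
  refine ⟨z, v, γ, hz0, hv0, hγ0, hmotion, fun t ht => ?_⟩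
  rw [((hmotion.isBandLimited_fst t ht).sub hz₀).Lam_eq,
    ((hmotion.isBandLimited_snd t ht).sub hv₀).Lam_eq]
  obtain ⟨hz, hv, -, hγ⟩ := hclose t ht
  exact ⟨hz, hv, hγ⟩

end Motion

section Existence

variable {q : ℕ} {s p k ε ν T τ : ℝ} {A₀ : L2} {z v w : ℝ → L2} {γ : ℝ → ℝ} {z₀ v₀ w₀ : L2}

/-- The denominator `ν² ω⁴ ‖A₀‖²_{Hˢ}` of the control functional `λ`. -/
def controlScale (s p k ν : ℝ) (A₀ : L2) : ℝ := ν ^ 2 * freq p k ^ 4 * sobNorm s A₀ ^ 2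

theorem controlScale_eq (s p k ν : ℝ) (A₀ : L2) :
    controlScale s p k ν A₀ = ν ^ 2 * (freq p k ^ 2 * sobNorm s A₀) ^ 2 := by
  rw [controlScale]
  ring

theorem controlScale_pos (hk : 0 < k) (hν : 0 < ν) (hA₀ : 0 < sobNorm s A₀) :
    0 < controlScale s p k ν A₀ := by
  have := freq_pos p hk
  unfold controlScale
  positivity

theorem sq_le_controlScale (hν : 1 ≤ ν) (hε : 0 ≤ ε) (h : ε ≤ sobNorm s A₀) :
    (freq p k ^ 2 * ε) ^ 2 ≤ controlScale s p k ν A₀ := by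
  rw [controlScale_eq]
  exact (by gcongr : (freq p k ^ 2 * ε) ^ 2 ≤ (freq p k ^ 2 * sobNorm s A₀) ^ 2).trans
    (le_mul_of_one_le_left (sq_nonneg _) (one_le_pow₀ hν))

theorem controlScale_le (hν : 0 ≤ ν) (hν2 : ν ≤ 2) {b : ℝ} (h : sobNorm s A₀ ≤ b) :
    controlScale s p k ν A₀ ≤ 2 ^ 2 * (freq p k ^ 2 * b) ^ 2 := by
  rw [controlScale_eq]
  have : 0 ≤ sobNorm s A₀ := norm_nonneg _
  gcongr

theorem controlNorm_eq_div (f : L2) :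
    controlNorm s p k ε ν A₀ f = ‖Lam s k ε f‖ ^ 2 / controlScale s p k ν A₀ := rfl

/-- A solution on `[0, τ]`, with first and second derivatives `v` and `w`, which satisfies the
assertions of the local existence theorem. -/
structure IsControlledSolution (q : ℕ) (s p k ε ν T : ℝ) (A₀ : L2) (τ : ℝ) (z v w : ℝ → L2) :
    Prop where
  isSolution : IsSolution q s p k ε ν T A₀ τ z v w
  isBandLimited : ∀ t ∈ Set.Icc 0 τ,
    IsBandLimited k (z t) ∧ IsBandLimited k (v t) ∧ IsBandLimited k (w t)
  continuousOn_Lam_fst : ContinuousOn (fun t => Lam s k ε (z t)) (Set.Icc 0 τ)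
  continuousOn_Lam_snd : ContinuousOn (fun t => Lam s k ε (v t)) (Set.Icc 0 τ)
  norm_Lam_le : ∀ t ∈ Set.Icc 0 τ, ‖Lam s k ε (z t)‖ ≤ 3 * sobNorm s A₀ ∧
    (freq p k)⁻¹ * ‖Lam s k ε (v t)‖ ≤ 3 * sobNorm s A₀
  abs_controlNorm_sub_le : ∀ t ∈ Set.Icc 0 τ,
    |controlNorm s p k ε ν A₀ (w t) - controlNorm s p k ε ν A₀ (w 0)|
      ≤ 1 / 2 * (1 - controlNorm s p k ε ν A₀ (w 0))

/-- The initial data `(z, z_t, z_tt)(0)` for which the equation is solved. -/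
structure IsAdmissibleData (q : ℕ) (s p k ε ν T : ℝ) (A₀ z₀ v₀ w₀ : L2) : Prop where
  isBandLimited_fst : IsBandLimited k z₀
  isBandLimited_snd : IsBandLimited k v₀
  norm_Lam_fst_le : ‖Lam s k ε z₀‖ ≤ 2 * sobNorm s A₀
  norm_Lam_snd_le : (freq p k)⁻¹ * ‖Lam s k ε v₀‖ ≤ 2 * sobNorm s A₀
  supNorm_le : supNorm z₀ ≤ 2 * ε * supNorm A₀
  compatible : Compatible q s p k ε ν T A₀ z₀ w₀

namespace IsPenalizedMotion

variable (h : IsPenalizedMotion q s p k ε T (controlScale s p k ν A₀) τ z v γ)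
  (hM : controlScale s p k ν A₀ ≠ 0)

include h

theorem continuousOn_Lam_fst : ContinuousOn (fun t => Lam s k ε (z t)) (Set.Icc 0 τ) :=
  ((bandOp k (besselC s k ε)).continuous.comp_continuousOn fun t ht =>
    (h.hasDerivWithinAt_fst t ht).continuousWithinAt).congr
      fun t ht => (h.isBandLimited_fst t ht).Lam_eq

theorem continuousOn_Lam_snd : ContinuousOn (fun t => Lam s k ε (v t)) (Set.Icc 0 τ) :=
  ((bandOp k (besselC s k ε)).continuous.comp_continuousOn fun t ht =>
    (h.hasDerivWithinAt_snd t ht).continuousWithinAt).congr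
      fun t ht => (h.isBandLimited_snd t ht).Lam_eq

include hM

theorem controlNorm_eq {t : ℝ} (ht : t ∈ Set.Icc 0 τ) :
    controlNorm s p k ε ν A₀ (acceleration q p k ε T t (γ t) (z t)) = 2 * γ t - γ t ^ 2 := by
  rw [controlNorm_eq_div, h.norm_sq_eq t ht, mul_div_cancel_left₀ _ hM]

theorem isSolution (hp : 0 < p) (hτ : 0 ≤ τ) :
    IsSolution q s p k ε ν T A₀ τ z v fun t => acceleration q p k ε T t (γ t) (z t) :=
  isSolution_of_continuousOn hτ h.continuousOn
    (fun t ht => (h.isBandLimited_fst t ht).isBandLimited_acceleration hp)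
    h.hasDerivWithinAt_fst h.hasDerivWithinAt_snd fun t ht =>
      (h.isBandLimited_fst t ht).equationAt hp rfl
        ((congrArg pen (h.controlNorm_eq hM ht)).trans (pen_two_mul_sub_sq (h.le_one t ht)))

theorem isControlledSolution (hp : 0 < p) (hk : 0 < k) (hτ : 0 ≤ τ)
    (hz₀ : ‖Lam s k ε (z 0)‖ ≤ 2 * sobNorm s A₀)
    (hv₀ : (freq p k)⁻¹ * ‖Lam s k ε (v 0)‖ ≤ 2 * sobNorm s A₀)
    (hz : ∀ t ∈ Set.Icc 0 τ, ‖Lam s k ε (z t - z 0)‖ ≤ sobNorm s A₀)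
    (hv : ∀ t ∈ Set.Icc 0 τ, ‖Lam s k ε (v t - v 0)‖ ≤ freq p k * sobNorm s A₀)
    (hγ : ∀ t ∈ Set.Icc 0 τ,
      |(2 * γ t - γ t ^ 2) - (2 * γ 0 - γ 0 ^ 2)| ≤ 1 / 2 * (1 - (2 * γ 0 - γ 0 ^ 2))) :
    IsControlledSolution q s p k ε ν T A₀ τ z v
      fun t => acceleration q p k ε T t (γ t) (z t) := by
  have h0 : (0 : ℝ) ∈ Set.Icc 0 τ := Set.left_mem_Icc.2 hτ
  refine ⟨h.isSolution hM hp hτ, fun t ht => ⟨h.isBandLimited_fst t ht, h.isBandLimited_snd t ht,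
    (h.isBandLimited_fst t ht).isBandLimited_acceleration hp⟩, h.continuousOn_Lam_fst,
    h.continuousOn_Lam_snd, fun t ht => ⟨?_, ?_⟩, fun t ht => ?_⟩
  · have hzt := hz t ht
    rw [(h.isBandLimited_fst t ht).Lam_sub (h.isBandLimited_fst 0 h0)] at hzt
    linarith [norm_le_norm_sub_add (Lam s k ε (z t)) (Lam s k ε (z 0))]
  · have hvt := hv t ht
    rw [(h.isBandLimited_snd t ht).Lam_sub (h.isBandLimited_snd 0 h0)] at hvt
    rw [inv_mul_le_iff₀ (freq_pos p hk)] at hv₀ ⊢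
    linarith [norm_le_norm_sub_add (Lam s k ε (v t)) (Lam s k ε (v 0))]
  · rw [h.controlNorm_eq hM ht, h.controlNorm_eq hM h0]
    exact hγ t ht

end IsPenalizedMotion

theorem slope_le_of_norm_le {H : Type*} [NormedAddCommGroup H] [InnerProductSpace ℝ H] {f n : H}
    {N b e γ : ℝ} (hf : ‖f‖ ^ 2 ≤ b ^ 2 * N ^ 2) (hn : ‖n‖ ≤ 3 * N * e) (he : 0 ≤ e) (hN : 0 ≤ N)
    (hb : 1 < b) (hγ : 6 * e ≤ 1 - γ) :
    3 * N ^ 2 * e ≤ b ^ 2 * N ^ 2 * (1 - γ) + inner ℝ f n := by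
  have hfN : ‖f‖ ≤ b * N := le_of_sq_le_sq (by rwa [mul_pow]) (by positivity)
  have hinner : -(b * N * (3 * N * e)) ≤ inner ℝ f n :=
    neg_le_of_abs_le ((abs_real_inner_le_norm f n).trans (by gcongr))
  have hMγ : b ^ 2 * N ^ 2 * (6 * e) ≤ b ^ 2 * N ^ 2 * (1 - γ) := by gcongr
  have hb2 : 3 * (N ^ 2 * e) ≤ (6 * b ^ 2 - 3 * b) * (N ^ 2 * e) := by
    gcongr
    nlinarith
  linarith

theorem IsBandLimited.norm_le_mul_norm_Lam {f : L2} (hf : IsBandLimited k f) (s ε : ℝ) :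
    ‖f‖ ≤ ‖bandOp k (besselC (-s) k ε)‖ * ‖Lam s k ε f‖ := by
  have hinv : bandOp k (besselC (-s) k ε) (Lam s k ε f) = f := by
    have := hf.Lam_Lam_neg (s := -s) (ε := ε)
    rwa [neg_neg, hf.isBandLimited_Lam.Lam_eq] at this
  conv_lhs => rw [← hinv]
  exact ContinuousLinearMap.le_opNorm _ _

theorem compatible_iff_eq_acceleration : Compatible q s p k ε ν T A₀ z₀ w₀ ↔
    w₀ = acceleration q p k ε T 0 (pen (controlNorm s p k ε ν A₀ w₀)) z₀ := by
  rw [acceleration, RCLike.real_smul_eq_coe_smul (K := ℂ)]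
  rfl

namespace IsAdmissibleData

theorem norm_fst_le (h : IsAdmissibleData q s p k ε ν T A₀ z₀ v₀ w₀) :
    ‖z₀‖ ≤ ‖bandOp k (besselC (-s) k ε)‖ * (2 * sobNorm s A₀) :=
  (h.isBandLimited_fst.norm_le_mul_norm_Lam s ε).trans (by gcongr; exact h.norm_Lam_fst_le)

theorem norm_snd_le (hk : 0 < k) (h : IsAdmissibleData q s p k ε ν T A₀ z₀ v₀ w₀) :
    ‖v₀‖ ≤ ‖bandOp k (besselC (-s) k ε)‖ * (freq p k * (2 * sobNorm s A₀)) :=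
  (h.isBandLimited_snd.norm_le_mul_norm_Lam s ε).trans
    (by gcongr; exact (inv_mul_le_iff₀ (freq_pos p hk)).1 h.norm_Lam_snd_le)

variable {K : ℝ} (h : IsAdmissibleData q s p k ε ν T A₀ z₀ v₀ w₀) (hK : TameBound q s k ε K)
  (hq : 1 ≤ q) (hε : 0 < ε) (hT : 0 ≤ T) (hK0 : 0 ≤ K)
  (hsmall : 2 * 2 ^ q * K * T * supNorm A₀ ^ (q - 1) ≤ 1)

include h hK hq hε hT hK0 hsmall

theorem norm_Lam_penal_le : ‖Lam s k ε (penal q p k ε T 0 z₀)‖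
    ≤ 3 * (freq p k ^ 2 * sobNorm s A₀) * ε ^ (q + 4) := by
  have hz₀ := supNorm_nonneg z₀
  have hpow : 2 * (ε ^ 5 * T) * (K * supNorm z₀ ^ (q - 1)) ≤ 1 / 2 * ε ^ (q + 4) :=
    calc 2 * (ε ^ 5 * T) * (K * supNorm z₀ ^ (q - 1))
        ≤ 2 * (ε ^ 5 * T) * (K * (2 * ε * supNorm A₀) ^ (q - 1)) := by gcongr; exact h.supNorm_le
      _ = 1 / 2 * ε ^ (q + 4) * (2 * 2 ^ q * K * T * supNorm A₀ ^ (q - 1)) := by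
        obtain ⟨n, rfl⟩ := Nat.exists_eq_add_of_le' hq
        rw [Nat.add_sub_cancel]
        ring
      _ ≤ 1 / 2 * ε ^ (q + 4) := mul_le_of_le_one_right (by positivity) hsmall
  have hle := h.isBandLimited_fst.norm_Lam_penal_le (p := p) (t := 0) hK hε
    (by positivity : 0 ≤ ε ^ 7 * 0 + ε ^ 5 * T)
  rw [mul_zero, zero_add] at hle
  calc ‖Lam s k ε (penal q p k ε T 0 z₀)‖
      ≤ freq p k ^ 2 * (ε ^ (q + 4) + 1 / 2 * ε ^ (q + 4)) * (2 * sobNorm s A₀) := by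
        refine hle.trans ?_
        gcongr
        exact h.norm_Lam_fst_le
    _ = 3 * (freq p k ^ 2 * sobNorm s A₀) * ε ^ (q + 4) := by ring

theorem isPenRoot (hp : 0 < p) (hk : 0 < k) (hν : 1 < ν) (hA₀ : 0 < sobNorm s A₀)
    (hw₀ : controlNorm s p k ε ν A₀ w₀ < 1)
    (hderiv : deriv pen (controlNorm s p k ε ν A₀ w₀) ≤ 16 / (192 * ε ^ (q + 4))) :
    IsPenRoot (Lam s k ε (force q p k ε z₀)) (Lam s k ε (penal q p k ε T 0 z₀))
      (controlScale s p k ν A₀) (3 * (freq p k ^ 2 * sobNorm s A₀) ^ 2 * ε ^ (q + 4))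
      (pen (controlNorm s p k ε ν A₀ w₀)) := by
  have hω := freq_pos p hk
  have hM : 0 < controlScale s p k ν A₀ := controlScale_pos hk (one_pos.trans hν) hA₀
  have hLam : Lam s k ε (force q p k ε z₀) - pen (controlNorm s p k ε ν A₀ w₀) •
      Lam s k ε (penal q p k ε T 0 z₀) = Lam s k ε w₀ := by
    conv_rhs => rw [compatible_iff_eq_acceleration.1 h.compatible,
      h.isBandLimited_fst.Lam_acceleration hp]
  have hsq : ‖Lam s k ε w₀‖ ^ 2 = controlScale s p k ν A₀ * controlNorm s p k ε ν A₀ w₀ :=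
    (mul_div_cancel₀ _ hM.ne').symm
  have hγ : 6 * ε ^ (q + 4) ≤ 1 - pen (controlNorm s p k ε ν A₀ w₀) := by
    have := le_one_sub_pen hw₀ (by positivity) (by norm_num) hderiv
    linarith
  constructor
  · rw [hLam, two_mul_pen_sub_sq hw₀.le, hsq]
  · rw [hLam, controlScale_eq]
    refine slope_le_of_norm_le ?_ (h.norm_Lam_penal_le hK hq hε hT hK0 hsmall) (by positivity)
      (by positivity) hν hγ
    rw [← controlScale_eq, hsq]
    exact mul_le_of_le_one_right hM.le hw₀.le

end IsAdmissibleData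

theorem exists_isControlledSolution (hq : 1 ≤ q) (s L : ℝ) (hp : 0 < p) (hk : 0 < k) (hε : 0 < ε)
    {δ : ℝ} (hδ : 0 < δ) :
    ∃ τ > 0, ∀ ν T K A₀ z₀ v₀ w₀, 1 < ν → ν ≤ 2 → ε ≤ sobNorm s A₀ → sobNorm s A₀ ≤ ε⁻¹ →
      0 ≤ T → T ≤ L → 0 ≤ K → TameBound q s k ε K →
      2 * 2 ^ q * K * T * supNorm A₀ ^ (q - 1) ≤ 1 →
      IsAdmissibleData q s p k ε ν T A₀ z₀ v₀ w₀ → 1 - controlNorm s p k ε ν A₀ w₀ = δ →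
      deriv pen (controlNorm s p k ε ν A₀ w₀) ≤ 16 / (192 * ε ^ (q + 4)) →
      ∃ z v w, z 0 = z₀ ∧ v 0 = v₀ ∧ w 0 = w₀ ∧
        IsControlledSolution q s p k ε ν T A₀ τ z v w := by
  let ω := freq p k
  have hω : 0 < ω := freq_pos p hk
  let B := ‖bandOp k (besselC (-s) k ε)‖
  obtain ⟨R, hzR, hvR, hLR, hMR⟩ : ∃ R : NNReal, B * (2 * ε⁻¹) ≤ R ∧ B * (ω * (2 * ε⁻¹)) ≤ R ∧
      L ≤ R ∧ 2 ^ 2 * (ω ^ 2 * ε⁻¹) ^ 2 ≤ R :=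
    ⟨(max (max (B * (2 * ε⁻¹)) (B * (ω * (2 * ε⁻¹)))) (max L (2 ^ 2 * (ω ^ 2 * ε⁻¹) ^ 2))).toNNReal,
      by simp [Real.coe_toNNReal']⟩
  obtain ⟨τ, hτ, hmotion⟩ := exists_isPenalizedMotion q s k hp hε R hδ
    (by positivity : 0 < 3 * (ω ^ 2 * ε) ^ 2 * ε ^ (q + 4)) (by positivity : 0 < (ω ^ 2 * ε) ^ 2)
    (lt_min hε (mul_pos hω hε))
  refine ⟨τ, hτ, fun ν T K A₀ z₀ v₀ w₀ hν1 hν2 haε haε' hT0 hTL hK0 hK hsmall h hδ₀ hderiv => ?_⟩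
  have ha : 0 < sobNorm s A₀ := hε.trans_le haε
  have hl1 : controlNorm s p k ε ν A₀ w₀ < 1 := by linarith
  have hM : 0 < controlScale s p k ν A₀ := controlScale_pos hk (one_pos.trans hν1) ha
  have hMR' := (controlScale_le (p := p) (k := k) (one_pos.trans hν1).le hν2 haε').trans hMR
  have hzR' : ‖z₀‖ ≤ R := h.norm_fst_le.trans (le_trans (by gcongr) hzR)
  have hvR' : ‖v₀‖ ≤ R := (h.norm_snd_le hk).trans (le_trans (by gcongr) hvR)
  have hroot := h.isPenRoot hK hq hε hT0 hK0 hsmall hp hk hν1 ha hl1 hderiv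
  obtain ⟨z, v, γ, rfl, rfl, hγ0, hz, hclose⟩ := hmotion T _ z₀ v₀ _
    h.isBandLimited_fst h.isBandLimited_snd hzR' hvR' ((abs_of_nonneg hT0).trans_le (hTL.trans hLR))
    (sq_le_controlScale hν1.le hε.le haε) ((abs_of_pos hM).trans_le hMR')
    (by rw [one_sub_pen, hδ₀]) ⟨hroot.norm_sub_smul_sq, le_trans (by gcongr) hroot.le_slope⟩
  refine ⟨z, v, _, rfl, rfl, ?_, hz.isControlledSolution hM.ne' hp hk hτ.le h.norm_Lam_fst_le
    h.norm_Lam_snd_le (fun t ht => (hclose t ht).1.trans ((min_le_left _ _).trans haε))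
    (fun t ht => (hclose t ht).2.1.trans ((min_le_right _ _).trans (by gcongr))) fun t ht => ?_⟩
  · rw [hγ0]
    exact (compatible_iff_eq_acceleration.1 h.compatible).symm
  · have hγt := (hclose t ht).2.2
    rw [two_mul_pen_sub_sq hl1.le] at hγt
    rwa [hγ0, two_mul_pen_sub_sq hl1.le, hδ₀, one_div_mul_eq_div]

theorem exists_existenceTime {K : ℝ} (hq : 1 ≤ q) (hp : 0 < p) (hk : 0 < k) (hK0 : 0 ≤ K)
    (hK : ∀ ε, 0 < ε → TameBound q s k ε K) :
    ∃ t₀ : ℝ → ℝ → ℝ, (∀ ε δ, 0 < ε → 0 < δ → 0 < t₀ ε δ) ∧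
      ∀ ν Tmax a, 1 < ν → ν ≤ 2 → 0 < Tmax → 0 < a →
      ∃ ε₀ > 0, ∀ ε, 0 < ε → ε < ε₀ → ∀ A₀, sobNorm s A₀ = a →
      4 * 2 ^ q * K * freq p k ^ (4 / p - 1) * Tmax * supNorm A₀ ^ (q - 1) ≤ 1 →
      ∀ T z₀ v₀ w₀, 0 ≤ T → T ≤ 2 * freq p k ^ (4 / p - 1) * Tmax →
      IsAdmissibleData q s p k ε ν T A₀ z₀ v₀ w₀ → controlNorm s p k ε ν A₀ w₀ < 1 →
      deriv pen (controlNorm s p k ε ν A₀ w₀) ≤ 16 / (192 * ε ^ (q + 4)) →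
      ∃ t₁, t₀ ε (1 - controlNorm s p k ε ν A₀ w₀) < t₁ ∧ ∃ z v w, z 0 = z₀ ∧ v 0 = v₀ ∧
        w 0 = w₀ ∧ IsControlledSolution q s p k ε ν T A₀ t₁ z v w := by
  have hω : 0 < freq p k ^ (4 / p - 1) := Real.rpow_pos_of_pos (freq_pos p hk) _
  choose! τ hτ hsol using fun (ε : ℝ) (hε : 0 < ε) (δ : ℝ) (hδ : 0 < δ) =>
    exists_isControlledSolution hq s (2 * freq p k ^ (4 / p - 1) * ε⁻¹) hp hk hε hδ
  refine ⟨fun ε δ => τ ε δ / 2, fun ε δ hε hδ => half_pos (hτ ε hε δ hδ),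
    fun ν Tmax a hν1 hν2 hTmax ha => ⟨min a (min a⁻¹ Tmax⁻¹), by positivity, ?_⟩⟩
  rintro ε hε hlt A₀ rfl hsmall T z₀ v₀ w₀ hT0 hT h hlam hderiv
  obtain ⟨hεa, hεa', hεT⟩ : ε < sobNorm s A₀ ∧ ε < (sobNorm s A₀)⁻¹ ∧ ε < Tmax⁻¹ := by
    simpa only [lt_min_iff] using hlt
  have hTε : T ≤ 2 * freq p k ^ (4 / p - 1) * ε⁻¹ :=
    hT.trans (by gcongr; exact ((lt_inv_comm₀ hε hTmax).1 hεT).le)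
  have hsmall' : 2 * 2 ^ q * K * T * supNorm A₀ ^ (q - 1) ≤ 1 :=
    calc 2 * 2 ^ q * K * T * supNorm A₀ ^ (q - 1)
        ≤ 2 * 2 ^ q * K * (2 * freq p k ^ (4 / p - 1) * Tmax) * supNorm A₀ ^ (q - 1) := by
          have := supNorm_nonneg A₀
          gcongr
      _ = 4 * 2 ^ q * K * freq p k ^ (4 / p - 1) * Tmax * supNorm A₀ ^ (q - 1) := by ring
      _ ≤ 1 := hsmall
  have hδ := sub_pos.2 hlam
  exact ⟨_, half_lt_self (hτ ε hε _ hδ), hsol ε hε _ hδ ν T K A₀ z₀ v₀ w₀ hν1 hν2 hεa.le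
    ((lt_inv_comm₀ hε ha).1 hεa').le hT0 hTε hK0 (hK ε hε) hsmall' h rfl hderiv⟩

end Existence

/-! ### The spectrum of a wave packet -/

section Affine

open Module Real

variable {V : Type*} [NormedAddCommGroup V] [MeasurableSpace V] [BorelSpace V] {r : ℝ}

section Haar

variable [NormedSpace ℝ V] [FiniteDimensional ℝ V] {μ : Measure V} [μ.IsAddHaarMeasure]

theorem lintegral_comp_inv_smul_sub (hr : 0 < r) (κ : V) (F : V → ENNReal) :
    ∫⁻ η, F (r⁻¹ • (η - κ)) ∂μ = ENNReal.ofReal (r ^ finrank ℝ V) * ∫⁻ η, F η ∂μ := by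
  have hr' : r⁻¹ ≠ 0 := inv_ne_zero hr.ne'
  have hemb : MeasurableEmbedding fun η : V => r⁻¹ • η :=
    (Homeomorph.smulOfNeZero r⁻¹ hr').measurableEmbedding
  rw [lintegral_sub_right_eq_self (fun η => F (r⁻¹ • η)) κ, ← hemb.lintegral_map,
    Measure.map_addHaar_smul _ hr',
    lintegral_smul_measure, inv_pow, inv_inv, abs_of_nonneg (by positivity), smul_eq_mul]

theorem integral_comp_inv_smul_sub {E : Type*} [NormedAddCommGroup E] [NormedSpace ℝ E]
    (hr : 0 < r) (κ : V) (F : V → E) :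
    ∫ η, F (r⁻¹ • (η - κ)) ∂μ = r ^ finrank ℝ V • ∫ η, F η ∂μ := by
  rw [integral_sub_right_eq_self (fun η => F (r⁻¹ • η)) κ, Measure.integral_comp_smul, inv_pow,
    inv_inv, abs_of_nonneg (by positivity)]

theorem quasiMeasurePreserving_inv_smul_sub (hr : 0 < r) (κ : V) :
    Measure.QuasiMeasurePreserving (fun η : V => r⁻¹ • (η - κ)) μ μ :=
  (Measure.quasiMeasurePreserving_smul μ (inv_ne_zero hr.ne')).comp
    (measurePreserving_sub_right μ κ).quasiMeasurePreserving

end Haar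

theorem fourierInv_comp_inv_smul_sub [InnerProductSpace ℝ V] [FiniteDimensional ℝ V] (hr : 0 < r)
    (κ : V) (c : V → ℂ) (x : V) :
    𝓕⁻ (fun η => c (r⁻¹ • (η - κ))) x
      = 𝐞 (inner ℝ κ x) • r ^ finrank ℝ V • 𝓕⁻ c (r • x) := by
  have hphase : ∀ η, 𝐞 (inner ℝ η x) = 𝐞 (inner ℝ κ x) * 𝐞 (inner ℝ (r⁻¹ • (η - κ)) (r • x)) :=
    fun η => by
      rw [← AddChar.map_add_eq_mul, inner_smul_left, inner_smul_right, conj_trivial,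
        inv_mul_cancel_left₀ hr.ne', ← inner_add_left, add_sub_cancel]
  calc 𝓕⁻ (fun η => c (r⁻¹ • (η - κ))) x
      = ∫ η, (𝐞 (inner ℝ κ x) : ℂ) •
          𝐞 (inner ℝ (r⁻¹ • (η - κ)) (r • x)) • c (r⁻¹ • (η - κ)) := by
        rw [Real.fourierInv_eq]
        exact integral_congr_ae
          (.of_forall fun η => by simp only [hphase η, mul_smul, Circle.smul_def])
    _ = 𝐞 (inner ℝ κ x) • r ^ finrank ℝ V • 𝓕⁻ c (r • x) := by
        rw [integral_smul,
          integral_comp_inv_smul_sub hr κ fun ζ => 𝐞 (inner ℝ ζ (r • x)) • c ζ, Real.fourierInv_eq,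
          Circle.smul_def (𝐞 (inner ℝ κ x))]

end Affine

section Packet

variable {k ε : ℝ} {A : L2}

/-- The Fourier transform of the wave packet `ε A(εx, εy) e^{ikx}`, for an amplitude `A` with
Fourier transform `c`. The carrier `k e₁` has ordinary frequency `k / 2π`. -/
def packetSpectrum (k ε : ℝ) (c : Plane → ℂ) : Plane → ℂ :=
  fun η => (ε⁻¹ : ℂ) * c (ε⁻¹ • (η - (k / (2 * Real.pi)) • e1))

theorem enorm_packetSpectrum (hε : 0 < ε) (c : Plane → ℂ) (η : Plane) :
    ‖packetSpectrum k ε c η‖ₑ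
      = ENNReal.ofReal ε⁻¹ * ‖c (ε⁻¹ • (η - (k / (2 * Real.pi)) • e1))‖ₑ := by
  rw [packetSpectrum, enorm_mul, ← ofReal_norm, ← Complex.ofReal_inv, Complex.norm_real,
    Real.norm_of_nonneg (by positivity)]

theorem lintegral_enorm_packetSpectrum (hε : 0 < ε) (c : Plane → ℂ) :
    ∫⁻ η, ‖packetSpectrum k ε c η‖ₑ = ENNReal.ofReal ε * ∫⁻ η, ‖c η‖ₑ := by
  simp_rw [enorm_packetSpectrum hε]
  rw [lintegral_const_mul' _ _ ENNReal.ofReal_ne_top,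
    lintegral_comp_inv_smul_sub hε _ (fun η => ‖c η‖ₑ), finrank_euclideanSpace_fin, ← mul_assoc,
    ← ENNReal.ofReal_mul (by positivity)]
  congr 2
  field_simp

theorem eLpNorm_two_packetSpectrum (hε : 0 < ε) (c : Plane → ℂ) :
    eLpNorm (packetSpectrum k ε c) 2 volume = eLpNorm c 2 volume := by
  rw [eLpNorm_eq_lintegral_rpow_enorm_toReal two_ne_zero ENNReal.ofNat_ne_top,
    eLpNorm_eq_lintegral_rpow_enorm_toReal two_ne_zero ENNReal.ofNat_ne_top]
  simp_rw [ENNReal.toReal_ofNat, ENNReal.rpow_two, enorm_packetSpectrum hε, mul_pow]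
  rw [lintegral_const_mul' _ _ (ENNReal.pow_ne_top ENNReal.ofReal_ne_top),
    lintegral_comp_inv_smul_sub hε _ (fun η => ‖c η‖ₑ ^ 2), finrank_euclideanSpace_fin,
    ← mul_assoc, ENNReal.ofReal_pow hε.le, ← mul_pow, ← ENNReal.ofReal_mul (by positivity),
    inv_mul_cancel₀ hε.ne', ENNReal.ofReal_one, one_pow, one_mul]

theorem integrable_packetSpectrum (hε : 0 < ε) {c : Plane → ℂ} (hc : Integrable c) :
    Integrable (packetSpectrum k ε c) := by
  refine ⟨(hc.1.comp_quasiMeasurePreserving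
    (quasiMeasurePreserving_inv_smul_sub hε _)).const_mul _, ?_⟩
  rw [HasFiniteIntegral, lintegral_enorm_packetSpectrum hε]
  exact ENNReal.mul_lt_top ENNReal.ofReal_lt_top hc.2

theorem integral_norm_packetSpectrum (hε : 0 < ε) {c : Plane → ℂ} (hc : Integrable c) :
    ∫ η, ‖packetSpectrum k ε c η‖ = ε * ∫ η, ‖c η‖ := by
  rw [integral_norm_eq_lintegral_enorm (integrable_packetSpectrum hε hc).1,
    lintegral_enorm_packetSpectrum hε, ENNReal.toReal_mul, ENNReal.toReal_ofReal hε.le,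
    ← integral_norm_eq_lintegral_enorm hc.1]

theorem fourierInv_packetSpectrum (hε : 0 < ε) (c : Plane → ℂ) (x : Plane) :
    𝓕⁻ (packetSpectrum k ε c) x
      = (ε : ℂ) * 𝓕⁻ c (ε • x) * Complex.exp (Complex.I * ((k * x 0 : ℝ) : ℂ)) := by
  have hcarrier : 2 * Real.pi * inner ℝ ((k / (2 * Real.pi)) • e1) x = k * x 0 := by
    rw [inner_smul_left, e1, EuclideanSpace.inner_single_left, map_one, conj_trivial]
    field_simp
  have hscale : 𝓕⁻ (packetSpectrum k ε c) x
      = (ε⁻¹ : ℂ) • 𝓕⁻ (fun η => c (ε⁻¹ • (η - (k / (2 * Real.pi)) • e1))) x :=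
    congrFun (VectorFourier.fourierIntegral_const_smul _ _ _ _ _) x
  have hε' : (ε : ℂ) ≠ 0 := Complex.ofReal_ne_zero.2 hε.ne'
  rw [hscale, fourierInv_comp_inv_smul_sub hε,
    finrank_euclideanSpace_fin, Circle.smul_def, Real.fourierChar_apply, hcarrier]
  simp only [smul_eq_mul, Complex.real_smul]
  push_cast
  field_simp

theorem memLp_packet (k : ℝ) (hε : 0 < ε) (A : L2) : MemLp (fun x : Plane =>
    (ε : ℂ) * A (ε • x) * Complex.exp (Complex.I * ((k * x 0 : ℝ) : ℂ))) 2 volume := by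
  have hmeas : AEStronglyMeasurable (fun x : Plane => A (ε • x)) volume :=
    (Lp.aestronglyMeasurable A).comp_quasiMeasurePreserving
      (Measure.quasiMeasurePreserving_smul volume hε.ne')
  have hdil : MemLp (fun x : Plane => A (ε • x)) 2 volume :=
    (memLp_two_iff_integrable_sq_norm hmeas).2
      (((memLp_two_iff_integrable_sq_norm (Lp.memLp A).1).1 (Lp.memLp A)).comp_smul hε.ne')
  refine hdil.of_le_mul (c := ε) ((hmeas.const_mul (ε : ℂ)).mul
    (Continuous.aestronglyMeasurable (by fun_prop))) (.of_forall fun x => ?_)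
  rw [norm_mul, norm_mul, mul_comm Complex.I, Complex.norm_exp_ofReal_mul_I, mul_one,
    Complex.norm_real, Real.norm_of_nonneg hε.le]

theorem fourier_packet_ae_eq (k : ℝ) (hε : 0 < ε) (hA : Integrable (𝓕 A : L2)) :
    ((𝓕 (toL2 fun x => (ε : ℂ) * A (ε • x) * Complex.exp (Complex.I * ((k * x 0 : ℝ) : ℂ))) : L2)
      : Plane → ℂ) =ᵐ[volume] packetSpectrum k ε (𝓕 A : L2) := by
  refine fourier_ae_eq_of_ae_eq_fourierInv (integrable_packetSpectrum hε hA) ?_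
  filter_upwards [toL2_ae_eq (memLp_packet k hε A),
    (Measure.quasiMeasurePreserving_smul volume hε.ne').ae (pointValue_ae_eq hA)] with x hx hAx
  rw [hx, fourierInv_packetSpectrum hε, hAx, pointValue]

theorem norm_fourier_packetDatum_le (k : ℝ) (hε : 0 < ε) (hA : Integrable (𝓕 A : L2)) :
    ∀ᵐ η, ‖(𝓕 (packetDatum k ε A) : L2) η‖ ≤ ‖packetSpectrum k ε (𝓕 A : L2) η‖ := by
  filter_upwards [fourier_band_ae_eq k (toL2 fun x =>
    (ε : ℂ) * A (ε • x) * Complex.exp (Complex.I * ((k * x 0 : ℝ) : ℂ))),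
    fourier_packet_ae_eq k hε hA] with η hband hpacket
  rw [packetDatum, hband, norm_symbolMul, hpacket]
  exact mul_le_of_le_one_left (norm_nonneg _) (abs_bandSymbol_le k _)

theorem isBandLimited_packetDatum (k ε : ℝ) (A : L2) : IsBandLimited k (packetDatum k ε A) :=
  isBandLimited_band k _

theorem norm_multiplier_packetDatum_le (k : ℝ) (hε : 0 < ε) (hA : Integrable (𝓕 A : L2))
    {m : C(Plane, ℝ)} {m₀ : Plane → ℝ} (hm : ⇑m = rescaledSymbol k ε m₀) (hd : InDomain m₀ A) :
    ‖multiplier m (packetDatum k ε A)‖ ≤ ‖multiplier m₀ A‖ := by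
  have hcarrier : ∀ η : Plane, ε⁻¹ • ((2 * Real.pi) • η - k • e1)
      = (2 * Real.pi) • ε⁻¹ • (η - (k / (2 * Real.pi)) • e1) := fun η => by
    rw [smul_comm (2 * Real.pi), smul_sub (2 * Real.pi), smul_smul (2 * Real.pi),
      mul_div_cancel₀ _ (by positivity)]
  have hle : ∀ᵐ η, ‖symbolMul m (packetDatum k ε A) η‖
      ≤ ‖packetSpectrum k ε (symbolMul m₀ A) η‖ := by
    filter_upwards [norm_fourier_packetDatum_le k hε hA] with η hη
    rw [norm_symbolMul, hm, rescaledSymbol, hcarrier, packetSpectrum, norm_mul, norm_symbolMul,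
      mul_left_comm, ← norm_mul]
    exact mul_le_mul_of_nonneg_left hη (abs_nonneg _)
  rw [norm_multiplier, norm_multiplier, Lp.norm_def, Lp.norm_def, eLpNorm_congr_ae (toL2_ae_eq hd),
    eLpNorm_congr_ae (toL2_ae_eq ((isBandLimited_packetDatum k ε A).inDomain m)),
    ← eLpNorm_two_packetSpectrum hε (symbolMul m₀ A)]
  refine ENNReal.toReal_mono ?_ (eLpNorm_mono_ae hle)
  rw [eLpNorm_two_packetSpectrum hε]
  exact hd.2.ne

theorem supNorm_packetDatum_le (k : ℝ) (hε : 0 < ε) (hA : Integrable (𝓕 A : L2)) :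
    supNorm (packetDatum k ε A) ≤ ε * ∫ η, ‖(𝓕 A : L2) η‖ := by
  have hint := (isBandLimited_packetDatum k ε A).integrable_fourier
  have hle : ∫ η, ‖(𝓕 (packetDatum k ε A) : L2) η‖ ≤ ε * ∫ η, ‖(𝓕 A : L2) η‖ :=
    (integral_mono_ae hint.norm (integrable_packetSpectrum hε hA).norm
      (norm_fourier_packetDatum_le k hε hA)).trans_eq (integral_norm_packetSpectrum hε hA)
  refine supNorm_le (mul_nonneg hε.le (integral_nonneg fun _ => norm_nonneg _)) ?_
  filter_upwards [pointValue_ae_eq hint] with x hx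
  rw [hx]
  exact (norm_fourierInv_le _ x).trans hle

end Packet

/-! ### Compatible initial data -/

section Bessel

variable {s r : ℝ} {A : L2}

theorem besselSymbol_nonneg (s : ℝ) (ξ : Plane) : 0 ≤ besselSymbol s ξ :=
  Real.rpow_nonneg (by positivity) _

theorem measurable_besselSymbol (s : ℝ) : Measurable (besselSymbol s) := by
  unfold besselSymbol
  fun_prop

theorem besselSymbol_le_besselSymbol (h : s ≤ r) (ξ : Plane) :
    besselSymbol s ξ ≤ besselSymbol r ξ :=
  Real.rpow_le_rpow_of_exponent_le (le_add_of_nonneg_left (sq_nonneg _)) (by linarith)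

theorem besselSymbol_mul_besselSymbol (s r : ℝ) (ξ : Plane) :
    besselSymbol s ξ * besselSymbol r ξ = besselSymbol (s + r) ξ := by
  rw [besselSymbol, besselSymbol, ← Real.rpow_add (by positivity), ← add_div, besselSymbol]

theorem norm_mul_besselSymbol_le (s : ℝ) (ξ : Plane) :
    ‖ξ‖ * besselSymbol s ξ ≤ besselSymbol (s + 1) ξ := by
  have hnorm : ‖ξ‖ ≤ besselSymbol 1 ξ := by
    rw [besselSymbol, ← Real.sqrt_eq_rpow]
    exact Real.le_sqrt_of_sq_le (by linarith)
  rw [add_comm, ← besselSymbol_mul_besselSymbol]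
  exact mul_le_mul_of_nonneg_right hnorm (besselSymbol_nonneg s ξ)

theorem norm_symbolMul_besselSymbol_le (h : s ≤ r) (A : L2) (η : Plane) :
    ‖symbolMul (besselSymbol s) A η‖ ≤ 1 * ‖symbolMul (besselSymbol r) A η‖ := by
  rw [norm_symbolMul, norm_symbolMul, one_mul, abs_of_nonneg (besselSymbol_nonneg _ _),
    abs_of_nonneg (besselSymbol_nonneg _ _)]
  gcongr
  exact besselSymbol_le_besselSymbol h _

theorem MemH.mono (hA : MemH r A) (h : s ≤ r) : MemH s A :=
  InDomain.of_norm_le (measurable_besselSymbol s) hA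
    (.of_forall (norm_symbolMul_besselSymbol_le h A))

theorem MemH.sobNorm_le (hA : MemH r A) (h : s ≤ r) : sobNorm s A ≤ sobNorm r A :=
  (norm_multiplier_le (measurable_besselSymbol s) hA
    (.of_forall (norm_symbolMul_besselSymbol_le h A))).trans_eq (one_mul _)

theorem memLp_besselSymbol_neg (hr : 1 < r) :
    MemLp (fun η : Plane => besselSymbol (-r) ((2 * Real.pi) • η)) 2 volume := by
  have hdecay : Integrable fun ξ : Plane => (1 + ‖ξ‖ ^ 2) ^ (-(2 * r) / 2) :=
    integrable_rpow_neg_one_add_norm_sq (by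
      rw [finrank_euclideanSpace_fin]
      push_cast
      linarith)
  refine (memLp_two_iff_integrable_sq ((measurable_besselSymbol (-r)).comp
    (measurable_const_smul _)).aestronglyMeasurable).2
      ((hdecay.comp_smul Real.two_pi_pos.ne').congr (.of_forall fun η => ?_))
  change (1 + ‖(2 * Real.pi) • η‖ ^ 2) ^ _ = besselSymbol (-r) ((2 * Real.pi) • η) ^ 2
  rw [sq (besselSymbol _ _), besselSymbol_mul_besselSymbol, besselSymbol, add_comm 1,
    two_mul r, neg_add]

theorem exists_integral_norm_fourier_le_sobNorm (hr : 1 < r) :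
    ∃ C : ℝ, 0 ≤ C ∧ ∀ A : L2, MemH r A →
      Integrable (𝓕 A : L2) ∧ ∫ η, ‖(𝓕 A : L2) η‖ ≤ C * sobNorm r A := by
  have hφ := memLp_besselSymbol_neg hr
  refine ⟨(eLpNorm (fun η : Plane => besselSymbol (-r) ((2 * Real.pi) • η)) 2 volume).toReal,
    ENNReal.toReal_nonneg, fun A hA => ?_⟩
  have hA' : (fun η => besselSymbol (-r) ((2 * Real.pi) • η) •
      (𝓕 (multiplier (besselSymbol r) A) : L2) η) =ᵐ[volume] (𝓕 A : L2) := by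
    filter_upwards [fourier_multiplier_ae_eq hA] with η h
    rw [h, symbolMul, Complex.real_smul, ← mul_assoc, ← Complex.ofReal_mul,
      besselSymbol_mul_besselSymbol, neg_add_cancel]
    simp [besselSymbol]
  have hle := integral_norm_smul_le hφ (𝓕 (multiplier (besselSymbol r) A) : L2)
  rw [Lp.norm_fourier_eq] at hle
  exact ⟨(integrable_smul_of_memLp_two hφ _).congr hA',
    (integral_congr_ae (hA'.fun_comp norm)).symm.trans_le hle⟩

end Bessel

section Dispersion

variable {p k : ℝ}

theorem bandOp_add (k : ℝ) (m m' : C(Plane, ℝ)) (f : L2) :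
    bandOp k (m + m') f = bandOp k m f + bandOp k m' f := by
  refine (eq_bandOp_of_fourier_ae_eq ?_).symm
  filter_upwards [fourier_add_ae_eq (bandOp k m f) (bandOp k m' f), fourier_bandOp_ae_eq k m f,
    fourier_bandOp_ae_eq k m' f] with η hadd hm hm'
  rw [hadd, hm, hm']
  simp only [symbolMul, ContinuousMap.add_apply]
  push_cast
  ring

theorem norm_bandOp_le {m m' : C(Plane, ℝ)} {C : ℝ}
    (h : ∀ ξ ∈ Metric.closedBall (k • e1) (k / 2), |m ξ| ≤ C * |m' ξ|) (f : L2) :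
    ‖bandOp k m f‖ ≤ C * ‖bandOp k m' f‖ := by
  refine norm_multiplier_le (measurable_mul_bandSymbol k m) (inDomain_mul_bandSymbol k m' f)
    (.of_forall fun η => ?_)
  rw [norm_symbolMul, norm_symbolMul, ← mul_assoc]
  gcongr
  by_cases hη : (2 * Real.pi) • η ∈ Metric.closedBall (k • e1) (k / 2)
  · simpa only [bandSymbol_of_mem hη, mul_one] using h _ hη
  · simp [bandSymbol_of_notMem hη]

theorem freq_sq (p : ℝ) (hk : 0 ≤ k) : freq p k ^ 2 = k ^ p := by
  rw [freq, ← Real.rpow_mul_natCast hk, Nat.cast_ofNat, div_mul_cancel₀ _ two_ne_zero]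

theorem norm_smul_e1 (hk : 0 ≤ k) : ‖k • e1‖ = k := by
  rw [norm_smul, e1, PiLp.norm_single, norm_one, mul_one, Real.norm_of_nonneg hk]

theorem exists_abs_norm_rpow_sub_freq_sq_le (p : ℝ) (hk : 0 < k) :
    ∃ C : ℝ, 0 ≤ C ∧ ∀ ξ ∈ Metric.closedBall (k • e1) (k / 2),
      |‖ξ‖ ^ p - freq p k ^ 2| ≤ C * ‖ξ - k • e1‖ := by
  have hne : ∀ r ∈ Set.Icc (k / 2) (3 * k / 2), r ≠ 0 := fun r hr =>
    ((half_pos hk).trans_le hr.1).ne'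
  obtain ⟨C, hC⟩ := (isCompact_Icc (a := k / 2) (b := 3 * k / 2)).exists_bound_of_continuousOn
    (f := fun r : ℝ => p * r ^ (p - 1)) (continuousOn_const.mul
      (continuousOn_id.rpow_const fun r hr => Or.inl (hne r hr)))
  have hk_mem : k ∈ Set.Icc (k / 2) (3 * k / 2) := ⟨by linarith, by linarith⟩
  have hC0 : 0 ≤ C := (norm_nonneg _).trans (hC k hk_mem)
  refine ⟨C, hC0, fun ξ hξ => ?_⟩
  have hdist : |‖ξ‖ - k| ≤ ‖ξ - k • e1‖ := by
    have := abs_norm_sub_norm_le ξ (k • e1)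
    rwa [norm_smul_e1 hk.le] at this
  have hξ' := abs_le.1 (hdist.trans (mem_closedBall_iff_norm.1 hξ))
  rw [freq_sq p hk.le]
  exact ((convex_Icc _ _).norm_image_sub_le_of_norm_hasDerivWithin_le (f := fun r : ℝ => r ^ p)
    (fun r hr => (Real.hasDerivAt_rpow_const (Or.inl (hne r hr))).hasDerivWithinAt) hC hk_mem
    (y := ‖ξ‖) ⟨by linarith, by linarith⟩).trans (mul_le_mul_of_nonneg_left hdist hC0)

theorem norm_sub_mul_besselC_le {ε : ℝ} (hε : 0 < ε) (s k : ℝ) (ξ : Plane) :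
    ‖ξ - k • e1‖ * besselC s k ε ξ ≤ ε * besselC (s + 1) k ε ξ := by
  have h := norm_mul_besselSymbol_le s (ε⁻¹ • (ξ - k • e1))
  rwa [norm_smul, Real.norm_of_nonneg (by positivity), mul_assoc, inv_mul_le_iff₀ hε] at h

theorem exists_norm_Lam_absD_le (hp : 0 < p) (hk : 0 < k) :
    ∃ C : ℝ, 0 ≤ C ∧ ∀ (s ε : ℝ), 0 < ε → ∀ z : L2, IsBandLimited k z →
      ‖Lam s k ε (absD p z)‖ ≤ freq p k ^ 2 * ‖Lam s k ε z‖ + C * ε * ‖Lam (s + 1) k ε z‖ := by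
  obtain ⟨C, hC0, hC⟩ := exists_abs_norm_rpow_sub_freq_sq_le p hk
  refine ⟨C, hC0, fun s ε hε z hz => ?_⟩
  have hsplit : besselC s k ε * rieszC p hp =
      besselC s k ε * .const _ (freq p k ^ 2) +
        besselC s k ε * (rieszC p hp - .const _ (freq p k ^ 2)) := by ring
  have hbessel : ∀ s ξ, 0 ≤ besselC s k ε ξ := fun s ξ => besselSymbol_nonneg s _
  rw [(hz.isBandLimited_absD hp).Lam_eq, hz.absD_eq hp, bandOp_bandOp, hsplit, bandOp_add,
    hz.Lam_eq, hz.Lam_eq]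
  refine (norm_add_le _ _).trans (add_le_add (norm_bandOp_le (fun ξ _ => ?_) z)
    (norm_bandOp_le (fun ξ hξ => ?_) z))
  · rw [ContinuousMap.mul_apply, ContinuousMap.const_apply, abs_mul, abs_sq, mul_comm]
  · rw [ContinuousMap.mul_apply, ContinuousMap.sub_apply, ContinuousMap.const_apply, abs_mul,
      abs_of_nonneg (hbessel s ξ), abs_of_nonneg (hbessel (s + 1) ξ)]
    calc besselC s k ε ξ * |‖ξ‖ ^ p - freq p k ^ 2|
        ≤ besselC s k ε ξ * (C * ‖ξ - k • e1‖) :=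
          mul_le_mul_of_nonneg_left (hC ξ hξ) (hbessel s ξ)
      _ = C * (‖ξ - k • e1‖ * besselC s k ε ξ) := by ring
      _ ≤ C * ε * besselC (s + 1) k ε ξ := by
          rw [mul_assoc C]
          exact mul_le_mul_of_nonneg_left (norm_sub_mul_besselC_le hε s k ξ) hC0

end Dispersion

section Compatibility

variable {q : ℕ} {s p k ε ν T c K : ℝ} {z A₀ : L2}

theorem abs_pen_le_one {l : ℝ} (h : 0 ≤ l) : |pen l| ≤ 1 := by
  rw [pen, abs_of_nonneg (sub_nonneg.2 (Real.sqrt_le_one.2 (sub_le_self 1 h)))]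
  exact sub_le_self _ (Real.sqrt_nonneg _)

theorem exists_norm_sub_pen_smul_sq_div_eq {H : Type*} [NormedAddCommGroup H] [NormedSpace ℝ H]
    {f n : H} {M : ℝ} (hM : 0 < M) (hc : 0 ≤ c) (h : (‖f‖ + ‖n‖) ^ 2 ≤ c * M) :
    ∃ l ∈ Set.Icc 0 c, ‖f - pen l • n‖ ^ 2 / M = l := by
  have hcont : Continuous fun l : ℝ => ‖f - pen l • n‖ ^ 2 / M := by
    unfold pen
    fun_prop
  refine exists_mem_Icc_isFixedPt_of_mapsTo hcont.continuousOn hc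
    fun l hl => ⟨by positivity, (div_le_iff₀ hM).2 (le_trans ?_ h)⟩
  gcongr
  refine (norm_sub_le _ _).trans (add_le_add_right ?_ _)
  rw [norm_smul]
  exact mul_le_of_le_one_left (norm_nonneg _) (abs_pen_le_one hl.1)

theorem IsBandLimited.exists_compatible (hz : IsBandLimited k z) (hp : 0 < p)
    (hM : 0 < controlScale s p k ν A₀) (hc : 0 ≤ c)
    (h : (‖Lam s k ε (force q p k ε z)‖ + ‖Lam s k ε (penal q p k ε T 0 z)‖) ^ 2 ≤
      c * controlScale s p k ν A₀) :
    ∃ w, Compatible q s p k ε ν T A₀ z w ∧ controlNorm s p k ε ν A₀ w ≤ c := by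
  obtain ⟨l, hl, hfix⟩ := exists_norm_sub_pen_smul_sq_div_eq hM hc h
  rw [← hz.Lam_acceleration hp, ← controlNorm_eq_div] at hfix
  exact ⟨_, compatible_iff_eq_acceleration.2 (by rw [hfix]), hfix.trans_le hl.2⟩

theorem exists_norm_Lam_force_add_norm_Lam_penal_le (q : ℕ) {a b S L : ℝ} (hp : 0 < p)
    (hk : 0 < k) (ha : 0 ≤ a) (hb : 0 ≤ b) (hS : 0 ≤ S) (hL : 0 ≤ L) (hK0 : 0 ≤ K) :
    ∃ D : ℝ, 0 ≤ D ∧ ∀ s ε : ℝ, 0 < ε → ε ≤ 1 → TameBound q s k ε K →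
      ∀ z : L2, IsBandLimited k z → ‖Lam s k ε z‖ ≤ a → ‖Lam (s + 1) k ε z‖ ≤ b →
      supNorm z ≤ ε * S → ∀ T : ℝ, 0 ≤ T → T ≤ L →
      ‖Lam s k ε (force q p k ε z)‖ + ‖Lam s k ε (penal q p k ε T 0 z)‖ ≤
        freq p k ^ 2 * a + D * ε := by
  obtain ⟨C, hC0, hC⟩ := exists_norm_Lam_absD_le hp hk
  have hpow := powCoeff_nonneg p hk
  refine ⟨C * b + powCoeff p k * (S ^ (q - 1) * (K * a)) +
    freq p k ^ 2 * (1 + 2 * L * (K * S ^ (q - 1))) * a, by positivity,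
    fun s ε hε hε1 hK z hz hza hzb hzS T hT hTL => ?_⟩
  have hpow_le : ∀ n : ℕ, n ≠ 0 → ε ^ n ≤ ε := fun n hn => pow_le_of_le_one hε.le hε1 hn
  have hsup := supNorm_nonneg z
  have hforce : ‖Lam s k ε (force q p k ε z)‖ ≤
      freq p k ^ 2 * a + C * ε * b + powCoeff p k * ε * (S ^ (q - 1) * (K * a)) := by
    rw [force, (hz.isBandLimited_absD hp).neg.Lam_sub isBandLimited_semilinear,
      (hz.isBandLimited_absD hp).neg.Lam_eq, map_neg, ← (hz.isBandLimited_absD hp).Lam_eq]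
    refine (norm_sub_le _ _).trans (add_le_add ?_ ?_)
    · rw [norm_neg]
      exact (hC s ε hε z hz).trans (by gcongr)
    · refine (hz.norm_Lam_semilinear_le hK hk hε).trans ?_
      gcongr
      · exact hpow_le 2 two_ne_zero
      · rwa [div_le_iff₀' hε]
  have hpenal : ‖Lam s k ε (penal q p k ε T 0 z)‖ ≤
      freq p k ^ 2 * (ε + 2 * (ε * L) * (K * S ^ (q - 1))) * a := by
    refine (hz.norm_Lam_penal_le hK hε (by positivity)).trans ?_
    rw [mul_zero, zero_add]
    gcongr
    · exact hpow_le _ (by omega)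
    · exact hpow_le 5 (by omega)
    · exact hzS.trans (mul_le_of_le_one_left hS hε1)
  linarith

theorem exists_compatible_packetDatum (q : ℕ) {L a N : ℝ} (b : ℝ) (hp : 0 < p)
    (hk : 0 < k) (hν : 1 < ν) (hL : 0 ≤ L) (ha : 0 < a) (hN : s + 1 ≤ N) (hN1 : 1 < N)
    (hK0 : 0 ≤ K) (hK : ∀ ε : ℝ, 0 < ε → TameBound q s k ε K) :
    ∃ ε₀ > 0, ∀ ε : ℝ, 0 < ε → ε < ε₀ → ∀ A₀ : L2, MemH N A₀ → sobNorm s A₀ = a →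
      sobNorm N A₀ = b → ∀ T : ℝ, 0 ≤ T → T ≤ L →
      ∃ w, Compatible q s p k ε ν T A₀ (packetDatum k ε A₀) w ∧
        controlNorm s p k ε ν A₀ w ≤ 1 / 2 + 1 / (2 * ν ^ 2) := by
  obtain ⟨C, hC0, hC⟩ := exists_integral_norm_fourier_le_sobNorm hN1
  obtain ⟨D, hD0, hD⟩ := exists_norm_Lam_force_add_norm_Lam_penal_le q hp hk ha.le
    (abs_nonneg b) (mul_nonneg hC0 (abs_nonneg b)) hL hK0
  have hω := freq_pos p hk
  have hρ1 : 1 < √((ν ^ 2 + 1) / 2) := by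
    rw [Real.lt_sqrt zero_le_one]
    nlinarith
  set ρ := √((ν ^ 2 + 1) / 2)
  have hρ : ρ ^ 2 = (ν ^ 2 + 1) / 2 := Real.sq_sqrt (by positivity)
  refine ⟨min 1 ((ρ - 1) * (freq p k ^ 2 * a) / (D + 1)),
    lt_min one_pos (div_pos (mul_pos (sub_pos.2 hρ1) (by positivity)) (by positivity)),
    fun ε hε hεlt A₀ hA hAs hAN T hT hTL => ?_⟩
  obtain ⟨hε1, hεD⟩ := lt_min_iff.1 hεlt
  rw [lt_div_iff₀ (by positivity)] at hεD
  obtain ⟨hint, hint_le⟩ := hC A₀ hA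
  rw [hAN] at hint_le
  have hs1 : ‖Lam (s + 1) k ε (packetDatum k ε A₀)‖ ≤ |b| :=
    (norm_multiplier_packetDatum_le k hε hint (m := besselC (s + 1) k ε) rfl (hA.mono hN)).trans
      ((hA.sobNorm_le hN).trans (hAN.trans_le (le_abs_self b)))
  have hsup : supNorm (packetDatum k ε A₀) ≤ ε * (C * |b|) :=
    (supNorm_packetDatum_le k hε hint).trans (mul_le_mul_of_nonneg_left
      (hint_le.trans (mul_le_mul_of_nonneg_left (le_abs_self b) hC0)) hε.le)
  have hsum := hD s ε hε hε1.le (hK ε hε) _ (isBandLimited_packetDatum k ε A₀)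
    ((norm_multiplier_packetDatum_le k hε hint (m := besselC s k ε) rfl
      (hA.mono (by linarith))).trans_eq hAs) hs1 hsup T hT hTL
  have hA₀ : 0 < sobNorm s A₀ := hAs ▸ ha
  refine (isBandLimited_packetDatum k ε A₀).exists_compatible hp
    (controlScale_pos hk (one_pos.trans hν) hA₀) (by positivity) ?_
  calc _ ≤ (ρ * (freq p k ^ 2 * a)) ^ 2 := by
        gcongr
        linarith
    _ = _ := by
        rw [mul_pow, hρ, controlScale_eq, hAs]
        field_simp

end Compatibility

theorem mainTheorem3_general :
    ∃ 𝒞 : ℝ, 1 < 𝒞 ∧ ∀ (q : ℕ) (s : ℝ), Odd q → 0 < s →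
    ∃ K > 0, ∀ p k : ℝ, 0 < p → 0 < k →
    ∃ t₀ : ℝ → ℝ → ℝ, (∀ ε δ, 0 < ε → 0 < δ → 0 < t₀ ε δ) ∧
    ∀ ν Tmax a : ℝ, 1 < ν → ν ≤ 2 → 0 < Tmax → 0 < a →
      (∀ N b : ℝ, s + 1 ≤ N → ∃ ε₀ > 0, ∀ ε, 0 < ε → ε < ε₀ →
        ∀ A₀, MemH N A₀ → sobNorm s A₀ = a → sobNorm N A₀ = b →
        ∀ T, 0 ≤ T → T ≤ 2 * freq p k ^ (4 / p - 1) * Tmax →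
        ∃ w, Compatible q s p k ε ν T A₀ (packetDatum k ε A₀) w ∧
          controlNorm s p k ε ν A₀ w ≤ 1 / 2 + 1 / (2 * ν ^ 2)) ∧
      ∃ ε₀ > 0, ∀ ε, 0 < ε → ε < ε₀ → ∀ A₀ N, s + 1 ≤ N → MemH N A₀ → sobNorm s A₀ = a →
        K * freq p k ^ (4 / p - 1) * Tmax * supNorm A₀ ^ (q - 1) ≤ 1 →
        ∀ T z₀ v₀ w₀, 0 ≤ T → T ≤ 2 * freq p k ^ (4 / p - 1) * Tmax →
        IsAdmissibleData q s p k ε ν T A₀ z₀ v₀ w₀ → controlNorm s p k ε ν A₀ w₀ < 1 →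
        deriv pen (controlNorm s p k ε ν A₀ w₀) ≤ 16 / (𝒞 * ε ^ (q + 4)) →
        ∃ t₁, t₀ ε (1 - controlNorm s p k ε ν A₀ w₀) < t₁ ∧ ∃ z v w, z 0 = z₀ ∧ v 0 = v₀ ∧
          w 0 = w₀ ∧ IsControlledSolution q s p k ε ν T A₀ t₁ z v w := by
  refine ⟨192, by norm_num, fun q s hq hs => ?_⟩
  obtain ⟨K, hK1, hK⟩ := exists_tameBound hq hs
  have hK0 : 0 ≤ K := zero_le_one.trans hK1
  refine ⟨4 * 2 ^ q * K, by positivity, fun p k hp hk => ?_⟩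
  have hω : 0 < freq p k := freq_pos p hk
  obtain ⟨t₀, ht₀, hsol⟩ := exists_existenceTime hq.pos hp hk hK0 (hK k)
  refine ⟨t₀, ht₀, fun ν Tmax a hν1 hν2 hTmax ha => ⟨fun N b hN => ?_, ?_⟩⟩
  · exact exists_compatible_packetDatum q b hp hk hν1 (by positivity) ha hN (by linarith) hK0 (hK k)
  · obtain ⟨ε₀, hε₀, hsolε⟩ := hsol ν Tmax a hν1 hν2 hTmax ha
    exact ⟨ε₀, hε₀, fun ε hε hlt A₀ N _ _ => hsolε ε hε hlt A₀⟩

end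

end Progenitor

theorem mainTheorem3 :
    ∃ 𝒞 : ℝ, 1 < 𝒞 ∧
    ∀ (q : ℕ) (s : ℝ), Odd q → 3 ≤ q → 1 - 2 / ((q : ℝ) - 1) < s →
    ∃ K : ℝ, 0 < K ∧
    ∀ p k : ℝ, 0 < p → 0 < k →
    ∃ t₀ : ℝ → ℝ → ℝ, (∀ ε δ : ℝ, 0 < ε → 0 < δ → 0 < t₀ ε δ) ∧
    ∀ ν Tmax a : ℝ, 1 < ν → ν < 2 → 0 < Tmax → 0 < a →
      -- part (a)
      (∀ N b : ℝ, s + 21 < N → ∃ ε₀ : ℝ, 0 < ε₀ ∧ ∀ ε : ℝ, 0 < ε → ε < ε₀ →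
        ∀ A₀ : L2, MemH N A₀ → sobNorm s A₀ = a → sobNorm N A₀ = b →
        ∀ T₁ 𝒯₁ : ℝ, 0 < T₁ → 0 ≤ 𝒯₁ → T₁ + 𝒯₁ ≤ 2 * freq p k ^ (4 / p - 1) * Tmax →
        ∃ 𝔴₀ : L2,
          Compatible q s p k ε ν (T₁ + 𝒯₁) A₀ (packetDatum k ε A₀) 𝔴₀ ∧
          controlNorm s p k ε ν A₀ 𝔴₀ ≤ 1 / 2 + 1 / (2 * ν ^ 2) ∧
          1 / 2 + 1 / (2 * ν ^ 2) < 1) ∧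
      -- part (b)
      (∃ ε₀ : ℝ, 0 < ε₀ ∧ ∀ ε : ℝ, 0 < ε → ε < ε₀ →
        ∀ (A₀ : L2) (N : ℝ), s + 21 < N → MemH N A₀ → sobNorm s A₀ = a →
        K * freq p k ^ (4 / p - 1) * Tmax * supNorm A₀ ^ (q - 1) ≤ 1 →
        ∀ T₁ 𝒯₁ : ℝ, 0 < T₁ → 0 ≤ 𝒯₁ → T₁ + 𝒯₁ ≤ 2 * freq p k ^ (4 / p - 1) * Tmax →
        ∀ u₀ v₀ w₀ : L2, u₀ = band k u₀ → v₀ = band k v₀ → w₀ = band k w₀ →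
        ‖u₀‖ ≤ 2 * sobNorm s A₀ →
        (freq p k)⁻¹ * ‖v₀‖ ≤ 2 * sobNorm s A₀ →
        (freq p k ^ 2)⁻¹ * ‖w₀‖ ≤ 2 * sobNorm s A₀ →
        supNorm (Lam (-s) k ε u₀) ≤ 2 * ε * supNorm A₀ →
        Compatible q s p k ε ν (T₁ + 𝒯₁) A₀ (Lam (-s) k ε u₀) (Lam (-s) k ε w₀) →
        ∀ lam₀ : ℝ, lam₀ = controlNorm s p k ε ν A₀ (Lam (-s) k ε w₀) →
        lam₀ < 1 → deriv pen lam₀ ≤ 16 / (𝒞 * ε ^ (q + 4)) →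
        ∃ t₁ : ℝ, t₀ ε (1 - lam₀) < t₁ ∧ ∃ z zt ztt : ℝ → L2,
          -- the initial data
          z 0 = Lam (-s) k ε u₀ ∧ zt 0 = Lam (-s) k ε v₀ ∧ ztt 0 = Lam (-s) k ε w₀ ∧
          -- (i)
          IsSolution q s p k ε ν (T₁ + 𝒯₁) A₀ t₁ z zt ztt ∧
          -- (ii)
          (∀ t ∈ Set.Icc 0 t₁,
            z t = band k (z t) ∧ zt t = band k (zt t) ∧ ztt t = band k (ztt t)) ∧
          -- (iii)
          ContinuousOn (fun t => Lam s k ε (z t)) (Set.Icc 0 t₁) ∧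
          ContinuousOn (fun t => Lam s k ε (zt t)) (Set.Icc 0 t₁) ∧
          (∀ t ∈ Set.Icc 0 t₁,
            ‖Lam s k ε (z t)‖ ≤ 3 * sobNorm s A₀ ∧
            (freq p k)⁻¹ * ‖Lam s k ε (zt t)‖ ≤ 3 * sobNorm s A₀) ∧
          -- (iv)
          (∀ t ∈ Set.Icc 0 t₁,
            |controlNorm s p k ε ν A₀ (ztt t) - lam₀| ≤ 1 / 2 * (1 - lam₀))) := by
  obtain ⟨𝒞, h𝒞, H⟩ := mainTheorem3_general
  refine ⟨𝒞, h𝒞, fun q s hq hq3 hs => ?_⟩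
  have hs0 : 0 < s := by
    have hq1 : (2 : ℝ) ≤ q - 1 := le_sub_iff_add_le.2 (by norm_num; exact_mod_cast hq3)
    linarith [div_le_one_of_le₀ hq1 (by linarith)]
  obtain ⟨K, hK, H⟩ := H q s hq hs0
  refine ⟨K, hK, fun p k hp hk => ?_⟩
  obtain ⟨t₀, ht₀, H⟩ := H p k hp hk
  refine ⟨t₀, ht₀, fun ν Tmax a hν1 hν2 hTmax ha => ⟨fun N b hN => ?_, ?_⟩⟩
  · obtain ⟨ε₀, hε₀, hcompat⟩ := (H ν Tmax a hν1 hν2.le hTmax ha).1 N b (by linarith)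
    refine ⟨ε₀, hε₀, fun ε hε hlt A₀ hA hAs hAN T₁ 𝒯₁ hT₁ h𝒯₁ hT => ?_⟩
    obtain ⟨w, hw, hwle⟩ := hcompat ε hε hlt A₀ hA hAs hAN (T₁ + 𝒯₁) (by positivity) hT
    have hν : 1 / (2 * ν ^ 2) < 1 / 2 := one_div_lt_one_div_of_lt two_pos (by nlinarith)
    exact ⟨w, hw, hwle, by linarith⟩
  · obtain ⟨ε₀, hε₀, hsol⟩ := (H ν Tmax a hν1 hν2.le hTmax ha).2
    refine ⟨ε₀, hε₀, ?_⟩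
    rintro ε hε hlt A₀ N hN hA hAs hsmall T₁ 𝒯₁ hT₁ h𝒯₁ hT u₀ v₀ w₀ (hu : IsBandLimited k u₀)
      (hv : IsBandLimited k v₀) - hu₀ hv₀ - hsup hcomp _ rfl hlam hderiv
    obtain ⟨t₁, ht₁, z, v, w, hz0, hv0, hw0, h⟩ := hsol ε hε hlt A₀ N (by linarith) hA hAs hsmall
      (T₁ + 𝒯₁) _ _ _ (by positivity) hT ⟨hu.isBandLimited_Lam, hv.isBandLimited_Lam,
        by rwa [hu.Lam_Lam_neg], by rwa [hv.Lam_Lam_neg], hsup, hcomp⟩ hlam hderiv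
    exact ⟨t₁, ht₁, z, v, w, hz0, hv0, hw0, h.isSolution, h.isBandLimited, h.continuousOn_Lam_fst,
      h.continuousOn_Lam_snd, h.norm_Lam_le, hw0 ▸ h.abs_controlNorm_sub_le⟩
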